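/- Let $N\ge 1$, let $\Gamma=(\delta_{i,j+1})_{ij}\in gl(N,\mathbb C)$ and $Z_N=\mathbb C[\Gamma]\cong\mathbb C[\Gamma]/(\Gamma^N)$. Functions of $t=(t_1,t_3,t_5,\dots)$ are formal power series with coefficients in $Z_N$, $x=t_1$, $\partial=\partial_x$. Let $\Phi=1+\sum_{i\ge1}a_i(t)\partial^{-i}$ be a $Z_N$-valued dressing operator of the commutative multi-component BKP hierarchy: $\Phi^*=\partial\,\Phi^{-1}\partial^{-1}$ and $\partial\Phi/\partial t_{2n-1}=-(L^{2n-1})_-\Phi$ for all $n\ge 1$, where $L=\Phi\partial\Phi^{-1}$. Put $\xi=\sum_{i>0\ \mathrm{odd}}t_iz^i$, $w=\Phi e^{\xi}$, and let $\tau(t)$ be an invertible $Z_N$-valued power series (a tau function) with $$w(t,z)=\frac{\tau(t-2[z^{-1}])}{\tau(t)}e^{\xi(t,z)},\qquad [z]=(z,z^3/3,z^5/5,\dots).$$ Let $M=\Phi\big(\sum_{i>0\ \mathrm{odd}}i t_i\partial^{i-1}\big)\Phi^{-1}$ and $B_{p,s}=M^pL^s-(-1)^sL^{s-1}M^pL$.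 Fix $q=e^{\log q}\in\mathbb C^*$ together with a logarithm $\log q$, and integers $l,k\ge0$. Let $$D_{l,k}=e^{lM}q^{kL}-L^{-1}q^{-kL}e^{lM}L=\sum_{p,s\ge0}\frac{l^p(k\log q)^s}{p!\,s!}B_{p,s},$$ and let $\partial_{t^*_{l,k}}$ be the flow $\partial_{t^*_{l,k}}\Phi=-(D_{l,k})_-\Phi$, so that $\partial_{t^*_{l,k}}w=-(D_{l,k})_-\,w$. Let $X(\lambda,\mu)=\exp\Big(\sum_{i\ \mathrm{odd}}t_i(\mu^i-\lambda^i)\Big)\exp\Big(-2\sum_{i\ \mathrm{odd}}\frac{\mu^{-i}-\lambda^{-i}}{i}\partial_{t_i}\Big)$, and define the $W^B_\infty$ generators $Z^{(p+1)}_s$ by the expansion for $|\mu-\lambda|<|\lambda|$ $$\frac{1}{2\lambda}\,\frac{\mu+\lambda}{\mu-\lambda}\,\big(X(\lambda,\mu)-1\big)=\sum_{p\ge0}\frac{(\mu-\lambda)^p}{p!}\sum_{s\in\mathbb Z}\lambda^{-s-1}\frac{Z^{(p+1)}_s}{p+1}.$$ Let $$L^B_{l,k}=\sum_{p,s\ge0}\frac{l^p(k\log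 q)^s}{p!\,s!}\,\frac{Z^{(p+1)}_s}{p+1},$$ and suppose that the double series $L^B_{l,k}\tau$ converges (each coefficient of a monomial in $t$ is a summable family in $Z_N$). Then the series defining $(D_{l,k})_-$ converges in the same coefficientwise sense, and $$\partial_{t^*_{l,k}}w=0\quad\Longleftrightarrow\quad L^B_{l,k}\tau=c\,\tau\ \text{ for some constant } c\in Z_N .$$ -/

import Mathlib

noncomputable section

namespace CMBKP

/-! ### The commutative algebra `Z_N` -/

/-- The shift matrix `Γ = (δ_{i,j+1})_{ij} ∈ gl(N, ℂ)`. -/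
def shiftMatrix (N : ℕ) : Matrix (Fin N) (Fin N) ℂ :=
  Matrix.of fun i j => if (i : ℕ) = (j : ℕ) + 1 then 1 else 0

/-- `Z_N = ℂ[Γ] ≅ ℂ[Γ]/(Γ^N)`, the commutative subalgebra of `gl(N, ℂ)` generated by `Γ`
(with the topology inherited from `gl(N, ℂ)`). -/
abbrev ZN (N : ℕ) : Type :=
  ↥(Algebra.adjoin ℂ ({shiftMatrix N} : Set (Matrix (Fin N) (Fin N) ℂ)))

open scoped IsMulCommutative in
instance instCommRingZN (N : ℕ) : CommRing (ZN N) := inferInstance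

/-! ### Functions of the times

Functions of `t = (t₁, t₃, t₅, …)` are formal power series; the variable with index `i : ℕ` is
`t_{2i+1}`, and `x = t₁`. The coefficient ring `R` will be `Z_N`. -/

/-- Formal power series in `t₁, t₃, t₅, …` with coefficients in `R`. -/
abbrev TimeFn (R : Type) : Type := MvPowerSeries ℕ R

/-- `∑ᵢ (2i+1) βᵢ`, where `t_{2i+1}` has weight `2i+1`. -/
def weight (β : ℕ →₀ ℕ) : ℕ := β.sum fun i b => (2 * i + 1) * b

section

variable {R : Type} [CommRing R]

/-- `∏ᵢ (∂/∂t_{2i+1})^{βᵢ} f`; on coefficients,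
`t^(δ+β) ↦ (∏ᵢ (δᵢ+βᵢ)!/δᵢ!) t^δ`. -/
def timeDeriv (β : ℕ →₀ ℕ) (f : TimeFn R) : TimeFn R :=
  fun δ => (β.prod fun i b => (δ i + b).descFactorial b) • MvPowerSeries.coeff (δ + β) f

/-- `∂_x^n f`, where `x = t₁`. -/
def dx (n : ℕ) (f : TimeFn R) : TimeFn R := timeDeriv (Finsupp.single 0 n) f

/-! ### Pseudo-differential operators -/

/-- A formal operator `∑_{j ∈ ℤ} P_j(t) ∂^j`, `∂ = ∂_x`, given by its coefficients. -/
abbrev PsiDO (R : Type) : Type := ℤ → TimeFn R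

/-- The operator `∂^n`. -/
def dPow (n : ℤ) : PsiDO R := fun k => if k = n then 1 else 0

/-- Composition: `(a ∂^i) ∘ (b ∂^j) = ∑_{n ≥ 0} (i choose n) a (∂_x^n b) ∂^{i+j-n}`, extended to
infinite sums. Every coefficient of every monomial in `t` is a finite sum for operators that, at each
monomial in `t₃, t₅, …`, have order bounded above uniformly in the power of `x`; these operators
(power series in `t₃, t₅, …` with values in ordinary pseudo-differential operators in `x`) are closed
under composition, and `Φ`, `Φ⁻¹`, `∂^n`, `Γ_B` below are among them. -/
def comp (P Q : PsiDO R) : PsiDO R := fun k α =>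
  ∑ᶠ p : ℤ × ℕ, MvPowerSeries.coeff α
    (Ring.choose p.1 p.2 • (P p.1 * dx p.2 (Q (k - p.1 + p.2))))

/-- The `n`-fold composition power. -/
def pow (P : PsiDO R) : ℕ → PsiDO R
  | 0 => dPow 0
  | n + 1 => comp (pow P n) P

/-- The inverse of `P = 1 + ∑_{j<0} P_j ∂^j`: the Neumann series `∑_n (1 - P)^n`. Since `(1 - P)^n`
has order at most `-n`, the coefficient of `∂^k` involves only `n ≤ -k`. -/
def inv (P : PsiDO R) : PsiDO R := fun k =>
  ∑ n ∈ Finset.range ((-k).toNat + 1), pow (dPow 0 - P) n k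

/-- The formal adjoint `P^* = ∑_i (-1)^i ∂^i ∘ P_i` of an operator of order bounded above (the
entries `P_i` are symmetric under `*` because the coefficients commute). The coefficient of `∂^k` is
`∑_n (-1)^{k+n} (k+n choose n) ∂_x^n P_{k+n}`. -/
def adjoint (P : PsiDO R) : PsiDO R := fun k α =>
  ∑ᶠ n : ℕ, MvPowerSeries.coeff α
    ((((k + n).negOnePow : ℤ) * Ring.choose (k + n) n) • dx n (P (k + n)))

/-- The projection `P_- = ∑_{j<0} P_j ∂^j`. -/
def negPart (P : PsiDO R) : PsiDO R := fun k => if k < 0 then P k else 0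

/-! ### The hierarchy -/

/-- `L^n = Φ ∂^n Φ⁻¹` for `n ∈ ℤ`; in particular `L = Φ ∂ Φ⁻¹`. -/
def laxPow (Φ : PsiDO R) (n : ℤ) : PsiDO R := comp (comp Φ (dPow n)) (inv Φ)

/-- `Φ` is a dressing operator of a solution of the hierarchy. -/
structure IsDressing (Φ : PsiDO R) : Prop where
  /-- `Φ = 1 + ∑_{i ≥ 1} a_i ∂^{-i}` -/
  order_le : ∀ j : ℤ, 0 < j → Φ j = 0
  monic : Φ 0 = 1
  /-- the B type condition `Φ^* = ∂ Φ⁻¹ ∂⁻¹` -/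
  bType : adjoint Φ = comp (comp (dPow 1) (inv Φ)) (dPow (-1))
  /-- `∂Φ/∂t_{2i+1} = -(L^{2i+1})_- Φ` -/
  flow : ∀ (i : ℕ) (j : ℤ), timeDeriv (Finsupp.single i 1) (Φ j) =
    -comp (negPart (laxPow Φ (2 * i + 1))) Φ j

/-- `Γ_B = ∑_{i odd > 0} i t_i ∂^{i-1}`. -/
def gammaB : PsiDO R := fun j =>
  if 0 ≤ j ∧ Even j then (j + 1) • (MvPowerSeries.X (j / 2).toNat : TimeFn R) else 0

/-- The Orlov–Shulman operator `M = Φ Γ_B Φ⁻¹`. -/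
def orlov (Φ : PsiDO R) : PsiDO R := comp (comp Φ gammaB) (inv Φ)

/-- `B_{m,n} = M^m L^n - (-1)^n L^{n-1} M^m L`. -/
def opB (Φ : PsiDO R) (m n : ℕ) : PsiDO R :=
  comp (pow (orlov Φ) m) (laxPow Φ n) -
    ((-1 : ℤ) ^ n) • comp (comp (laxPow Φ ((n : ℤ) - 1)) (pow (orlov Φ) m)) (laxPow Φ 1)

/-- Formal functions `f(t, z) e^{ξ(t,z)}` with `ξ(t,z) = ∑_{k odd > 0} t_k z^k`, recorded by the
coefficients of `z^j` in `f = ∑_{j ∈ ℤ} f_j(t) z^j`. -/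
abbrev WaveFn (R : Type) : Type := ℤ → TimeFn R

/-- `P · e^ξ = (∑_j P_j z^j) e^ξ`, since `∂^j e^ξ = z^j e^ξ`. -/
def applyExp (P : PsiDO R) : WaveFn R := fun j => P j

/-- The wave function `w = Φ · e^ξ`. -/
def wave (Φ : PsiDO R) : WaveFn R := applyExp Φ

variable [Algebra ℂ R]

/-! ### Tau functions -/

/-- The coefficient of `z^{-n}` in
`f(t - 2[z⁻¹]) = ∑_β (∏ᵢ (-2 z^{-(2i+1)}/(2i+1))^{βᵢ} / βᵢ!) ∂^β f(t)`,
where `[z] = (z, z³/3, z⁵/5, …)`. -/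
def shiftCoeff (f : TimeFn R) (n : ℕ) : TimeFn R := fun α =>
  ∑ᶠ β : ℕ →₀ ℕ, if weight β = n then
    (β.prod fun i b => (-2 / (2 * i + 1) : ℂ) ^ b / (b.factorial : ℂ)) •
      MvPowerSeries.coeff α (timeDeriv β f) else 0

/-- `τ` is an (invertible) tau function of the wave function `w = Φ · e^ξ`:
`w(t, z) = τ(t - 2[z⁻¹])/τ(t) · e^ξ`. -/
def IsTau (Φ : PsiDO R) (τ : TimeFn R) : Prop :=
  IsUnit τ ∧ ∀ j : ℤ, τ * wave Φ j = if j ≤ 0 then shiftCoeff τ (-j).toNat else 0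

/-! ### The generators of `W^B_∞`

They are the modes, in the expansion at `μ = λ` for `|μ - λ| < |λ|`, of the vertex operator
`X(λ,μ) = exp(∑_{i odd} t_i (μ^i - λ^i)) exp(-2 ∑_{i odd} (μ^{-i} - λ^{-i})/i · ∂/∂t_i)`.
With `μ = λ(1 + u)`, so that `μ^i - λ^i = λ^i((1+u)^i - 1)`, this reads
`X = ∑_{γ,β} λ^{weight γ - weight β} K_{γ,β}(u) t^γ ∂^β`, where `K_{γ,β}` is `vertexSeries γ β`. -/

/-- `∏ᵢ ((1+u)^{2i+1} - 1)^{γᵢ}/γᵢ! · ∏ᵢ (-2/(2i+1) · ((1+u)^{-(2i+1)} - 1))^{βᵢ}/βᵢ!`, as a power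
series in `u`. -/
def vertexSeries (γ β : ℕ →₀ ℕ) : PowerSeries ℂ :=
  (γ.prod fun i c => ((c.factorial : ℂ)⁻¹) •
    ((1 + PowerSeries.X) ^ (2 * i + 1) - 1 : PowerSeries ℂ) ^ c) *
  (β.prod fun i b => ((-2 / (2 * i + 1) : ℂ) ^ b / (b.factorial : ℂ)) •
    (((1 + PowerSeries.X)⁻¹) ^ (2 * i + 1) - 1 : PowerSeries ℂ) ^ b)

/-- The coefficient of `u^m λ^{-r}` in `X(λ, λ(1+u)) f`. -/
def vertexMode (m : ℕ) (r : ℤ) (f : TimeFn R) : TimeFn R := fun α =>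
  ∑ᶠ p : (ℕ →₀ ℕ) × (ℕ →₀ ℕ), if (weight p.1 : ℤ) - weight p.2 = -r then
    PowerSeries.coeff m (vertexSeries p.1 p.2) •
      MvPowerSeries.coeff α (MvPowerSeries.monomial p.1 (1 : R) * timeDeriv p.2 f) else 0

/-- The modes `W_r^{(m)}` of the normal ordered vertex operator:
`X(λ,μ) - 1 = ∑_{m ≥ 1} (μ-λ)^m/m! ∑_r λ^{-r-m} W_r^{(m)}`. -/
def opW (m : ℕ) (r : ℤ) (f : TimeFn R) : TimeFn R :=
  if m = 0 then 0 else (m.factorial : ℂ) • vertexMode m r f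

/-- The generator `Z_s^{(p+1)}` of `W^B_∞`, defined by
`(1/(2λ)) (μ+λ)/(μ-λ) (X(λ,μ) - 1) = ∑_p (μ-λ)^p/p! ∑_s λ^{-s-1} Z_s^{(p+1)}/(p+1)`,
that is `Z_s^{(p+1)} = W_{s-p}^{(p+1)} + (p+1)/2 · W_{s-p}^{(p)}`. -/
def opZ (p s : ℕ) (f : TimeFn R) : TimeFn R :=
  opW (p + 1) ((s : ℤ) - p) f + (((p : ℂ) + 1) / 2) • opW p ((s : ℤ) - p) f

/-! ### The quantum torus flows and the operator `L^B_{l,k}`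

`logq` is a logarithm of the quantum parameter `q`. Series over `(p, s)` are summed coefficientwise. -/

/-- `l^p (k log q)^s / (p! s!)`. -/
def torusCoeff (logq : ℂ) (l k : ℕ) (a : ℕ × ℕ) : ℂ :=
  (l : ℂ) ^ a.1 * ((k : ℂ) * logq) ^ a.2 / ((a.1.factorial : ℂ) * (a.2.factorial : ℂ))

/-- The `(p,s)` term of the coefficient of `t^α ∂^j` in `D_{l,k}`. -/
def termD (logq : ℂ) (Φ : PsiDO R) (l k : ℕ) (j : ℤ) (α : ℕ →₀ ℕ) (a : ℕ × ℕ) : R :=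
  torusCoeff logq l k a • MvPowerSeries.coeff α (opB Φ a.1 a.2 j)

/-- The `(p,s)` term of the coefficient of `t^α` in `L^B_{l,k} f`. -/
def termLB (logq : ℂ) (l k : ℕ) (f : TimeFn R) (α : ℕ →₀ ℕ) (a : ℕ × ℕ) : R :=
  torusCoeff logq l k a • MvPowerSeries.coeff α (((a.1 : ℂ) + 1)⁻¹ • opZ a.1 a.2 f)

variable [TopologicalSpace R]

/-- `D_{l,k} = e^{lM} q^{kL} - L⁻¹ q^{-kL} e^{lM} L`, with the exponentials `e^{lM}` and
`q^{kL} = e^{k log q L}` expanded: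
`D_{l,k} = ∑_{p,s} l^p (k log q)^s/(p! s!) (M^p L^s - (-1)^s L^{s-1} M^p L)`. -/
def opD (logq : ℂ) (Φ : PsiDO R) (l k : ℕ) : PsiDO R := fun j α =>
  ∑' a : ℕ × ℕ, termD logq Φ l k j α a

/-- `∂w/∂t*_{l,k}`: the flow is `∂Φ/∂t*_{l,k} = -(D_{l,k})_- Φ`, and `w = Φ · e^ξ` with `ξ` independent
of `t*_{l,k}`. -/
def torusFlowWave (logq : ℂ) (Φ : PsiDO R) (l k : ℕ) : WaveFn R :=
  applyExp (-comp (negPart (opD logq Φ l k)) Φ)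

/-- `L^B_{l,k} f = ∑_{p,s} l^p (k log q)^s/(p! s!) Z_s^{(p+1)} f / (p+1)`. -/
def opLB (logq : ℂ) (l k : ℕ) (f : TimeFn R) : TimeFn R := fun α =>
  ∑' a : ℕ × ℕ, termLB logq l k f α a

end

end CMBKP

end

/-! The proof rests on the Adler–Shiota–van Moerbeke formula, which turns additional symmetries of
`w` into vertex-operator symmetries of `τ`.

Since `Γ_B e^ξ = ∂_z e^ξ`, the operators `M` and `L` act on `w = Φ e^ξ` as `∂_z` and multiplication
by `z`. Hence `B_{p,s} w = z^s ∂_z^p w - (-1)^s z ∂_z^p (z^{s-1} w)` (`mode_orlovB`). On the other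
side put `V(z) f = f(t - 2[z⁻¹]) e^ξ`, so that `V(z) τ = τ w`. The two orders of `V(z)` and `X(λ,μ)`
differ by the same rational function of `z` expanded at infinity and at zero, so their commutator is
carried by delta functions at `z = λ` and `z = -μ` (`commDefect_eq_zero`). Extracting modes shows
that commuting `V(z)` past `Z_s^{(p+1)}/(p+1)` produces the same differential operator in `z` that
describes `B_{p,s}` (`V_genZ`).

The B type condition and the flows give the bilinear identity: the `z^0` coefficient of `w(t,z)
w(t',-z)` is `1` (`Dressing.bilinear`). Multiply it by `τ(t)` and apply `Z_s^{(p+1)}/(p+1)` in the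
variables `t` only. With `g = Z_s^{(p+1)} τ/(p+1)`, combining this with the commutator yields
`(B_{p,s})_- w = (g/τ) w - V(z) g/τ` (`neg_orlovB`).

Each coefficient of the right side is a finite linear combination of coefficients of `g`.
Coefficientwise convergence of `L^B τ` therefore passes to `(D_{l,k})_-`, and the formula persists
with `g = L^B τ`. It says that `(D_{l,k})_- w` is `w` times the difference of `g/τ` and its shift by
`-2[z⁻¹]`. The flow is thus trivial exactly when `g/τ` is invariant under the shift, and expanding
in `z⁻¹` forces every derivative of `g/τ` to vanish (`pderiv_eq_zero_of_shiftOp`). -/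

noncomputable section

namespace CMBKP

open MvPowerSeries (coeff C X monomial pderiv)
open Finset.HasAntidiagonal (antidiagonal mem_antidiagonal)

/-! ### Formal summation of time functions: coefficientwise stabilisation. -/

section Topology

variable {R : Type} [CommRing R] {ι : Type*}

/-- The topology of coefficientwise stabilisation: the product of discrete topologies. -/
instance timeFnTopology : TopologicalSpace (TimeFn R) :=
  @Pi.topologicalSpace (ℕ →₀ ℕ) (fun _ => R) (fun _ => ⊥)

instance : IsTopologicalRing (TimeFn R) := by
  let _ : TopologicalSpace R := ⊥
  have : DiscreteTopology R := ⟨rfl⟩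
  exact MvPowerSeries.WithPiTopology.instIsTopologicalRing ..

instance : T3Space (TimeFn R) := by
  let _ : TopologicalSpace R := ⊥
  have : DiscreteTopology R := ⟨rfl⟩
  exact inferInstanceAs (T3Space ((ℕ →₀ ℕ) → R))

theorem timeFn_summable_of_finite {F : ι → TimeFn R}
    (h : ∀ α, {i | coeff α (F i) ≠ 0}.Finite) : Summable F := by
  let _ : TopologicalSpace R := ⊥
  have : DiscreteTopology R := ⟨rfl⟩
  exact MvPowerSeries.WithPiTopology.summable_iff_summable_coeff.2
    fun α => summable_of_hasFiniteSupport (h α)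

theorem timeFn_hasSum_of_finsum {F : ι → TimeFn R} {G : TimeFn R}
    (h : ∀ α, {i | coeff α (F i) ≠ 0}.Finite) (hG : ∀ α, coeff α G = ∑ᶠ i, coeff α (F i)) :
    HasSum F G := by
  let _ : TopologicalSpace R := ⊥
  have : DiscreteTopology R := ⟨rfl⟩
  refine MvPowerSeries.WithPiTopology.hasSum_iff_hasSum_coeff.2 fun α => ?_
  have h1 : Summable fun i => coeff α (F i) := summable_of_hasFiniteSupport (h α)
  rw [hG, ← tsum_eq_finsum (L := SummationFilter.unconditional _) (h α)]
  exact h1.hasSum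

theorem timeFn_hasSum_coeff {F : ι → TimeFn R} {G : TimeFn R} (h : HasSum F G) (α : ℕ →₀ ℕ) :
    {i | coeff α (F i) ≠ 0}.Finite ∧ coeff α G = ∑ᶠ i, coeff α (F i) := by
  let _ : TopologicalSpace R := ⊥
  have : DiscreteTopology R := ⟨rfl⟩
  have h1 := MvPowerSeries.WithPiTopology.hasSum_iff_hasSum_coeff.1 h α
  have h2 : {i | coeff α (F i) ≠ 0}.Finite := by
    have := h1.summable.hasFiniteSupport_of_discreteTopology
    exact this
  exact ⟨h2, by rw [← tsum_eq_finsum (L := SummationFilter.unconditional _) h2, h1.tsum_eq]⟩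

/-- A linear operator is continuous if each coefficient of its values depends on finitely many
coefficients of the argument. -/
theorem continuous_of_local (T : TimeFn R →+ TimeFn R) (A : (ℕ →₀ ℕ) → Finset (ℕ →₀ ℕ))
    (h : ∀ f α, (∀ δ ∈ A α, coeff δ f = 0) → coeff α (T f) = 0) : Continuous T := by
  let _ : TopologicalSpace R := ⊥
  have : DiscreteTopology R := ⟨rfl⟩
  refine continuous_pi fun α => ?_
  rw [continuous_discrete_rng]
  intro b
  rw [isOpen_iff_mem_nhds]
  intro f hf
  have h2 : {g : TimeFn R | ∀ δ ∈ A α, coeff δ g = coeff δ f} ∈ nhds f := by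
    have : {g : TimeFn R | ∀ δ ∈ A α, coeff δ g = coeff δ f}
        = Set.pi (A α) (fun δ => {coeff δ f}) := by
      ext g; rfl
    rw [this]
    exact set_pi_mem_nhds (A α).finite_toSet fun δ _ => (isOpen_discrete _).mem_nhds rfl
  refine Filter.mem_of_superset h2 fun g hg => ?_
  have h3 := h (g - f) α fun δ hδ => by rw [map_sub, hg δ hδ, sub_self]
  rw [map_sub, map_sub, sub_eq_zero] at h3
  exact h3.trans hf

/-- Converse of `continuous_of_local`: into a discrete ring, continuity at `0` is already dependence
on finitely many coefficients. This lets formal operators be applied to sums converging in another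
topology of `R`. -/
theorem exists_finset_of_continuous (T : TimeFn R →+ TimeFn R) (hT : Continuous T) (α : ℕ →₀ ℕ) :
    ∃ A : Finset (ℕ →₀ ℕ), ∀ f, (∀ δ ∈ A, coeff δ f = 0) → coeff α (T f) = 0 := by
  let _ : TopologicalSpace R := ⊥
  have : DiscreteTopology R := ⟨rfl⟩
  have h1 : Continuous fun f => coeff α (T f) := (continuous_apply α).comp hT
  have h0 : (0 : TimeFn R) ∈ (fun f => coeff α (T f)) ⁻¹' {0} := by simp
  obtain ⟨A, u, hu, hs⟩ := isOpen_pi_iff.1 ((isOpen_discrete ({0} : Set R)).preimage h1) 0 h0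
  refine ⟨A, fun f hf => hs fun δ hδ => ?_⟩
  have h2 := (hu δ hδ).2
  rwa [show f δ = (0 : TimeFn R) δ from hf δ hδ]

theorem timeFn_hasSum_monomials (f : TimeFn R) :
    HasSum (fun d : ℕ →₀ ℕ => monomial d (coeff d f)) f := by
  let _ : TopologicalSpace R := ⊥
  have : DiscreteTopology R := ⟨rfl⟩
  exact MvPowerSeries.WithPiTopology.hasSum_of_monomials_self f

end Topology

/-! ### Derivatives in the times and the Leibniz rule. -/

section Derivatives

variable {R : Type} [CommRing R]

theorem timeDeriv_coeff (β : ℕ →₀ ℕ) (f : TimeFn R) (δ : ℕ →₀ ℕ) :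
    coeff δ (timeDeriv β f) =
      (β.prod fun i b => (δ i + b).descFactorial b) • coeff (δ + β) f := rfl

theorem timeDeriv_zero (f : TimeFn R) : timeDeriv 0 f = f := by
  ext δ; simp [timeDeriv_coeff]

theorem timeDeriv_single (i : ℕ) (f : TimeFn R) :
    timeDeriv (Finsupp.single i 1) f = pderiv R i f := by
  ext δ
  rw [timeDeriv_coeff, MvPowerSeries.coeff_pderiv, Finsupp.prod_single_index (by simp)]
  simp [mul_comm]

theorem timeDeriv_add_single (β : ℕ →₀ ℕ) (i : ℕ) (f : TimeFn R) :
    timeDeriv (β + Finsupp.single i 1) f = pderiv R i (timeDeriv β f) := by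
  ext δ
  rw [MvPowerSeries.coeff_pderiv, timeDeriv_coeff, timeDeriv_coeff, add_right_comm, ← add_assoc,
    nsmul_eq_mul, nsmul_eq_mul, mul_right_comm]
  congr 1
  have key : ((β + Finsupp.single i 1).prod fun i b => (δ i + b).descFactorial b) =
      (β.prod fun j b => ((δ + Finsupp.single i 1 : ℕ →₀ ℕ) j + b).descFactorial b) * (δ i + 1) := by
    rw [Finsupp.prod_of_support_subset _ (s := insert i β.support) _ _ (by simp),
      Finsupp.prod_of_support_subset _ (s := insert i β.support) _ _ (by simp)]
    · rw [← Finset.mul_prod_erase _ _ (Finset.mem_insert_self i _),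
        ← Finset.mul_prod_erase (insert i β.support) _ (Finset.mem_insert_self i _), mul_right_comm]
      congr 1
      · simp only [Finsupp.add_apply, Finsupp.single_eq_same]
        rw [Nat.descFactorial_succ, mul_comm]
        congr 2 <;> omega
      · refine Finset.prod_congr rfl fun j hj => ?_
        simp [(Finset.ne_of_mem_erase hj).symm]
    · exact Finset.subset_insert _ _
    · intro j hj
      simp only [Finsupp.mem_support_iff, Finsupp.add_apply, Finsupp.single_apply] at hj
      simp only [Finset.mem_insert, Finsupp.mem_support_iff]
      grind
  rw [key]; push_cast; ring

theorem dx_zero (f : TimeFn R) : dx 0 f = f := by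
  rw [dx, Finsupp.single_zero, timeDeriv_zero]

theorem dx_succ (n : ℕ) (f : TimeFn R) : dx (n + 1) f = pderiv R 0 (dx n f) := by
  rw [dx, Finsupp.single_add, timeDeriv_add_single]; rfl

theorem dx_one (f : TimeFn R) : dx 1 f = pderiv R 0 f := by
  rw [dx_succ, dx_zero]

theorem pderiv_comm (i j : ℕ) (f : TimeFn R) :
    pderiv R i (pderiv R j f) = pderiv R j (pderiv R i f) := by
  rw [← timeDeriv_single j f, ← timeDeriv_add_single, add_comm, timeDeriv_add_single,
    timeDeriv_single]

theorem continuous_pderiv (i : ℕ) : Continuous (pderiv R i : TimeFn R → TimeFn R) := by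
  refine continuous_of_local ((pderiv R i : TimeFn R →ₗ[R] TimeFn R).toAddMonoidHom)
    (fun α => {α + Finsupp.single i 1}) fun f α h => ?_
  have := h _ (Finset.mem_singleton_self _)
  change coeff α (pderiv R i f) = 0
  rw [MvPowerSeries.coeff_pderiv, this, zero_mul]

/-- `∂_x^n` as a linear map. -/
def dxL (n : ℕ) : TimeFn R →ₗ[R] TimeFn R := (pderiv R 0 : TimeFn R →ₗ[R] TimeFn R) ^ n

theorem dxL_apply (n : ℕ) (f : TimeFn R) : dxL n f = dx n f := by
  induction n with
  | zero => rw [dx_zero]; rfl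
  | succ n ih => rw [dx_succ, ← ih, dxL, pow_succ']; rfl

theorem dx_add (m n : ℕ) (f : TimeFn R) : dx (m + n) f = dx m (dx n f) := by
  simp only [← dxL_apply, dxL, pow_add]; rfl

theorem dx_map_add (n : ℕ) (f g : TimeFn R) : dx n (f + g) = dx n f + dx n g := by
  simp only [← dxL_apply, map_add]

theorem dx_map_zero (n : ℕ) : dx n (0 : TimeFn R) = 0 := by
  rw [← dxL_apply, map_zero]

theorem dx_map_zsmul (n : ℕ) (a : ℤ) (f : TimeFn R) : dx n (a • f) = a • dx n f := by
  simp only [← dxL_apply, map_zsmul]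

theorem dx_one_of_pos {n : ℕ} (hn : n ≠ 0) : dx n (1 : TimeFn R) = 0 := by
  obtain ⟨m, rfl⟩ := Nat.exists_eq_succ_of_ne_zero hn
  rw [Nat.succ_eq_add_one, dx_add, dx_one, MvPowerSeries.pderiv_one, dx_map_zero]

theorem continuous_dx (n : ℕ) : Continuous (dx n : TimeFn R → TimeFn R) := by
  induction n with
  | zero => exact continuous_id.congr fun f => (dx_zero f).symm
  | succ n ih =>
    have : (dx (n + 1) : TimeFn R → TimeFn R) = fun f => pderiv R 0 (dx n f) :=
      funext (dx_succ n)
    rw [this]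
    exact (continuous_pderiv 0).comp ih

/-- The Leibniz rule for `∂_x^n`. -/
theorem dx_mul (n : ℕ) (f g : TimeFn R) : dx n (f * g) =
    ∑ ij ∈ Finset.HasAntidiagonal.antidiagonal n, n.choose ij.1 • (dx ij.1 f * dx ij.2 g) := by
  induction n with
  | zero => simp [dx_zero]
  | succ n ih =>
    rw [dx_succ, ih, map_sum, Finset.sum_antidiagonal_choose_succ_nsmul
      (fun i j => dx i f * dx j g), ← Finset.sum_add_distrib]
    refine Finset.sum_congr rfl fun ij hij => ?_
    have : n.choose ij.2 = n.choose ij.1 := by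
      rw [← Nat.choose_symm_of_eq_add (Finset.HasAntidiagonal.mem_antidiagonal.1 hij).symm]
    rw [this, map_nsmul, Derivation.leibniz, ← dx_succ, ← dx_succ, smul_eq_mul, smul_eq_mul,
      smul_add, mul_comm (dx ij.2 g)]

end Derivatives

/-! ### Two gradings of the times, by `2i+1` and by `2i`. -/

section Filtration

variable {R : Type} [CommRing R]

/-- The additive function on exponents with value `a i` on the `i`-th variable. -/
def linWeight (a : ℕ → ℕ) : (ℕ →₀ ℕ) →+ ℕ where
  toFun α := α.sum fun i b => a i * b
  map_zero' := Finsupp.sum_zero_index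
  map_add' _ _ := Finsupp.sum_add_index' (by simp) (fun i b c => mul_add _ _ _)

theorem linWeight_single (a : ℕ → ℕ) (i b : ℕ) : linWeight a (Finsupp.single i b) = a i * b :=
  Finsupp.sum_single_index (by simp)

/-- `weight` as an additive map. -/
abbrev wt : (ℕ →₀ ℕ) →+ ℕ := linWeight fun i => 2 * i + 1

theorem weight_eq_wt (α : ℕ →₀ ℕ) : weight α = wt α := rfl

/-- The weight in which `t_{2i+1}` has weight `2i`, so that `x` has weight `0`. -/
abbrev wx : (ℕ →₀ ℕ) →+ ℕ := linWeight fun i => 2 * i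

theorem wx_le_wt (α : ℕ →₀ ℕ) : wx α ≤ wt α :=
  Finset.sum_le_sum fun i _ => Nat.mul_le_mul_right _ (by simp)

/-- Every variable has positive weight here. The analogue for `wx` fails, because `x` has weight `0`
there. -/
theorem finite_wt_le (n : ℕ) : {α : ℕ →₀ ℕ | wt α ≤ n}.Finite := by
  refine Set.Finite.subset (Finset.finite_toSet
    (Finset.Iic (Finsupp.indicator (Finset.range (n + 1)) fun _ _ => n))) fun α hα => ?_
  rw [Finset.mem_coe, Finset.mem_Iic]
  have key : ∀ i ∈ α.support, (2 * i + 1) * α i ≤ n := fun i hi =>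
    (Finset.single_le_sum (f := fun i => (2 * i + 1) * α i) (fun _ _ => Nat.zero_le _) hi).trans hα
  intro i
  by_cases hi : α i = 0
  · rw [hi]; exact Nat.zero_le _
  · have h1 := key i (Finsupp.mem_support_iff.2 hi)
    have h2 : 1 ≤ α i := Nat.one_le_iff_ne_zero.2 hi
    have h3 : i < n + 1 := by nlinarith
    rw [Finsupp.indicator_of_mem (Finset.mem_range.2 h3)]
    nlinarith

/-- `f` only has monomials of `w`-weight at least `c`. -/
def Fil (w : (ℕ →₀ ℕ) →+ ℕ) (c : ℤ) (f : TimeFn R) : Prop :=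
  ∀ α, coeff α f ≠ 0 → c ≤ w α

variable {w : (ℕ →₀ ℕ) →+ ℕ} {c d : ℤ} {f g : TimeFn R}

theorem Fil.mono (hf : Fil w c f) (h : d ≤ c) : Fil w d f := fun α hα => h.trans (hf α hα)

theorem Fil.eq_zero (hf : Fil w c f) {α : ℕ →₀ ℕ} (h : (w α : ℤ) < c) : coeff α f = 0 := by
  by_contra h1; exact absurd (hf α h1) (not_le.2 h)

theorem Fil.zero : Fil w c (0 : TimeFn R) := fun _ hα => absurd (map_zero _) hα

theorem Fil.of_nonpos (h : c ≤ 0) : Fil w c f := fun α _ => h.trans (by positivity)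

theorem Fil.add (hf : Fil w c f) (hg : Fil w c g) : Fil w c (f + g) := fun α hα => by
  by_cases h : coeff α f = 0
  · exact hg α fun h2 => hα (by rw [map_add, h, h2, add_zero])
  · exact hf α h

theorem Fil.neg (hf : Fil w c f) : Fil w c (-f) := fun α hα =>
  hf α fun h => hα (by rw [map_neg, h, neg_zero])

theorem Fil.mul (hf : Fil w c f) (hg : Fil w d g) : Fil w (c + d) (f * g) := fun α hα => by
  rw [MvPowerSeries.coeff_mul] at hα
  obtain ⟨p, hp, hne⟩ := Finset.exists_ne_zero_of_sum_ne_zero hα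
  have h1 := hf p.1 (left_ne_zero_of_mul hne)
  have h2 := hg p.2 (right_ne_zero_of_mul hne)
  rw [← mem_antidiagonal.1 hp, map_add]
  push_cast
  exact add_le_add h1 h2

theorem Fil.mul_right (hf : Fil w c f) : Fil w c (f * g) := by
  simpa using hf.mul (Fil.of_nonpos (f := g) (w := w) le_rfl)

theorem Fil.mul_left (hg : Fil w c g) : Fil w c (f * g) := by
  rw [mul_comm]; exact hg.mul_right

theorem Fil.zsmul (hf : Fil w c f) (a : ℤ) : Fil w c (a • f) := by
  rw [zsmul_eq_mul]; exact hf.mul_left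

theorem Fil.hasSum {ι : Type*} {F : ι → TimeFn R} (hF : ∀ i, Fil w c (F i)) (h : HasSum F g) :
    Fil w c g := fun α hα => by
  rw [(timeFn_hasSum_coeff h α).2] at hα
  by_contra h1
  exact hα (finsum_eq_zero_of_forall_eq_zero fun i => (hF i).eq_zero (not_le.1 h1))

/-- Giving `x` weight `0` is what makes the filtration stable under `∂_x`, and hence under
composition. -/
theorem Fil.dx (hf : Fil wx c f) (n : ℕ) : Fil wx c (dx n f) := fun α hα => by
  have h1 : coeff (α + Finsupp.single 0 n) f ≠ 0 := fun h => hα (by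
    rw [CMBKP.dx, timeDeriv_coeff, h, smul_zero])
  have := hf _ h1
  rwa [map_add, linWeight_single, mul_zero, zero_mul, add_zero] at this

theorem wx_add_single (α : ℕ →₀ ℕ) (i : ℕ) : wx (α + Finsupp.single i 1) = wx α + 2 * i := by
  rw [map_add, linWeight_single, mul_one]

theorem wt_add_single (α : ℕ →₀ ℕ) (i : ℕ) :
    wt (α + Finsupp.single i 1) = wt α + (2 * i + 1) := by
  rw [map_add, linWeight_single, mul_one]

end Filtration

section Sums

variable {R : Type} [CommRing R] {ι : Type*}

theorem hasSum_antidiagonal {F : ι × (ℕ × ℕ) → TimeFn R} {a : TimeFn R} (hF : HasSum F a) :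
    HasSum (fun x : ι × ℕ => ∑ ab ∈ antidiagonal x.2, F (x.1, ab)) a := by
  let e : (Σ x : ι × ℕ, antidiagonal x.2) ≃ ι × (ℕ × ℕ) :=
    { toFun := fun y => (y.1.1, y.2.1)
      invFun := fun z => ⟨(z.1, z.2.1 + z.2.2), ⟨z.2, by simp⟩⟩
      left_inv := by
        rintro ⟨⟨i, n⟩, ⟨ab, h⟩⟩
        obtain rfl := mem_antidiagonal.1 h
        rfl
      right_inv := fun z => rfl }
  refine ((e.hasSum_iff (f := F)).2 hF).sigma fun x => ?_
  simp only [Function.comp_def]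
  rw [← Finset.sum_coe_sort]
  exact hasSum_fintype _

end Sums

/-! ### Composition of pseudo-differential operators and its associativity. -/

section Comp

variable {R : Type} [CommRing R]

/-- `P` has order at most `c` when `t_{2i+1}` is given the order `-2i`. -/
def Adm (c : ℤ) (P : PsiDO R) : Prop := ∀ j, Fil wx (j - c) (P j)

variable {c d e : ℤ} {P Q S : PsiDO R}

theorem Adm.mono (hP : Adm c P) (h : c ≤ d) : Adm d P := fun j => (hP j).mono (by omega)

theorem Adm.add (hP : Adm c P) (hQ : Adm c Q) : Adm c (P + Q) := fun j => (hP j).add (hQ j)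

theorem Adm.neg (hP : Adm c P) : Adm c (-P) := fun j => (hP j).neg

theorem adm_zero (c : ℤ) : Adm c (0 : PsiDO R) := fun _ => Fil.zero

theorem Adm.of_order_le (h : ∀ j, c < j → P j = 0) : Adm c P := fun j => by
  rcases lt_or_ge c j with h1 | h1
  · rw [h j h1]; exact Fil.zero
  · exact Fil.of_nonpos (by omega)

/-- The terms of a composition. -/
def compTerm (P Q : PsiDO R) (k : ℤ) (x : ℤ × ℕ) : TimeFn R :=
  Ring.choose x.1 x.2 • (P x.1 * dx x.2 (Q (k - x.1 + x.2)))

/-- At a fixed monomial the first bound limits `x.1` from above; the second then limits `x.2` from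
above and `x.1` from below, so only finitely many terms survive. The third bound is the order of the
composite. -/
theorem compTerm_fil (hP : Adm c P) (hQ : Adm d Q) (k : ℤ) (x : ℤ × ℕ) :
    Fil wx (x.1 - c) (compTerm P Q k x) ∧ Fil wx (k - x.1 + x.2 - d) (compTerm P Q k x) ∧
    Fil wx (k - (c + d)) (compTerm P Q k x) := by
  refine ⟨((hP _).mul_right).zsmul _, (((hQ _).dx _).mul_left).zsmul _, ?_⟩
  exact ((((hP x.1).mul ((hQ (k - x.1 + x.2)).dx x.2))).zsmul _).mono (by omega)

theorem comp_hasSum (hP : Adm c P) (hQ : Adm d Q) (k : ℤ) :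
    HasSum (compTerm P Q k) (comp P Q k) := by
  refine timeFn_hasSum_of_finsum (fun α => ?_) fun α => rfl
  refine Set.Finite.subset ((Finset.finite_toSet (Finset.Icc (k - d - wx α) (c + wx α) ×ˢ
    Finset.range (d + wx α + (c + wx α) - k + 1).toNat))) fun x hx => ?_
  obtain ⟨h1, h2, -⟩ := compTerm_fil hP hQ k x
  have h1 := h1 α hx
  have h2 := h2 α hx
  simp only [Finset.coe_product, Set.mem_prod, Finset.mem_coe, Finset.mem_Icc, Finset.mem_range]
  omega

theorem Adm.comp (hP : Adm c P) (hQ : Adm d Q) : Adm (c + d) (comp P Q) := fun k =>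
  Fil.hasSum (fun x => (compTerm_fil hP hQ k x).2.2) (comp_hasSum hP hQ k)

theorem comp_add_left {P' : PsiDO R} (hP : Adm c P) (hP' : Adm d P') (hQ : Adm e Q) :
    comp (P + P') Q = comp P Q + comp P' Q := by
  funext k
  refine (comp_hasSum ((hP.mono (le_max_left c d)).add (hP'.mono (le_max_right c d))) hQ k).unique ?_
  convert! (comp_hasSum hP hQ k).add (comp_hasSum hP' hQ k) using 1
  funext x
  simp [compTerm, add_mul, smul_add]

theorem comp_add_right {Q' : PsiDO R} (hP : Adm c P) (hQ : Adm d Q) (hQ' : Adm e Q') :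
    comp P (Q + Q') = comp P Q + comp P Q' := by
  funext k
  refine (comp_hasSum hP ((hQ.mono (le_max_left d e)).add (hQ'.mono (le_max_right d e))) k).unique ?_
  convert! (comp_hasSum hP hQ k).add (comp_hasSum hP hQ' k) using 1
  funext x
  simp [compTerm, mul_add, smul_add, dx_map_add]

theorem comp_zero_left : comp 0 Q = 0 := by
  funext k; ext α
  rw [show coeff α (comp 0 Q k) = ∑ᶠ x, coeff α (compTerm 0 Q k x) from rfl]
  simp [compTerm]

theorem comp_zero_right : comp P 0 = 0 := by
  funext k; ext α
  rw [show coeff α (comp P 0 k) = ∑ᶠ x, coeff α (compTerm P 0 k x) from rfl]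
  simp [compTerm, dx_map_zero]

theorem adm_dPow (n : ℤ) : Adm n (dPow n : PsiDO R) :=
  Adm.of_order_le fun j hj => by simp [dPow, (ne_of_lt hj).symm]

theorem comp_dPow_right (hP : Adm c P) (n k : ℤ) : comp P (dPow n) k = P (k - n) := by
  refine (comp_hasSum hP (adm_dPow n) k).unique ?_
  convert! hasSum_single (f := compTerm P (dPow n) k) ((k - n : ℤ), 0) ?_ using 1
  · simp [compTerm, dPow, dx_zero]
  · rintro ⟨p, m⟩ h
    rcases eq_or_ne m 0 with rfl | hm
    · have : k - p ≠ n := fun h1 => h (by simp; omega)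
      simp [compTerm, dPow, dx_zero, this]
    · simp only [compTerm, dPow]
      split_ifs
      · simp [dx_one_of_pos hm]
      · simp [dx_map_zero]

theorem comp_dPow_zero_left (hQ : Adm d Q) : comp (dPow 0) Q = Q := by
  funext k
  refine (comp_hasSum (adm_dPow 0) hQ k).unique ?_
  convert! hasSum_single (f := compTerm (dPow 0) Q k) ((0 : ℤ), 0) ?_ using 1
  · simp [compTerm, dPow, dx_zero]
  · rintro ⟨p, m⟩ h
    rcases eq_or_ne p 0 with rfl | hm
    · have : m ≠ 0 := fun h1 => h (by simp [h1])
      simp [compTerm, Ring.choose_zero_pos ℤ (Nat.pos_of_ne_zero this)]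
    · simp [compTerm, dPow, hm]

/-- The terms of a threefold composition. -/
def assocTerm (P Q S : PsiDO R) (k : ℤ) (p q : ℤ) (m a b : ℕ) : TimeFn R :=
  (((m + a).choose m : ℤ) * Ring.choose p (m + a) * Ring.choose q b) •
    (P p * dx m (Q q) * dx (a + b) (S (k - p - q + m + (a + b : ℕ))))

theorem assocTerm_finite (hP : Adm c P) (hQ : Adm d Q) (hS : Adm e S) (k : ℤ) (α : ℕ →₀ ℕ) :
    {x : (ℤ × ℤ) × ℕ × ℕ × ℕ |
      coeff α (assocTerm P Q S k x.1.1 x.1.2 x.2.1 x.2.2.1 x.2.2.2) ≠ 0}.Finite := by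
  set w : ℤ := ((wx α : ℕ) : ℤ)
  set B : ℕ := (c + d + e + 3 * w - k + 1).toNat
  refine Set.Finite.subset ((Finset.finite_toSet
    ((Finset.Icc (k - d - e - 2 * w) (c + w) ×ˢ Finset.Icc (k - c - e - 2 * w) (d + w)) ×ˢ
      Finset.range B ×ˢ Finset.range B ×ˢ Finset.range B))) ?_
  rintro ⟨⟨p, q⟩, m, a, b⟩ hx
  simp only [Set.mem_ofPred_eq, assocTerm] at hx
  have h1 := ((((hP p).mul_right (g := dx m (Q q))).mul_right).zsmul _) α hx
  have h2 := (((((hQ q).dx m).mul_left (f := P p)).mul_right).zsmul _) α hx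
  have h3 := ((((hS _).dx _).mul_left).zsmul _) α hx
  simp only [Finset.coe_product, Set.mem_prod, Finset.mem_coe, Finset.mem_Icc, Finset.mem_range]
  push_cast at h3
  omega

/-- Here `u = p + q - m` is the order of the inner term and `n = a + b` counts the derivatives
falling on `S`. The Vandermonde identity splits `choose u n` over `a + b = n` into `choose (p - m)
a` times `choose q b`, and `choose p m * choose (p - m) a` is rewritten with `choose p (m + a)`. -/
theorem comp_assoc_left (hP : Adm c P) (hQ : Adm d Q) (hS : Adm e S) (k : ℤ) :
    HasSum (fun x : (ℤ × ℤ) × ℕ × ℕ × ℕ =>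
      assocTerm P Q S k x.1.1 x.1.2 x.2.1 x.2.2.1 x.2.2.2) (comp (comp P Q) S k) := by
  have hs := (timeFn_summable_of_finite (assocTerm_finite hP hQ hS k)).hasSum
  convert! hs using 1
  refine (comp_hasSum (hP.comp hQ) hS k).unique ?_
  let e1 : (((ℤ × ℤ) × ℕ) × (ℕ × ℕ)) ≃ (ℤ × ℤ) × ℕ × ℕ × ℕ :=
    Equiv.prodAssoc _ _ _
  have h1 := hasSum_antidiagonal ((e1.hasSum_iff).2 hs)
  let e2 : (ℤ × ℕ) × (ℤ × ℕ) ≃ ((ℤ × ℤ) × ℕ) × ℕ :=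
    { toFun := fun y => (((y.2.1, y.1.1 - y.2.1 + y.2.2), y.2.2), y.1.2)
      invFun := fun z => ((z.1.1.1 + z.1.1.2 - z.1.2, z.2), (z.1.1.1, z.1.2))
      left_inv := by rintro ⟨⟨u, n⟩, ⟨p, m⟩⟩; ext <;> simp; ring
      right_inv := by rintro ⟨⟨⟨p, q⟩, m⟩, n⟩; ext <;> simp; ring }
  refine ((e2.hasSum_iff).2 h1).prod_fiberwise ?_
  rintro ⟨u, n⟩
  have h2 := ((comp_hasSum hP hQ u).mul_right (dx n (S (k - u + n)))).const_smul
    (Ring.choose u n : ℤ)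
  convert! h2 using 1
  funext ⟨p, m⟩
  simp only [Function.comp_apply, e2, e1, Equiv.coe_fn_mk, Equiv.prodAssoc_apply, assocTerm,
    compTerm]
  have h3 : ∀ ab ∈ antidiagonal n,
      (((m + ab.1).choose m : ℤ) * Ring.choose p (m + ab.1) *
        Ring.choose (u - p + m : ℤ) ab.2) • (P p * dx m (Q (u - p + m)) *
        dx (ab.1 + ab.2) (S (k - p - (u - p + m) + m + (ab.1 + ab.2 : ℕ)))) =
      ((Ring.choose p m : ℤ) * (Ring.choose (p - m : ℤ) ab.1 * Ring.choose (u - p + m : ℤ) ab.2)) •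
        (P p * dx m (Q (u - p + m)) * dx n (S (k - u + n))) := by
    intro ab hab
    rw [mem_antidiagonal.1 hab]
    congr 1
    · have := Ring.choose_smul_choose p (Nat.le_add_right m ab.1)
      rw [nsmul_eq_mul, Nat.add_sub_cancel_left] at this
      rw [this, mul_assoc]
    · congr 3; ring
  rw [Finset.sum_congr rfl h3, ← Finset.sum_smul, ← Finset.mul_sum,
    ← Ring.add_choose_eq n (Commute.all _ _), smul_mul_assoc, smul_smul, mul_comm]
  congr 2
  congr 1; ring

/-- The outer composition applies `N = m + a` derivatives to a product, and the Leibniz rule sends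
`m` of them to `Q` and `a` to `S`. The binomial factors agree with those of `comp_assoc_left` as
they stand. -/
theorem comp_assoc_right (hP : Adm c P) (hQ : Adm d Q) (hS : Adm e S) (k : ℤ) :
    HasSum (fun x : (ℤ × ℤ) × ℕ × ℕ × ℕ =>
      assocTerm P Q S k x.1.1 x.1.2 x.2.1 x.2.2.1 x.2.2.2) (comp P (comp Q S) k) := by
  have hs := (timeFn_summable_of_finite (assocTerm_finite hP hQ hS k)).hasSum
  convert! hs using 1
  refine (comp_hasSum hP (hQ.comp hS) k).unique ?_
  let e1 : (((ℤ × ℤ) × ℕ) × (ℕ × ℕ)) ≃ (ℤ × ℤ) × ℕ × ℕ × ℕ :=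
    { toFun := fun y => (y.1.1, (y.2.1, y.2.2, y.1.2))
      invFun := fun z => ((z.1, z.2.2.2), (z.2.1, z.2.2.1))
      left_inv := fun _ => rfl
      right_inv := fun _ => rfl }
  have h1 := hasSum_antidiagonal ((e1.hasSum_iff).2 hs)
  let e2 : (ℤ × ℕ) × (ℤ × ℕ) ≃ ((ℤ × ℤ) × ℕ) × ℕ :=
    { toFun := fun y => (((y.1.1, y.2.1), y.2.2), y.1.2)
      invFun := fun z => ((z.1.1.1, z.2), (z.1.1.2, z.1.2))
      left_inv := fun _ => rfl
      right_inv := fun _ => rfl }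
  refine ((e2.hasSum_iff).2 h1).prod_fiberwise ?_
  rintro ⟨p, N⟩
  have h2 := ((((comp_hasSum hQ hS (k - p + N)).map (dxL N).toAddMonoidHom
    ((continuous_dx N).congr fun f => (dxL_apply N f).symm)).mul_left (P p)).const_smul
    (Ring.choose p N : ℤ))
  have h3 : (dxL N).toAddMonoidHom (comp Q S (k - p + N)) = dx N (comp Q S (k - p + N)) :=
    dxL_apply _ _
  rw [h3] at h2
  convert! h2 using 1
  funext ⟨q, n⟩
  simp only [Function.comp_apply, e2, e1, Equiv.coe_fn_mk, assocTerm, compTerm]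
  have h4 : (dxL N).toAddMonoidHom (Ring.choose q n • (Q q * dx n (S (k - p + N - q + n)))) =
      Ring.choose q n • dx N (Q q * dx n (S (k - p + N - q + n))) := by
    rw [← dx_map_zsmul]; exact dxL_apply _ _
  rw [h4, dx_mul, Finset.smul_sum, Finset.mul_sum, Finset.smul_sum]
  refine Finset.sum_congr rfl fun ab hab => ?_
  have hN := mem_antidiagonal.1 hab
  rw [hN, ← dx_add, mul_smul_comm, mul_smul_comm, ← natCast_zsmul, smul_smul, smul_smul, ← mul_assoc]
  congr 1
  · ring
  · congr 3
    rw [← hN]; push_cast; ring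

theorem comp_assoc (hP : Adm c P) (hQ : Adm d Q) (hS : Adm e S) :
    comp (comp P Q) S = comp P (comp Q S) :=
  funext fun k => (comp_assoc_left hP hQ hS k).unique (comp_assoc_right hP hQ hS k)

end Comp

/-! ### The ring of admissible operators. -/

section Ring

variable (R : Type) [CommRing R]

/-- The additive group of admissible operators. -/
def admissible : AddSubgroup (PsiDO R) where
  carrier := {P | ∃ c, Adm c P}
  zero_mem' := ⟨0, adm_zero 0⟩
  add_mem' := fun ⟨c, hc⟩ ⟨d, hd⟩ =>
    ⟨max c d, (hc.mono (le_max_left c d)).add (hd.mono (le_max_right c d))⟩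
  neg_mem' := fun ⟨c, hc⟩ => ⟨c, hc.neg⟩

/-- The ring of admissible pseudo-differential operators. -/
abbrev Op : Type := admissible R

variable {R}

instance : Mul (Op R) := ⟨fun A B => ⟨comp A.1 B.1, by
  obtain ⟨c, hc⟩ := A.2
  obtain ⟨d, hd⟩ := B.2
  exact ⟨c + d, hc.comp hd⟩⟩⟩

instance : One (Op R) := ⟨⟨dPow 0, 0, adm_dPow 0⟩⟩

theorem Op.coe_mul (A B : Op R) : ((A * B : Op R) : PsiDO R) = comp A B := rfl

instance : Ring (Op R) :=
  { (inferInstance : AddCommGroup (Op R)), (inferInstance : Mul (Op R)),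
    (inferInstance : One (Op R)) with
    left_distrib := fun ⟨_, _, hP⟩ ⟨_, _, hQ⟩ ⟨_, _, hS⟩ => Subtype.ext (comp_add_right hP hQ hS)
    right_distrib := fun ⟨_, _, hP⟩ ⟨_, _, hQ⟩ ⟨_, _, hS⟩ => Subtype.ext (comp_add_left hP hQ hS)
    zero_mul := fun _ => Subtype.ext comp_zero_left
    mul_zero := fun _ => Subtype.ext comp_zero_right
    mul_assoc := fun ⟨_, _, hP⟩ ⟨_, _, hQ⟩ ⟨_, _, hS⟩ => Subtype.ext (comp_assoc hP hQ hS)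
    one_mul := fun ⟨_, _, hQ⟩ => Subtype.ext (comp_dPow_zero_left hQ)
    mul_one := fun ⟨_, _, hQ⟩ => Subtype.ext (funext fun k => by
      change comp _ (dPow 0) k = _
      rw [comp_dPow_right hQ, sub_zero]) }

theorem Op.coe_pow (A : Op R) (n : ℕ) : ((A ^ n : Op R) : PsiDO R) = pow A n := by
  induction n with
  | zero => rw [pow_zero]; rfl
  | succ n ih => rw [pow_succ, Op.coe_mul, ih]; rfl

end Ring

theorem timeFn_summable_comp {R : Type} [CommRing R] {ι κ : Type*} {F : ι → TimeFn R}
    (hF : Summable F) {e : κ → ι} (he : Function.Injective e) : Summable (F ∘ e) :=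
  timeFn_summable_of_finite fun α =>
    (timeFn_hasSum_coeff hF.hasSum α).1.preimage he.injOn

/-! ### The expansion of the exponential factor `e^ξ`. -/

section Schur

variable {R : Type} [CommRing R] [Algebra ℂ R]

/-- Positive integers must be cancellable for a series to be determined by its constant term and
partial derivatives. -/
theorem isAddTorsionFree_of_complex (R : Type) [CommRing R] [Algebra ℂ R] :
    IsAddTorsionFree R := by
  refine ⟨fun n hn a b h => ?_⟩
  have h1 : (n : ℂ) • a = (n : ℂ) • b := by simpa only [Nat.cast_smul_eq_nsmul] using h
  exact (smul_right_injective₀ (Nat.cast_ne_zero.2 hn)) h1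
where
  smul_right_injective₀ {z : ℂ} (hz : z ≠ 0) : Function.Injective fun a : R => z • a :=
    fun a b h => by simpa [smul_smul, inv_mul_cancel₀ hz] using congrArg (z⁻¹ • ·) h

/-- Only the `i`-th factor changes. All recursions for products of factorials and powers below are
instances. -/
theorem prod_add_single {M : Type*} [CommMonoid M] {F : ℕ → ℕ → M} (h0 : ∀ i, F i 0 = 1)
    (γ : ℕ →₀ ℕ) (i : ℕ) {a b : M} (h : F i (γ i + 1) * a = F i (γ i) * b) :
    (γ + Finsupp.single i 1).prod F * a = γ.prod F * b := by
  rw [← Finsupp.mul_prod_erase' γ i F h0,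
    ← Finsupp.mul_prod_erase' (γ + Finsupp.single i 1) i F h0,
    Finsupp.erase_add, Finsupp.erase_single, add_zero, Finsupp.add_apply, Finsupp.single_eq_same,
    mul_right_comm, h, mul_right_comm]

/-- `∏ᵢ 1/γᵢ!`. -/
def invFact (γ : ℕ →₀ ℕ) : ℂ := γ.prod fun _ c => (c.factorial : ℂ)⁻¹

theorem invFact_add_single (γ : ℕ →₀ ℕ) (i : ℕ) :
    invFact (γ + Finsupp.single i 1) * (γ i + 1) = invFact γ := by
  have := prod_add_single (F := fun _ c => (c.factorial : ℂ)⁻¹) (by simp) γ i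
    (a := (γ i + 1 : ℂ)) (b := 1) (by
      rw [Nat.factorial_succ]
      have h1 : ((γ i : ℂ) + 1) ≠ 0 := by exact Nat.cast_add_one_ne_zero (γ i)
      have h2 : ((γ i).factorial : ℂ) ≠ 0 := by exact_mod_cast Nat.factorial_ne_zero (γ i)
      push_cast
      field_simp)
  rw [mul_one] at this
  exact this

/-- The coefficient of `z^m` in `e^ξ`. -/
def schur (R : Type) [CommRing R] [Algebra ℂ R] (m : ℤ) : TimeFn R := fun γ =>
  if (wt γ : ℤ) = m then algebraMap ℂ R (invFact γ) else 0

theorem coeff_schur (m : ℤ) (γ : ℕ →₀ ℕ) :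
    coeff γ (schur R m) = if (wt γ : ℤ) = m then algebraMap ℂ R (invFact γ) else 0 := rfl

theorem schur_fil (m : ℤ) : Fil wt m (schur R m) := fun γ hγ => by
  rw [coeff_schur] at hγ
  split_ifs at hγ with h
  · exact h.ge
  · exact absurd rfl hγ

theorem schur_neg {m : ℤ} (hm : m < 0) : schur R m = 0 := by
  ext γ
  rw [coeff_schur, if_neg (by omega)]; rfl

theorem coeff_zero_schur (m : ℤ) : coeff 0 (schur R m) = if m = 0 then 1 else 0 := by
  rw [coeff_schur, map_zero]
  simp [invFact, eq_comm]

theorem constantCoeff_schur (m : ℤ) :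
    MvPowerSeries.constantCoeff (schur R m) = if m = 0 then 1 else 0 := coeff_zero_schur m

theorem pderiv_schur (i : ℕ) (m : ℤ) : pderiv R i (schur R m) = schur R (m - (2 * i + 1)) := by
  ext γ
  rw [MvPowerSeries.coeff_pderiv, coeff_schur, coeff_schur, wt_add_single]
  by_cases h : (wt γ : ℤ) = m - (2 * i + 1)
  · rw [if_pos h, if_pos (by push_cast; omega), ← invFact_add_single γ i, map_mul]
    simp
  · rw [if_neg h, if_neg (by push_cast; omega), zero_mul]

theorem coeff_X_mul (i : ℕ) (f : TimeFn R) (γ : ℕ →₀ ℕ) :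
    coeff (γ + Finsupp.single i 1) (X i * f) = coeff γ f := by
  rw [MvPowerSeries.X, add_comm, MvPowerSeries.coeff_add_monomial_mul, one_mul]

theorem coeff_X_mul_of_eq_zero {i : ℕ} (f : TimeFn R) {γ : ℕ →₀ ℕ} (h : γ i = 0) :
    coeff γ (X i * f) = 0 := by
  rw [MvPowerSeries.X, MvPowerSeries.coeff_monomial_mul, if_neg]
  intro h1
  have := h1 i
  rw [Finsupp.single_eq_same] at this
  omega

theorem eq_add_single {γ : ℕ →₀ ℕ} {i : ℕ} (h : γ i ≠ 0) :
    ∃ δ : ℕ →₀ ℕ, γ = δ + Finsupp.single i 1 :=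
  ⟨γ - Finsupp.single i 1, (tsub_add_cancel_of_le (by
    rw [Finsupp.single_le_iff]; omega)).symm⟩

theorem coeff_X_mul_schur (i : ℕ) (m : ℤ) (γ : ℕ →₀ ℕ) :
    coeff γ (X i * schur R (m - (2 * i + 1))) = (γ i : ℤ) • coeff γ (schur R m) := by
  by_cases h : γ i = 0
  · rw [coeff_X_mul_of_eq_zero _ h, h, Nat.cast_zero, zero_smul]
  · obtain ⟨δ, rfl⟩ := eq_add_single h
    rw [coeff_X_mul, ← pderiv_schur, MvPowerSeries.coeff_pderiv, mul_comm, zsmul_eq_mul]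
    simp

/-- The Euler identity for `e^ξ`. -/
theorem schur_euler (m : ℤ) :
    HasSum (fun i : ℕ => (2 * i + 1 : ℤ) • (X i * schur R (m - (2 * i + 1)))) (m • schur R m) := by
  have key : ∀ (γ : ℕ →₀ ℕ) (i : ℕ),
      coeff γ ((2 * i + 1 : ℤ) • (X i * schur R (m - (2 * i + 1)))) =
        (((2 * i + 1) * γ i : ℕ) : ℤ) • coeff γ (schur R m) := fun γ i => by
    rw [map_zsmul, coeff_X_mul_schur, smul_smul]; push_cast; rfl
  have hsub : ∀ γ : ℕ →₀ ℕ,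
      (Function.support fun i => (((2 * i + 1) * γ i : ℕ) : ℤ) • coeff γ (schur R m)) ⊆
        γ.support := fun γ i hi => by
    rw [Finset.mem_coe, Finsupp.mem_support_iff]
    intro h; rw [Function.mem_support, h] at hi; simp at hi
  refine timeFn_hasSum_of_finsum (fun γ => ?_) fun γ => ?_
  · simp only [key]
    exact (Finset.finite_toSet _).subset (hsub γ)
  · simp only [key]
    rw [finsum_eq_sum_of_support_subset _ (hsub γ), ← Finset.sum_smul, map_zsmul, coeff_schur]
    split_ifs with h
    · rw [← h, ← Nat.cast_sum]; rfl
    · simp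

/-- This is `e^{ξ(t,z)} e^{ξ(t,-z)} = 1`, which holds because `ξ` is odd in `z`. Every
`t`-derivative cancels after the shift `j ↦ j - (2i+1)`, which flips the sign, and the constant
terms agree. -/
theorem schur_conv (n : ℤ) :
    HasSum (fun j : ℤ => ((j.negOnePow : ℤˣ) : ℤ) • (schur R j * schur R (n - j)))
      (if n = 0 then 1 else 0) := by
  have hsum : ∀ n : ℤ,
      Summable fun j : ℤ => ((j.negOnePow : ℤˣ) : ℤ) • (schur R j * schur R (n - j)) := fun n => by
    refine summable_of_hasFiniteSupport ((Set.finite_Icc 0 n).subset fun j hj => ?_)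
    by_contra h
    rw [Set.mem_Icc, not_and_or, not_le, not_le] at h
    refine hj ?_
    rcases h with h | h
    · simp [schur_neg h]
    · simp [schur_neg (R := R) (m := n - j) (by omega)]
  convert! (hsum n).hasSum using 1
  have := isAddTorsionFree_of_complex R
  refine MvPowerSeries.pderiv.ext (fun i => ?_) ?_
  · have h1 := (hsum n).hasSum.map (pderiv R i) (continuous_pderiv i)
    have h2 := (hsum (n - (2 * i + 1))).hasSum
    have h3 := ((Equiv.subRight (2 * i + 1 : ℤ)).hasSum_iff
      (f := fun j : ℤ => ((j.negOnePow : ℤˣ) : ℤ) • (schur R j * schur R (n - (2 * i + 1) - j)))).2 h2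
    have h4 := h3.neg.add h2
    rw [neg_add_cancel] at h4
    rw [show pderiv R i (if n = 0 then (1 : TimeFn R) else 0) = 0 by
      split_ifs
      · exact MvPowerSeries.pderiv_one
      · exact map_zero _]
    refine h4.unique ?_
    convert! h1 using 1
    funext j
    simp only [Function.comp_apply, Equiv.subRight_apply, map_zsmul, Derivation.leibniz,
      pderiv_schur, smul_eq_mul]
    have hneg : ((j - (2 * i + 1 : ℤ)).negOnePow : ℤˣ) = - j.negOnePow := by
      rw [Int.negOnePow_sub, Int.negOnePow_odd _ ⟨i, rfl⟩]; simp
    rw [hneg, smul_add, Units.val_neg, neg_smul, neg_neg, add_comm, mul_comm (schur R (n - j)),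
      show n - (2 * i + 1) - (j - (2 * i + 1)) = n - j by ring,
      show n - (2 * i + 1) - j = n - j - (2 * i + 1) by ring]
  · have h1 := timeFn_hasSum_coeff (hsum n).hasSum 0
    rw [← MvPowerSeries.coeff_zero_eq_constantCoeff_apply,
      ← MvPowerSeries.coeff_zero_eq_constantCoeff_apply, h1.2,
      finsum_eq_single _ (0 : ℤ)]
    · simp only [map_zsmul, sub_zero]
      rw [MvPowerSeries.coeff_zero_eq_constantCoeff_apply,
        MvPowerSeries.coeff_zero_eq_constantCoeff_apply, map_mul, constantCoeff_schur,
        constantCoeff_schur]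
      split_ifs <;> simp_all
    · intro j hj
      rw [map_zsmul, MvPowerSeries.coeff_zero_eq_constantCoeff_apply, map_mul,
        constantCoeff_schur, if_neg hj, zero_mul,
        smul_zero]

end Schur

/-! ### Modes of `A e^ξ` and the pairing by the `z^0` coefficient of `A(z) B(-z)`. -/

section Modes

variable {R : Type} [CommRing R] [Algebra ℂ R] {c d : ℤ} {A B : PsiDO R}

/-- The coefficient of `z^j` in `A · e^ξ`, with the exponential factor expanded. -/
def mode (A : PsiDO R) (j : ℤ) : TimeFn R := ∑' m : ℤ, schur R (j - m) * A m

theorem Fil.wt_of_wx {f : TimeFn R} (h : Fil wx c f) : Fil wt c f := fun α hα =>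
  (h α hα).trans (by exact_mod_cast wx_le_wt α)

theorem mode_hasSum (hA : Adm c A) (j : ℤ) :
    HasSum (fun m : ℤ => schur R (j - m) * A m) (mode A j) := by
  refine (timeFn_summable_of_finite fun α => ?_).hasSum
  refine (Set.finite_Icc (j - wt α) (c + wx α)).subset fun m hm => ?_
  have h1 := (schur_fil (j - m)).mul_right α hm
  have h2 := (hA m).mul_left α hm
  rw [Set.mem_Icc]; omega

theorem mode_fil (hA : Adm c A) (j : ℤ) : Fil wt (j - c) (mode A j) :=
  Fil.hasSum (fun m => ((schur_fil (j - m)).mul (hA m).wt_of_wx).mono (by omega))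
    (mode_hasSum hA j)

theorem mode_add (hA : Adm c A) (hB : Adm d B) (j : ℤ) :
    mode (A + B) j = mode A j + mode B j := by
  refine (mode_hasSum ((hA.mono (le_max_left c d)).add (hB.mono (le_max_right c d))) j).unique ?_
  simpa only [Pi.add_apply, mul_add] using (mode_hasSum hA j).add (mode_hasSum hB j)

theorem mode_congr_mul (f : TimeFn R) (hA : Adm c A) (j : ℤ) :
    mode (fun k => f * A k) j = f * mode A j := by
  have h := (mode_hasSum hA j).mul_left f
  rw [mode, ← h.tsum_eq]
  exact tsum_congr fun m => by ring

theorem mode_shift (A : PsiDO R) (n j : ℤ) : mode (fun k => A (k - n)) j = mode A (j - n) := by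
  rw [mode, mode, ← (Equiv.addRight n).tsum_eq]
  refine tsum_congr fun m => ?_
  rw [Equiv.coe_addRight, add_sub_cancel_right, show j - (m + n) = j - n - m by ring]

/-- Differentiating `A e^ξ` also hits the exponential, which contributes the factor `z^{2i+1}`;
subtracting that leaves the derivative of the coefficients of `A` alone. -/
theorem mode_pderiv (hA : Adm c A) (i : ℕ) (j : ℤ) :
    HasSum (fun m : ℤ => schur R (j - m) * pderiv R i (A m))
      (pderiv R i (mode A j) - mode A (j - (2 * i + 1))) := by
  have h1 := (mode_hasSum hA j).map (pderiv R i) (continuous_pderiv i)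
  have h2 := h1.sub (mode_hasSum hA (j - (2 * i + 1)))
  convert! h2 using 1
  funext m
  rw [Function.comp_apply, Derivation.leibniz, pderiv_schur, smul_eq_mul, smul_eq_mul]
  rw [show j - m - (2 * i + 1) = j - (2 * i + 1) - m by ring]
  ring

/-- The coefficient of `z^0` in `A(z) B(-z)`. -/
def pair (A B : PsiDO R) : TimeFn R := ∑' j : ℤ, ((j.negOnePow : ℤˣ) : ℤ) • (A j * B (-j))

theorem pair_hasSum (hA : Adm c A) (hB : Adm d B) :
    HasSum (fun j : ℤ => ((j.negOnePow : ℤˣ) : ℤ) • (A j * B (-j))) (pair A B) := by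
  refine (timeFn_summable_of_finite fun α => ?_).hasSum
  refine (Set.finite_Icc (-d - wx α) (c + wx α)).subset fun m hm => ?_
  have h1 := ((hA m).mul_right.zsmul _) α hm
  have h2 := ((hB (-m)).mul_left.zsmul _) α hm
  rw [Set.mem_Icc]; omega

theorem pair_comm (A B : PsiDO R) : pair A B = pair B A := by
  rw [pair, pair, ← (Equiv.neg ℤ).tsum_eq]
  refine tsum_congr fun j => ?_
  rw [Equiv.neg_apply, Int.negOnePow_neg, neg_neg, mul_comm]

/-- The pairing in terms of the modes, since `e^{ξ(t,z)} e^{ξ(t,-z)} = 1`. -/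
theorem pair_eq_modes (hA : Adm c A) (hB : Adm d B) :
    HasSum (fun j : ℤ => ((j.negOnePow : ℤˣ) : ℤ) • (mode A j * mode B (-j))) (pair A B) := by
  let F : ℤ × (ℤ × ℤ) → TimeFn R := fun x => ((x.1.negOnePow : ℤˣ) : ℤ) •
    ((schur R (x.1 - x.2.1) * A x.2.1) * (schur R (-x.1 - x.2.2) * B x.2.2))
  have hF : Summable F := timeFn_summable_of_finite fun α => by
    set w : ℤ := ((wt α : ℕ) : ℤ)
    refine (((Set.finite_Icc (-d - w - w) (c + w + w)).prod
      ((Set.finite_Icc (-d - w - w - w) (c + w)).prod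
        (Set.finite_Icc (-c - w - w - w) (d + w))))).subset ?_
    rintro ⟨j, m, m'⟩ hm
    have h1 := ((schur_fil (j - m)).mul_right.mul_right.zsmul _) α hm
    have h2 := ((schur_fil (-j - m')).mul_right.mul_left.zsmul _) α hm
    have h3 := ((hA m).wt_of_wx.mul_left.mul_right.zsmul _) α hm
    have h4 := ((hB m').wt_of_wx.mul_left.mul_left.zsmul _) α hm
    simp only [Set.mem_prod, Set.mem_Icc]
    omega
  have h1 : HasSum (fun j : ℤ => ((j.negOnePow : ℤˣ) : ℤ) • (mode A j * mode B (-j)))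
      (∑' x, F x) := by
    refine hF.hasSum.prod_fiberwise fun j => ?_
    refine (HasSum.mul (mode_hasSum hA j) (mode_hasSum hB (-j)) ?_).const_smul _
    have h5 := (timeFn_summable_comp hF (Prod.mk_right_injective j)).const_smul ((j.negOnePow : ℤˣ) : ℤ)
    convert! h5 using 1
    funext x
    simp only [F, Function.comp_apply, smul_smul]
    rw [← Units.val_mul, Int.units_mul_self]
    simp
  -- Summing over `j` first contracts the two exponentials by `schur_conv`, so only the terms with
  -- opposite orders in `A` and `B` remain.
  have h2 : HasSum (fun x : ℤ × ℤ => ((x.1.negOnePow : ℤˣ) : ℤ) •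
      (A x.1 * B x.2 * if x.1 + x.2 = 0 then 1 else 0)) (∑' x, F x) := by
    refine (((Equiv.prodComm _ _).hasSum_iff (f := F)).2 hF.hasSum).prod_fiberwise fun x => ?_
    have h3 := ((schur_conv (R := R) (-(x.1 + x.2))).mul_left (A x.1 * B x.2)).const_smul
      ((x.1.negOnePow : ℤˣ) : ℤ)
    have h4 := ((Equiv.subRight x.1).hasSum_iff).2 h3
    convert! h4 using 1
    · funext j
      simp only [Function.comp_apply, F, Equiv.prodComm_apply, Prod.swap, Equiv.subRight_apply]
      rw [Int.negOnePow_sub, mul_smul_comm, smul_smul, ← Units.val_mul, mul_comm x.1.negOnePow (j.negOnePow * _),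
        mul_assoc j.negOnePow, Int.units_mul_self, mul_one, show -(x.1 + x.2) - (j - x.1) = -j - x.2 by ring]
      congr 1; ring
    · simp only [neg_eq_zero]
  have h3 : HasSum (fun j : ℤ => ((j.negOnePow : ℤˣ) : ℤ) • (A j * B (-j))) (∑' x, F x) := by
    refine h2.prod_fiberwise fun j => ?_
    convert! hasSum_single (f := fun y : ℤ => ((j.negOnePow : ℤˣ) : ℤ) •
      (A j * B y * if j + y = 0 then 1 else 0)) (-j) ?_ using 1
    · simp
    · intro y hy
      rw [if_neg (by omega), mul_zero, smul_zero]
  rw [(pair_hasSum hA hB).unique h3]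
  exact h1

end Modes

/-! ### Elementary operators and orders. -/

section Operators

variable {R : Type} [CommRing R]

namespace Op

/-- The operator `∂^n`. -/
def d (n : ℤ) : Op R := ⟨dPow n, n, adm_dPow n⟩

/-- Multiplication by a function. -/
def fn (f : TimeFn R) : Op R := ⟨fun j => if j = 0 then f else 0, 0,
  Adm.of_order_le fun _ hj => if_neg hj.ne'⟩

theorem mul_d_apply (A : Op R) (n k : ℤ) : (A * d n).1 k = A.1 (k - n) := by
  obtain ⟨c, hc⟩ := A.2
  exact comp_dPow_right hc n k

theorem d_mul_d (m n : ℤ) : (d m * d n : Op R) = d (m + n) := by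
  ext k : 2
  rw [mul_d_apply]
  simp only [d, dPow]
  split_ifs <;> first | rfl | omega

theorem d_zero : (d 0 : Op R) = 1 := rfl

/-- `A` has no terms of order above `c`. -/
def OrdLE (c : ℤ) (A : Op R) : Prop := ∀ j, c < j → A.1 j = 0

theorem OrdLE.mono {c c' : ℤ} {A : Op R} (h : OrdLE c A) (hc : c ≤ c') : OrdLE c' A :=
  fun j hj => h j (by omega)

theorem mul_hasSum (A B : Op R) (k : ℤ) : HasSum (compTerm A.1 B.1 k) ((A * B).1 k) := by
  obtain ⟨c, hc⟩ := A.2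
  obtain ⟨e, he⟩ := B.2
  exact comp_hasSum hc he k

theorem OrdLE.mul {a b : ℤ} {A B : Op R} (hA : OrdLE a A) (hB : OrdLE b B) :
    OrdLE (a + b) (A * B) := fun j hj => by
  refine (mul_hasSum A B j).unique ?_
  convert! hasSum_zero using 1
  funext x
  rw [compTerm]
  rcases lt_or_ge a x.1 with h | h
  · rw [hA _ h, zero_mul, smul_zero]
  · rw [hB _ (by omega), dx_map_zero, mul_zero, smul_zero]

theorem OrdLE.sub {a : ℤ} {A B : Op R} (hA : OrdLE a A) (hB : OrdLE a B) :
    OrdLE a (A - B) := fun j hj => by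
  change A.1 j - B.1 j = 0
  rw [hA j hj, hB j hj, sub_zero]

theorem ordLE_d (n : ℤ) : OrdLE n (d n : Op R) := fun _ hj => if_neg hj.ne'

theorem OrdLE.pow {A : Op R} (hA : OrdLE (-1) A) (n : ℕ) : OrdLE (-n) (A ^ n) := by
  induction n with
  | zero => exact ordLE_d 0
  | succ n ih => rw [pow_succ]; exact (ih.mul hA).mono (by push_cast; omega)

theorem eq_zero_of_ordLE {A : Op R} (h : ∀ K : ℕ, OrdLE (-K - 1) A) : A = 0 :=
  Subtype.ext (funext fun j => h (-j).toNat j (by omega))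

/-- A factor `∂^p` with `p ≥ 0` can absorb at most `p` orders, so a constant term would need a
coefficient of `B` of nonpositive order. -/
theorem mul_apply_zero_of_pos {A B : Op R} (hB : ∀ j, j ≤ 0 → B.1 j = 0)
    (hA : ∀ j, j < 0 → A.1 j = 0) : (A * B).1 0 = 0 := by
  refine (mul_hasSum A B 0).unique ?_
  convert! hasSum_zero using 1
  funext ⟨p, n⟩
  rw [compTerm]
  rcases lt_or_ge p 0 with h | h
  · rw [hA _ h, zero_mul, smul_zero]
  · obtain ⟨m, rfl⟩ := Int.eq_ofNat_of_zero_le h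
    rcases le_or_gt n m with h1 | h1
    · rw [hB _ (by omega), dx_map_zero, mul_zero, smul_zero]
    · simp only
      rw [show Ring.choose (m : ℤ) n = 0 by
        rw [Ring.choose_natCast, Nat.choose_eq_zero_of_lt h1]; rfl, zero_smul]

theorem mul_nonneg_order {A B : Op R} (hA : ∀ j, j < 0 → A.1 j = 0)
    (hB : ∀ j, j < 0 → B.1 j = 0) (k : ℤ) (hk : k < 0) : (A * B).1 k = 0 := by
  refine (mul_hasSum A B k).unique ?_
  convert! hasSum_zero using 1
  funext ⟨p, n⟩
  rw [compTerm]
  rcases lt_or_ge p 0 with h | h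
  · rw [hA _ h, zero_mul, smul_zero]
  · obtain ⟨m, rfl⟩ := Int.eq_ofNat_of_zero_le h
    rcases le_or_gt n m with h1 | h1
    · rw [hB _ (by simp only; omega), dx_map_zero, mul_zero, smul_zero]
    · simp only
      rw [show Ring.choose (m : ℤ) n = 0 by
        rw [Ring.choose_natCast, Nat.choose_eq_zero_of_lt h1]; rfl, zero_smul]

theorem d_mul_hasSum (m : ℤ) (B : Op R) (k : ℤ) :
    HasSum (fun n : ℕ => Ring.choose m n • dx n (B.1 (k - m + n))) ((d m * B).1 k) := by
  have h := mul_hasSum (d m) B k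
  rw [← Function.Injective.hasSum_iff (Prod.mk_right_injective m)] at h
  · convert! h using 1
    funext n
    simp [compTerm, d, dPow]
  · rintro ⟨p, n⟩ hp
    have : p ≠ m := fun h1 => hp ⟨n, by rw [h1]⟩
    simp [compTerm, d, dPow, this]

theorem d_one_mul_apply (B : Op R) (k : ℤ) :
    (d 1 * B).1 k = pderiv R 0 (B.1 k) + B.1 (k - 1) := by
  refine (d_mul_hasSum 1 B k).unique ?_
  convert! hasSum_sum_of_ne_finset_zero (L := .unconditional ℕ) (s := {0, 1}) (f := fun n : ℕ =>
    Ring.choose (1 : ℤ) n • dx n (B.1 (k - 1 + n))) ?_ using 1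
  · rw [Finset.sum_pair (by simp)]
    simp only [Ring.choose_zero_right, Ring.choose_one_right, dx_zero, dx_one, one_smul]
    push_cast
    rw [add_zero, sub_add_cancel, add_comm]
  · intro n hn
    have h2 : 1 < n := by simp at hn; omega
    rw [show Ring.choose (1 : ℤ) n = 0 by
      rw [← Nat.cast_one, Ring.choose_natCast, Nat.choose_eq_zero_of_lt h2]; rfl, zero_smul]

theorem d_nat_mul_apply (n : ℕ) (B : Op R) (k : ℤ) : (d n * B).1 k =
    ∑ ij ∈ antidiagonal n, n.choose ij.1 • dx ij.1 (B.1 (k - ij.2)) := by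
  induction n generalizing k with
  | zero => simp [d_zero, dx_zero]
  | succ n ih =>
    rw [show (d ((n + 1 : ℕ) : ℤ) : Op R) = d 1 * d n by rw [d_mul_d]; push_cast; rw [add_comm],
      mul_assoc, d_one_mul_apply, ih, ih, map_sum, Finset.sum_antidiagonal_choose_succ_nsmul
      (fun i j => dx i (B.1 (k - j))), ← Finset.sum_add_distrib, ← Finset.sum_add_distrib]
    refine Finset.sum_congr rfl fun ij hij => ?_
    have : n.choose ij.2 = n.choose ij.1 := by
      rw [← Nat.choose_symm_of_eq_add (mem_antidiagonal.1 hij).symm]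
    rw [this, map_nsmul, ← dx_succ, add_comm]
    congr 4
    push_cast; ring

/-- An operator is determined in non-positive orders by the constant terms of `∂^n A`. -/
theorem apply_eq_zero_of_d_mul {A : Op R} (h : ∀ n : ℕ, (d n * A).1 0 = 0) (n : ℕ) :
    A.1 (-n) = 0 := by
  induction n using Nat.strong_induction_on with
  | _ n ih =>
    have h1 := h n
    rw [d_nat_mul_apply, Finset.sum_eq_single (0, n)] at h1
    · simpa [dx_zero] using h1
    · rintro ⟨i, j⟩ hij hne
      have hij := mem_antidiagonal.1 hij
      have hj : j < n := by
        by_contra hj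
        exact hne (by ext <;> simp at hij ⊢ <;> omega)
      simp only [zero_sub]
      rw [ih j hj, dx_map_zero, smul_zero]
    · intro hne
      exact absurd (mem_antidiagonal.2 (zero_add n)) hne

theorem fn_mul_apply (f : TimeFn R) (A : Op R) (k : ℤ) : (fn f * A).1 k = f * A.1 k := by
  refine (mul_hasSum (fn f) A k).unique ?_
  convert! hasSum_single (f := compTerm (fn f).1 A.1 k) ((0 : ℤ), 0) ?_ using 1
  · simp [compTerm, dx_zero, fn]
  · rintro ⟨p, m⟩ h
    rcases eq_or_ne p 0 with rfl | hm
    · have : m ≠ 0 := fun h1 => h (by simp [h1])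
      simp [compTerm, Ring.choose_zero_pos ℤ (Nat.pos_of_ne_zero this)]
    · simp [compTerm, fn, hm]

theorem fn_one : (fn 1 : Op R) = 1 := rfl

theorem fn_mul_fn (f g : TimeFn R) : fn f * fn g = fn (f * g) := by
  ext k : 2
  rw [fn_mul_apply]
  simp only [fn]
  split_ifs <;> simp

theorem d_mul_fn_apply_zero (n : ℕ) (f : TimeFn R) : (d n * fn f).1 0 = dx n f := by
  rw [d_nat_mul_apply, Finset.sum_eq_single (n, 0)]
  · simp [fn]
  · rintro ⟨i, j⟩ hij hne
    have hij := mem_antidiagonal.1 hij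
    have hj : j ≠ 0 := by
      rintro rfl
      exact hne (by ext <;> simp at hij ⊢ ; omega)
    simp [fn, hj, dx_map_zero]
  · intro hne
    exact absurd (mem_antidiagonal.2 (add_zero n)) hne

end Op

end Operators

/-! ### The inverse dressing operator. -/

section Inverse

variable {R : Type} [CommRing R]

open Op

/-- The inverse of a monic operator of order zero, as an element of the ring of operators. -/
theorem inv_spec {φ : Op R} (h0 : φ.1 0 = 1) (hle : OrdLE 0 φ) :
    ∃ ψ : Op R, ψ.1 = inv φ.1 ∧ OrdLE 0 ψ ∧ φ * ψ = 1 ∧ ψ * φ = 1 := by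
  set U : Op R := 1 - φ with hU
  have hU1 : OrdLE (-1) U := fun j hj => by
    change dPow 0 j - φ.1 j = 0
    rcases eq_or_ne j 0 with rfl | h
    · rw [h0]; simp [dPow]
    · rw [hle j (by omega)]; simp [dPow, h]
  have hinv : ∀ k, inv φ.1 k = ∑ n ∈ Finset.range ((-k).toNat + 1), (U ^ n).1 k := fun k => by
    rw [inv]
    exact Finset.sum_congr rfl fun n _ => by rw [coe_pow]; rfl
  have hsum : ∀ (s : Finset ℕ) (k : ℤ), (∑ n ∈ s, U ^ n).1 k = ∑ n ∈ s, (U ^ n).1 k := by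
    intro s k
    rw [AddSubmonoidClass.coe_finsetSum, Finset.sum_apply]
  have hle0 : ∀ k, 0 < k → inv φ.1 k = 0 := fun k hk => by
    rw [hinv]
    exact Finset.sum_eq_zero fun n _ => (hU1.pow n) k (by omega)
  let ψ : Op R := ⟨inv φ.1, 0, Adm.of_order_le hle0⟩
  -- Up to terms of arbitrarily low order the inverse is a finite geometric sum, so both inverse
  -- identities follow from the finite formula.
  have hψ : ∀ K : ℕ, OrdLE (-K - 1) (ψ - ∑ n ∈ Finset.range (K + 1), U ^ n) := fun K j hj => by
    change inv φ.1 j - (∑ n ∈ Finset.range (K + 1), U ^ n).1 j = 0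
    rw [hinv, hsum, sub_eq_zero]
    refine Finset.sum_subset (fun n hn => ?_) fun n _ hn => (hU1.pow n) j ?_
    · rw [Finset.mem_range] at hn ⊢; omega
    · rw [Finset.mem_range] at hn; omega
  have hφ : φ = 1 - U := by rw [hU]; abel
  refine ⟨ψ, rfl, hle0, ?_, ?_⟩ <;> rw [← sub_eq_zero] <;> refine eq_zero_of_ordLE fun K => ?_
  · have h1 : φ * ψ - 1 = φ * (ψ - ∑ n ∈ Finset.range (K + 1), U ^ n) - U ^ (K + 1) := by
      have h2 : φ * ∑ n ∈ Finset.range (K + 1), U ^ n = 1 - U ^ (K + 1) := by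
        rw [hφ, mul_neg_geom_sum]
      rw [mul_sub, h2]; abel
    rw [h1]
    exact ((hle.mul (hψ K)).mono (by omega)).sub ((hU1.pow (K + 1)).mono (by push_cast; omega))
  · have h1 : ψ * φ - 1 = (ψ - ∑ n ∈ Finset.range (K + 1), U ^ n) * φ - U ^ (K + 1) := by
      have h2 : (∑ n ∈ Finset.range (K + 1), U ^ n) * φ = 1 - U ^ (K + 1) := by
        rw [hφ, geom_sum_mul_neg]
      rw [sub_mul, h2]; abel
    rw [h1]
    exact (((hψ K).mul hle).mono (by omega)).sub ((hU1.pow (K + 1)).mono (by push_cast; omega))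

end Inverse

/-! ### The B type condition as a formula for constant terms. -/

section Adjoint

variable {R : Type} [CommRing R]

open Op

theorem adjoint_hasSum {φ : Op R} (hφ : OrdLE 0 φ) (k : ℤ) :
    HasSum (fun n : ℕ => (((k + n).negOnePow : ℤ) * Ring.choose (k + n) n) • dx n (φ.1 (k + n)))
      (adjoint φ.1 k) := by
  refine timeFn_hasSum_of_finsum (fun α => ?_) fun α => rfl
  refine (Set.finite_Iic (-k).toNat).subset fun n hn => ?_
  by_contra h
  refine hn ?_
  rw [Set.mem_Iic, not_le] at h
  rw [hφ _ (by omega), dx_map_zero, smul_zero, map_zero]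

/-- The condition on the adjoint gives `∂^p ψ = ∂^{p-1} φ^* ∂`. In the expansion, the terms with `N`
derivatives on `φ` add up by Vandermonde to a multiple of `choose (N - 1) N`, which is zero unless
`N = 0`. -/
theorem d_mul_inv_apply_zero {φ ψ : Op R} (hφ : OrdLE 0 φ)
    (hb : adjoint φ.1 = (d 1 * ψ * d (-1)).1) (p : ℤ) :
    (d p * ψ).1 0 = (p.negOnePow : ℤ) • φ.1 (-p) := by
  set χ : Op R := d 1 * ψ * d (-1)
  have h1 : d p * ψ = d (p - 1) * χ * d 1 := by
    simp only [χ, ← mul_assoc, d_mul_d]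
    rw [mul_assoc _ (d (-1)), d_mul_d, sub_add_cancel, neg_add_cancel, d_zero, mul_one]
  rw [h1, mul_d_apply]
  let G : ℕ × ℕ → TimeFn R := fun x => (Ring.choose (p - 1) x.1 *
    ((((x.1 + x.2 : ℕ) - p : ℤ).negOnePow : ℤ) * Ring.choose (((x.1 + x.2 : ℕ) : ℤ) - p) x.2)) •
      dx (x.1 + x.2) (φ.1 ((x.1 + x.2 : ℕ) - p))
  have hG : Summable G := by
    refine summable_of_hasFiniteSupport (((Set.finite_Iic p.toNat).prod
      (Set.finite_Iic p.toNat)).subset ?_)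
    rintro ⟨n, m⟩ hnm
    by_contra h
    refine hnm ?_
    have : (0 : ℤ) < (n + m : ℕ) - p := by
      simp only [Set.mem_prod, Set.mem_Iic] at h
      omega
    simp only [G]
    rw [hφ _ this, dx_map_zero, smul_zero]
  have h2 : HasSum (fun n : ℕ => Ring.choose (p - 1) n • dx n (χ.1 ((0 - 1) - (p - 1) + n)))
      (∑' x, G x) := by
    refine hG.hasSum.prod_fiberwise fun n => ?_
    have h3 := ((adjoint_hasSum hφ (n - p)).map (dxL n).toAddMonoidHom
      ((continuous_dx n).congr fun f => (dxL_apply n f).symm)).const_smul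
      (Ring.choose (p - 1) n : ℤ)
    convert! h3 using 1
    · funext m
      have h4 : ∀ z : ℤ, ∀ f : TimeFn R, (dxL n).toAddMonoidHom (z • f) = z • dx n f :=
        fun z f => (dxL_apply n _).trans (dx_map_zsmul _ _ _)
      simp only [Function.comp_apply, G]
      rw [h4, ← dx_add, smul_smul, show (n - p + m : ℤ) = (n + m : ℕ) - p by push_cast; ring]
    · rw [hb, show (0 - 1 - (p - 1) + n : ℤ) = n - p by ring]
      exact congrArg _ (dxL_apply _ _).symm
  refine (d_mul_hasSum (p - 1) χ (0 - 1)).unique ?_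
  convert! h2 using 1
  let e : Unit × (ℕ × ℕ) ≃ ℕ × ℕ := Equiv.punitProd _
  have h3 := hasSum_antidiagonal ((e.hasSum_iff).2 hG.hasSum)
  refine HasSum.unique ?_ h3
  convert! hasSum_single (f := fun x : Unit × ℕ => ∑ ab ∈ antidiagonal x.2, (G ∘ e) (x.1, ab))
    ((), 0) ?_ using 1
  · simp [G, e, dx_zero]
  · rintro ⟨u, N⟩ hN
    have hN : N ≠ 0 := fun h => hN (by rw [h])
    have h4 : ∀ ab ∈ antidiagonal N, (G ∘ e) (u, ab) =
        ((Ring.choose (p - 1) ab.1 * Ring.choose ((N : ℤ) - p) ab.2) *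
          (((N : ℤ) - p).negOnePow : ℤ)) • dx N (φ.1 (N - p)) := by
      rintro ⟨a, b⟩ hab
      simp only [Function.comp_apply, G, e, Equiv.punitProd_apply]
      rw [mem_antidiagonal.1 hab]
      congr 1
      ring_nf
    dsimp only
    rw [Finset.sum_congr rfl h4, ← Finset.sum_smul, ← Finset.sum_mul,
      ← Ring.add_choose_eq N (Commute.all _ _)]
    obtain ⟨M, rfl⟩ := Nat.exists_eq_succ_of_ne_zero hN
    rw [show (p - 1 + ((M.succ : ℕ) - p) : ℤ) = (M : ℕ) by push_cast; ring, Ring.choose_natCast,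
      Nat.choose_succ_self]
    simp

/-- For an operator `φ` with `φ^* = ∂ φ⁻¹ ∂⁻¹`, pairing with `φ` computes the constant term of
`A φ⁻¹`. -/
theorem pair_eq_mul_inv [Algebra ℂ R] {φ ψ : Op R} (hφ : OrdLE 0 φ)
    (hb : adjoint φ.1 = (d 1 * ψ * d (-1)).1) (A : Op R) : pair A.1 φ.1 = (A * ψ).1 0 := by
  obtain ⟨c, hc⟩ := A.2
  obtain ⟨e, he⟩ := φ.2
  refine (pair_hasSum hc he).unique ?_
  refine (mul_hasSum A ψ 0).prod_fiberwise fun p => ?_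
  have h1 := (d_mul_hasSum p ψ 0).mul_left (A.1 p)
  rw [d_mul_inv_apply_zero hφ hb, mul_smul_comm] at h1
  convert! h1 using 1
  funext n
  rw [compTerm, mul_smul_comm]

end Adjoint

/-! ### Right multiplication by `∂` and `Γ_B` as `z` and `∂_z`. -/

section OperatorModes

variable {R : Type} [CommRing R] [Algebra ℂ R]

namespace Op

theorem exists_adm (A : Op R) : ∃ c, Adm c A.1 := A.2

theorem mode_mul_d (A : Op R) (n j : ℤ) : mode (A * d n).1 j = mode A.1 (j - n) := by
  rw [← mode_shift]
  exact congrArg (mode · j) (funext fun k => mul_d_apply A n k)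

theorem mode_fn_mul (f : TimeFn R) (A : Op R) (j : ℤ) :
    mode (fn f * A).1 j = f * mode A.1 j := by
  obtain ⟨c, hc⟩ := A.2
  rw [← mode_congr_mul f hc]
  exact congrArg (mode · j) (funext fun k => fn_mul_apply f A k)

theorem mode_sub (A B : Op R) (j : ℤ) : mode (A - B).1 j = mode A.1 j - mode B.1 j := by
  obtain ⟨c, hc⟩ := (A - B).2
  obtain ⟨e, he⟩ := B.2
  have h := mode_add hc he j
  rw [eq_sub_iff_add_eq, ← h]
  exact congrArg (mode · j) (congrArg Subtype.val (sub_add_cancel A B))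

theorem mode_d_one_mul (A : Op R) (j : ℤ) : mode (d 1 * A).1 j = pderiv R 0 (mode A.1 j) := by
  obtain ⟨c, hc⟩ := A.2
  obtain ⟨e, he⟩ := (d 1 * A).2
  obtain ⟨a, ha⟩ := (A * d 1).exists_adm
  have h1 := (mode_pderiv hc 0 j).add (mode_hasSum ha j)
  have h2 : mode (A * d 1).1 j = mode A.1 (j - (2 * (0 : ℕ) + 1)) := by
    rw [mode_mul_d]; simp
  rw [h2, sub_add_cancel] at h1
  refine (mode_hasSum he j).unique ?_
  convert! h1 using 1
  funext m
  rw [d_one_mul_apply, mul_d_apply, mul_add]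

theorem mode_d_mul (n : ℕ) (A : Op R) (j : ℤ) : mode (d n * A).1 j = dx n (mode A.1 j) := by
  induction n with
  | zero => rw [Nat.cast_zero, d_zero, one_mul, dx_zero]
  | succ n ih =>
    rw [show (d ((n + 1 : ℕ) : ℤ) : Op R) = d 1 * d n by rw [d_mul_d]; push_cast; rw [add_comm],
      mul_assoc, mode_d_one_mul, ih, dx_succ]

theorem fil_gammaB (j : ℤ) : Fil wx (j - 0) (gammaB j : TimeFn R) := by
  rw [gammaB]
  split_ifs with h
  · refine Fil.zsmul (fun α hα => ?_) _
    rw [MvPowerSeries.coeff_X] at hα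
    split_ifs at hα with h1
    · rw [h1, linWeight_single]
      obtain ⟨h2, k, hk⟩ := h
      omega
    · exact absurd rfl hα
  · exact Fil.zero

/-- The operator `Γ_B`. -/
def gam : Op R := ⟨gammaB, 0, fil_gammaB⟩

theorem pderiv_gammaB (j : ℤ) : pderiv R 0 (gammaB j : TimeFn R) = if j = 0 then 1 else 0 := by
  rw [gammaB]
  by_cases h : j = 0
  · subst h
    simp
  · rw [if_neg h]
    split_ifs with h1
    · obtain ⟨h2, k, hk⟩ := h1
      rw [map_zsmul, MvPowerSeries.pderiv_X_of_ne (by omega), smul_zero]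
    · exact map_zero _

theorem dx_gammaB (n : ℕ) (j : ℤ) : dx (n + 2) (gammaB j : TimeFn R) = 0 := by
  rw [dx_add, dx_succ, dx_one, pderiv_gammaB]
  split_ifs
  · rw [MvPowerSeries.pderiv_one, dx_map_zero]
  · rw [map_zero, dx_map_zero]

/-- As an operator symbol `Γ_B` has `x`-derivative `1` and second `x`-derivative `0`, so the
composition has only the undifferentiated terms and the correction `(k + 1) A_{k+1}`. -/
theorem mul_gam_hasSum (A : Op R) (k : ℤ) :
    HasSum (fun p : ℤ => A.1 p * gammaB (k - p)) ((A * gam).1 k - (k + 1) • A.1 (k + 1)) := by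
  have h1 : HasSum (fun p : ℤ => A.1 p * gammaB (k - p) +
      if p = k + 1 then p • A.1 p else 0) ((A * gam).1 k) := by
    refine (mul_hasSum A gam k).prod_fiberwise fun p => ?_
    convert! hasSum_sum_of_ne_finset_zero (L := .unconditional ℕ) (s := {0, 1})
      (f := fun n : ℕ => compTerm A.1 gam.1 k (p, n)) ?_ using 1
    · rw [Finset.sum_pair (by simp)]
      simp only [compTerm, gam, dx_zero, dx_one, pderiv_gammaB, Ring.choose_zero_right,
        Ring.choose_one_right]
      simp only [one_smul, Nat.cast_zero, add_zero, Nat.cast_one]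
      by_cases h : p = k + 1
      · rw [if_pos h, if_pos (by omega), mul_one]
      · rw [if_neg h, if_neg (by omega), mul_zero, smul_zero]
    · intro n hn
      have h2 : 1 < n := by simp at hn; omega
      obtain ⟨m, rfl⟩ := Nat.exists_eq_add_of_le' h2
      simp only [compTerm, gam]
      rw [dx_gammaB, mul_zero, smul_zero]
  have h2 : HasSum (fun p : ℤ => if p = k + 1 then p • A.1 p else 0)
      ((k + 1) • A.1 (k + 1)) := by
    convert! hasSum_single (f := fun p : ℤ => if p = k + 1 then p • A.1 p else 0) (k + 1) ?_ using 1
    · rw [if_pos rfl]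
    · intro p hp; rw [if_neg hp]
  simpa only [add_sub_cancel_right] using h1.sub h2

/-- The terms of the modes of `A Γ_B`. -/
def gamTerm (A : Op R) (j : ℤ) (x : ℤ × ℤ) : TimeFn R :=
  schur R (j - x.1) * (A.1 x.2 * gammaB (x.1 - x.2))

theorem gamTerm_summable (A : Op R) (j : ℤ) : Summable (gamTerm A j) := by
  obtain ⟨c, hc⟩ := A.2
  refine timeFn_summable_of_finite fun α => ?_
  have key : ∀ x : ℤ × ℤ, coeff α (gamTerm A j x) ≠ 0 → j - x.1 ≤ wt α ∧ x.2 - c ≤ wt α ∧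
      x.1 - x.2 - 0 ≤ wt α := fun x hx =>
    ⟨(schur_fil (j - x.1)).mul_right α hx, (hc x.2).wt_of_wx.mul_right.mul_left α hx,
      (fil_gammaB (R := R) (x.1 - x.2)).wt_of_wx.mul_left.mul_left α hx⟩
  refine ((Set.finite_Icc (j - wt α) (c + wt α + wt α)).prod
    (Set.finite_Icc (j - wt α - wt α) (c + wt α))).subset fun x hx => ?_
  have := key x hx
  generalize ((wt α : ℕ) : ℤ) = w at this ⊢
  rw [Set.mem_prod, Set.mem_Icc, Set.mem_Icc]
  omega

theorem gamTerm_fiber (A : Op R) (j p : ℤ) :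
    HasSum (fun k : ℤ => gamTerm A j (k, p)) (A.1 p * ((j + 1 - p) • schur R (j + 1 - p))) := by
  have h3 := (schur_euler (R := R) (j + 1 - p)).mul_left (A.1 p)
  have hinj : Function.Injective fun i : ℕ => p + 2 * (i : ℤ) := fun a b h => by
    simp only at h; omega
  rw [← hinj.hasSum_iff]
  · refine h3.congr_fun fun i => ?_
    simp only [Function.comp_apply, gamTerm]
    rw [add_sub_cancel_left, gammaB, if_pos ⟨by omega, even_two_mul _⟩,
      show j + 1 - p - (2 * i + 1) = j - (p + 2 * i) by ring,
      show (2 * (i : ℤ) / 2).toNat = i by omega]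
    simp only [mul_smul_comm]
    congr 1; ring
  · intro k hk
    have h4 : ¬(0 ≤ k - p ∧ Even (k - p)) := by
      rintro ⟨h5, m, hm⟩
      exact hk ⟨m.toNat, by simp only; omega⟩
    rw [gamTerm, gammaB, if_neg h4, mul_zero, mul_zero]

/-- The reason is `Γ_B e^ξ = ∂_z e^ξ`: as `A` does not involve `z`, applying `A Γ_B` to `e^ξ` is the
same as applying `∂_z` to `A e^ξ`. The Euler identity `schur_euler` carries out the comparison: it
contributes the factor `j + 1 - m`, and the correction in `mul_gam_hasSum` contributes `m`. -/
theorem mode_mul_gam (A : Op R) (j : ℤ) : mode (A * gam).1 j = (j + 1) • mode A.1 (j + 1) := by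
  obtain ⟨c, hc⟩ := exists_adm A
  obtain ⟨e, he⟩ := exists_adm (A * gam)
  have hF := (gamTerm_summable A j).hasSum
  have h1 : HasSum (fun k : ℤ => schur R (j - k) * ((A * gam).1 k - (k + 1) • A.1 (k + 1)))
      (∑' x, gamTerm A j x) :=
    hF.prod_fiberwise fun k => ((mul_gam_hasSum A k).mul_left _).congr_fun fun p => by rw [gamTerm]
  have h2 : HasSum (fun p : ℤ => A.1 p * ((j + 1 - p) • schur R (j + 1 - p)))
      (∑' x, gamTerm A j x) :=
    (((Equiv.prodComm _ _).hasSum_iff (f := gamTerm A j)).2 hF).prod_fiberwise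
      fun p => (gamTerm_fiber A j p).congr_fun fun k => by
        rw [Function.comp_apply, Equiv.prodComm_apply, Prod.swap_prod_mk]
  have h3 : HasSum (fun m : ℤ => schur R (j + 1 - m) * (m • A.1 m))
      (mode (A * gam).1 j - ∑' x, gamTerm A j x) := by
    rw [← (Equiv.addRight (1 : ℤ)).hasSum_iff]
    refine ((mode_hasSum he j).sub h1).congr_fun fun k => ?_
    simp only [Function.comp_apply, Equiv.coe_addRight]
    rw [add_sub_add_right_eq_sub, ← mul_sub, sub_sub_cancel]
  have h4 := h3.add h2
  rw [sub_add_cancel] at h4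
  refine h4.unique (((mode_hasSum hc (j + 1)).const_smul (j + 1)).congr_fun fun m => ?_)
  rw [mul_smul_comm, mul_smul_comm, mul_comm (A.1 m), ← add_smul, add_sub_cancel]

/-- `k(k-1)⋯(k-p+1)`. -/
def fallFact (k : ℤ) (p : ℕ) : ℤ := p.factorial * Ring.choose k p

theorem fallFact_zero (k : ℤ) : fallFact k 0 = 1 := by simp [fallFact]

theorem fallFact_succ (k : ℤ) (p : ℕ) : fallFact k (p + 1) = fallFact k p * (k - p) := by
  have h1 := Ring.descPochhammer_eq_factorial_smul_choose k (p + 1)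
  have h2 := Ring.descPochhammer_eq_factorial_smul_choose k p
  rw [descPochhammer_succ_right, Polynomial.smeval_mul, Polynomial.smeval_sub, h2] at h1
  simp only [Polynomial.smeval_X, pow_one, nsmul_eq_mul, Polynomial.smeval_natCast, pow_zero,
    mul_one] at h1
  exact h1.symm

theorem mode_mul_gam_pow (A : Op R) (p : ℕ) (j : ℤ) :
    mode (A * gam ^ p).1 j = fallFact (j + p) p • mode A.1 (j + p) := by
  induction p generalizing j with
  | zero => rw [pow_zero, mul_one, fallFact_zero, one_smul, Nat.cast_zero, add_zero]
  | succ p ih =>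
    rw [pow_succ, ← mul_assoc, mode_mul_gam, ih, smul_smul, fallFact_succ]
    push_cast
    rw [show j + 1 + (p : ℤ) = j + (p + 1) by ring]
    congr 1; ring

theorem pair_mul_d (A B : Op R) (n : ℤ) :
    pair (A * d n).1 B.1 = (n.negOnePow : ℤ) • pair A.1 (B * d n).1 := by
  obtain ⟨c, hc⟩ := (A * d n).2
  obtain ⟨a, ha⟩ := A.2
  obtain ⟨b, hb⟩ := B.2
  obtain ⟨e, he⟩ := (B * d n).2
  refine (pair_hasSum hc hb).unique ?_
  convert! ((Equiv.subRight n).hasSum_iff.2 (pair_hasSum ha he)).const_smul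
    (n.negOnePow : ℤ) using 1
  funext j
  simp only [Function.comp_apply, Equiv.subRight_apply, mul_d_apply]
  rw [smul_smul, Int.negOnePow_sub, ← Units.val_mul, mul_comm n.negOnePow, mul_assoc,
    Int.units_mul_self, mul_one, show -(j - n) - n = -j by ring]

end Op

end OperatorModes

/-! ### The hierarchy flows and the bilinear identity. -/

section TimeFlows

variable {R : Type} [CommRing R]

namespace Op

/-- The derivative of an operator with respect to `t_{2i+1}`. -/
def pd (i : ℕ) (A : Op R) : Op R := ⟨fun k => pderiv R i (A.1 k), by
  obtain ⟨c, hc⟩ := A.2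
  refine ⟨c + 2 * i, fun j α hα => ?_⟩
  rw [MvPowerSeries.coeff_pderiv] at hα
  have := hc j _ (left_ne_zero_of_mul hα)
  rw [wx_add_single] at this
  push_cast at this
  omega⟩

theorem dx_pderiv (n i : ℕ) (f : TimeFn R) : dx n (pderiv R i f) = pderiv R i (dx n f) := by
  induction n with
  | zero => rw [dx_zero, dx_zero]
  | succ n ih => rw [dx_succ, ih, dx_succ, pderiv_comm]

theorem pd_mul (i : ℕ) (A B : Op R) : pd i (A * B) = pd i A * B + A * pd i B := by
  ext k : 2
  refine ((mul_hasSum A B k).map (pderiv R i) (continuous_pderiv i)).unique ?_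
  convert! (mul_hasSum (pd i A) B k).add (mul_hasSum A (pd i B) k) using 1
  funext x
  simp only [Function.comp_apply, compTerm, pd, map_zsmul, Derivation.leibniz, dx_pderiv,
    smul_eq_mul]
  rw [smul_add, add_comm, mul_comm (dx x.2 _)]

/-- The negative part of an operator. -/
def neg (A : Op R) : Op R := ⟨negPart A.1, by
  obtain ⟨c, hc⟩ := A.2
  refine ⟨c, fun j => ?_⟩
  rw [negPart]
  split_ifs
  · exact hc j
  · exact Fil.zero⟩

/-- `φ` satisfies the hierarchy and `ψ` is its inverse. -/
structure Dressing (φ ψ : Op R) : Prop where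
  ordLE : OrdLE 0 φ
  monic : φ.1 0 = 1
  ordLE_inv : OrdLE 0 ψ
  mul_inv : φ * ψ = 1
  inv_mul : ψ * φ = 1
  adj : adjoint φ.1 = (d 1 * ψ * d (-1)).1
  flow : ∀ i, pd i φ = -(neg (φ * d (2 * i + 1) * ψ) * φ)

theorem _root_.CMBKP.IsDressing.exists_op {Φ : PsiDO R} (h : IsDressing Φ) :
    ∃ φ ψ : Op R, φ.1 = Φ ∧ ψ.1 = inv Φ ∧ Dressing φ ψ := by
  let φ : Op R := ⟨Φ, 0, Adm.of_order_le h.order_le⟩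
  obtain ⟨ψ, hψ, hle, h1, h2⟩ := inv_spec (φ := φ) h.monic h.order_le
  refine ⟨φ, ψ, rfl, hψ, ⟨h.order_le, h.monic, hle, h1, h2, ?_, fun i => ?_⟩⟩
  · rw [coe_mul, coe_mul, hψ]; exact h.bType
  · ext j : 2
    have h3 := h.flow i j
    rw [timeDeriv_single] at h3
    refine h3.trans ?_
    change -comp _ _ j = -comp _ _ j
    rw [show negPart (laxPow Φ (2 * i + 1)) = (neg (φ * d (2 * i + 1) * ψ)).1 by
      simp only [neg, coe_mul, hψ]; rfl]

variable {φ ψ : Op R}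

theorem Dressing.pair_mul [Algebra ℂ R] (h : Dressing φ ψ) (A : Op R) :
    pair (A * φ).1 φ.1 = A.1 0 := by
  rw [pair_eq_mul_inv h.ordLE h.adj, mul_assoc, h.mul_inv, mul_one]

/-- This constant term is the pairing of `φ ∂^{2i+1}` with `φ`. Moving an odd power of `∂` across
changes the sign, while the pairing is symmetric, so the term equals its own negative. -/
theorem Dressing.lax_apply_zero [Algebra ℂ R] (h : Dressing φ ψ) (i : ℕ) :
    (φ * d (2 * i + 1) * ψ).1 0 = 0 := by
  rw [← h.pair_mul, mul_assoc, h.inv_mul, mul_one]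
  have h1 := pair_mul_d φ φ (2 * i + 1)
  rw [pair_comm φ.1, Int.negOnePow_odd _ ⟨i, rfl⟩, Units.val_neg, Units.val_one, neg_one_smul,
    eq_neg_iff_add_eq_zero, ← two_nsmul] at h1
  have := isAddTorsionFree_of_complex R
  ext α
  have h2 := congrArg (coeff α) h1
  rw [map_nsmul, map_zero] at h2
  rw [map_zero]
  exact (smul_eq_zero.1 h2).resolve_left two_ne_zero

/-- The flow equation reads `∂_i w = (L^{2i+1})_+ w`, where the positive part has no constant term
by `lax_apply_zero`. Iterating, every time derivative of `w` is a differential operator applied to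
`w`, again without constant term if `β ≠ 0`. -/
theorem Dressing.exists_timeDeriv [Algebra ℂ R] (h : Dressing φ ψ) (β : ℕ →₀ ℕ) :
    ∃ P : Op R, (∀ j, j < 0 → P.1 j = 0) ∧ P.1 0 = (if β = 0 then 1 else 0) ∧
      ∀ j, mode (P * φ).1 j = timeDeriv β (mode φ.1 j) := by
  induction hn : wt β using Nat.strong_induction_on generalizing β with
  | _ n ih =>
    by_cases hβ : β = 0
    · refine ⟨1, fun j hj => if_neg hj.ne, ?_, fun j => ?_⟩
      · rw [if_pos hβ]; rfl
      · rw [one_mul, hβ, timeDeriv_zero]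
    · obtain ⟨i, hi⟩ := Finsupp.ne_iff.1 hβ
      obtain ⟨δ, rfl⟩ := eq_add_single hi
      obtain ⟨P, hP1, hP2, hP3⟩ := ih (wt δ) (by rw [← hn, wt_add_single]; omega) δ rfl
      set L : Op R := φ * d (2 * i + 1) * ψ
      set Lp : Op R := L - neg L with hLp
      have hL : Lp * φ = pd i φ + φ * d (2 * i + 1) := by
        rw [hLp, sub_mul, h.flow i, mul_assoc _ ψ, h.inv_mul, mul_one]
        abel
      have hLp0 : ∀ j, j ≤ 0 → Lp.1 j = 0 := fun j hj => by
        change L.1 j - negPart L.1 j = 0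
        rw [negPart]
        rcases hj.lt_or_eq with hj | rfl
        · rw [if_pos hj, sub_self]
        · rw [if_neg (lt_irrefl _), sub_zero]
          exact h.lax_apply_zero i
      refine ⟨pd i P + P * Lp, fun j hj => ?_, ?_, fun j => ?_⟩
      · change pderiv R i (P.1 j) + (P * Lp).1 j = 0
        rw [hP1 j hj, map_zero, zero_add]
        exact mul_nonneg_order hP1 (fun j hj => hLp0 j hj.le) j hj
      · change pderiv R i (P.1 0) + (P * Lp).1 0 = _
        rw [mul_apply_zero_of_pos hLp0 hP1, hP2, if_neg hβ, add_zero]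
        split_ifs
        · exact MvPowerSeries.pderiv_one
        · exact map_zero _
      · rw [timeDeriv_add_single, ← hP3 j]
        have h1 : (pd i P + P * Lp) * φ = pd i (P * φ) + P * φ * d (2 * i + 1) := by
          rw [pd_mul, add_mul, mul_assoc P, hL]
          noncomm_ring
        obtain ⟨a, ha⟩ := (pd i (P * φ)).2
        obtain ⟨b, hb⟩ := (P * φ).2
        obtain ⟨e, he⟩ := (P * φ * d (2 * i + 1)).2
        rw [h1]
        refine (mode_add ha he j).trans ?_
        rw [mode_mul_d, (mode_hasSum ha j).unique (mode_pderiv hb i j), sub_add_cancel]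

/-- Read `T` as the series `∑ T_β(t) t'^β`. The hypothesis prescribes all its `t'`-derivatives on
the diagonal `t' = t`, and these determine it: in the `t^δ` coefficient the term with `p.2 = 0`
carries a nonzero product of factorials, and all others involve coefficients of smaller weight in
`t`. -/
theorem diag_ext [Algebra ℂ R] {T : (ℕ →₀ ℕ) → TimeFn R}
    (h : ∀ β δ : ℕ →₀ ℕ, ∑ p ∈ antidiagonal δ,
      (β.prod fun i b => (p.2 i + b).descFactorial b) • coeff p.1 (T (p.2 + β)) =
        if β = 0 ∧ δ = 0 then 1 else 0) (β α : ℕ →₀ ℕ) :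
    coeff α (T β) = if β = 0 ∧ α = 0 then 1 else 0 := by
  induction hn : wt α using Nat.strong_induction_on generalizing α β with
  | _ n ih =>
    have h1 := h β α
    have hpos : ∀ γ : ℕ →₀ ℕ, γ ≠ 0 → 0 < wt γ := fun γ hγ => by
      obtain ⟨i, hi⟩ := Finsupp.ne_iff.1 hγ
      obtain ⟨δ, rfl⟩ := eq_add_single hi
      rw [wt_add_single]; omega
    rw [Finset.sum_eq_single (α, 0)] at h1
    · simp only [Finsupp.coe_zero, Pi.zero_apply, zero_add, Nat.descFactorial_self] at h1
      by_cases hβ : β = 0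
      · rw [hβ] at h1 ⊢
        simpa using h1
      · rw [if_neg (fun h => hβ h.1)] at h1 ⊢
        have := isAddTorsionFree_of_complex R
        refine (smul_eq_zero.1 h1).resolve_left ?_
        exact Finset.prod_ne_zero_iff.2 fun i _ => Nat.factorial_ne_zero _
    · rintro ⟨p, q⟩ hp hne
      have hp := mem_antidiagonal.1 hp
      have hq : q ≠ 0 := by
        rintro rfl
        exact hne (by simpa using hp)
      have h2 := hpos q hq
      have h3 : wt p + wt q = wt α := by rw [← map_add]; exact congrArg _ hp
      rw [ih (wt p) (by omega) (q + β) p rfl, if_neg, smul_zero]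
      rintro ⟨h4, -⟩
      exact hq (add_eq_zero.1 h4).1
    · intro hne
      exact absurd (mem_antidiagonal.2 (add_zero α)) hne

theorem coeff_ite_one (p : Prop) [Decidable p] (α : ℕ →₀ ℕ) :
    coeff α (if p then (1 : TimeFn R) else 0) = if p ∧ α = 0 then 1 else 0 := by
  classical
  by_cases hp : p
  · rw [if_pos hp, MvPowerSeries.coeff_one]
    simp only [hp, true_and]
  · rw [if_neg hp, map_zero, if_neg fun h => hp h.1]

/-- The bilinear identity of the BKP hierarchy, with the second set of times expanded. -/
theorem Dressing.bilinear [Algebra ℂ R] (h : Dressing φ ψ) (β : ℕ →₀ ℕ) :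
    HasSum (fun j : ℤ => (j.negOnePow : ℤ) • (coeff β (mode φ.1 (-j)) • mode φ.1 j))
      (if β = 0 then 1 else 0) := by
  have hadm : Adm 0 φ.1 := Adm.of_order_le h.ordLE
  have hs : ∀ β : ℕ →₀ ℕ, Summable
      fun j : ℤ => (j.negOnePow : ℤ) • (coeff β (mode φ.1 (-j)) • mode φ.1 j) := fun β =>
    timeFn_summable_of_finite fun α => by
      refine (Set.finite_Icc (-(wt β : ℤ)) (wt α)).subset fun j hj => ?_
      have hj : coeff β (mode φ.1 (-j)) * coeff α (mode φ.1 j) ≠ 0 := fun h1 => hj (by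
        rw [map_zsmul, MvPowerSeries.coeff_smul, h1, smul_zero])
      have h1 := mode_fil hadm (-j) _ (left_ne_zero_of_mul hj)
      have h2 := mode_fil hadm j _ (right_ne_zero_of_mul hj)
      rw [Set.mem_Icc]; omega
  set T : (ℕ →₀ ℕ) → TimeFn R :=
    fun β => ∑' j : ℤ, (j.negOnePow : ℤ) • (coeff β (mode φ.1 (-j)) • mode φ.1 j)
  have key := diag_ext (T := T) fun β δ => by
    obtain ⟨P, -, hP2, hP3⟩ := h.exists_timeDeriv β
    obtain ⟨c, hc⟩ := (P * φ).2
    -- On the diagonal, the derivative in `t'` is the pairing of `φ` with `P φ`, that is, the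
    -- constant term of `P`.
    have h1 := pair_eq_modes hadm hc
    rw [pair_comm, h.pair_mul, hP2] at h1
    have h2 := (timeFn_hasSum_coeff h1 δ).2
    simp only [hP3, map_zsmul, MvPowerSeries.coeff_mul, timeDeriv_coeff, Finset.smul_sum] at h2
    rw [coeff_ite_one] at h2
    have h3 := fun p : (ℕ →₀ ℕ) × (ℕ →₀ ℕ) => timeFn_hasSum_coeff (hs (p.2 + β)).hasSum p.1
    have h4 : ∀ (p : (ℕ →₀ ℕ) × (ℕ →₀ ℕ)) (j : ℤ),
        (j.negOnePow : ℤ) • (coeff p.1 (mode φ.1 j) *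
          (β.prod fun i b => (p.2 i + b).descFactorial b) • coeff (p.2 + β) (mode φ.1 (-j))) =
        (β.prod fun i b => (p.2 i + b).descFactorial b) •
          coeff p.1 ((j.negOnePow : ℤ) • (coeff (p.2 + β) (mode φ.1 (-j)) • mode φ.1 j)) := by
      intro p j
      rw [map_zsmul, MvPowerSeries.coeff_smul, mul_smul_comm, smul_comm, mul_comm]
    simp only [h4] at h2
    rw [h2, finsum_sum_comm (antidiagonal δ) (fun (j : ℤ) (p : (ℕ →₀ ℕ) × (ℕ →₀ ℕ)) =>
      (β.prod fun i b => (p.2 i + b).descFactorial b) •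
        coeff p.1 ((j.negOnePow : ℤ) • (coeff (p.2 + β) (mode φ.1 (-j)) • mode φ.1 j)))
      fun p _ => (h3 p).1.subset fun j hj h5 => hj (by simp only [h5, smul_zero])]
    refine Finset.sum_congr rfl fun p _ => ?_
    rw [(h3 p).2, smul_finsum' _ (h3 p).1]
  have h5 : T β = if β = 0 then 1 else 0 := by
    ext α
    rw [key, coeff_ite_one]
  rw [← h5]
  exact (hs β).hasSum

end Op

end TimeFlows

/-! ### Operators `∑ κ(γ,β) t^γ ∂^β` of a fixed degree. -/

section KernelOperators

variable {R : Type} [CommRing R]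

theorem finsupp_single_induction {P : (ℕ →₀ ℕ) → Prop} (h0 : P 0)
    (h : ∀ β i, P β → P (β + Finsupp.single i 1)) (β : ℕ →₀ ℕ) : P β := by
  induction hn : wt β using Nat.strong_induction_on generalizing β with
  | _ n ih =>
    by_cases hβ : β = 0
    · rwa [hβ]
    · obtain ⟨i, hi⟩ := Finsupp.ne_iff.1 hβ
      obtain ⟨δ, rfl⟩ := eq_add_single hi
      exact h δ i (ih (wt δ) (by rw [← hn, wt_add_single]; omega) δ rfl)

theorem timeDeriv_map_add (β : ℕ →₀ ℕ) (f g : TimeFn R) :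
    timeDeriv β (f + g) = timeDeriv β f + timeDeriv β g := by
  ext δ; simp only [timeDeriv_coeff, map_add, smul_add]

theorem timeDeriv_smul (β : ℕ →₀ ℕ) (a : R) (f : TimeFn R) :
    timeDeriv β (a • f) = a • timeDeriv β f := by
  ext δ
  rw [MvPowerSeries.coeff_smul, timeDeriv_coeff, timeDeriv_coeff, MvPowerSeries.coeff_smul,
    mul_smul_comm]

theorem timeDeriv_pderiv (β : ℕ →₀ ℕ) (i : ℕ) (f : TimeFn R) :
    timeDeriv β (pderiv R i f) = pderiv R i (timeDeriv β f) := by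
  induction β using finsupp_single_induction with
  | h0 => rw [timeDeriv_zero, timeDeriv_zero]
  | h β j ih => rw [timeDeriv_add_single, ih, timeDeriv_add_single, pderiv_comm]

/-- When `β i = 0` the truncated difference is `β` itself, but its coefficient is zero. -/
theorem timeDeriv_X_mul (β : ℕ →₀ ℕ) (i : ℕ) (f : TimeFn R) :
    timeDeriv β (X i * f) = X i * timeDeriv β f + β i • timeDeriv (β - Finsupp.single i 1) f := by
  induction β using finsupp_single_induction with
  | h0 => simp [timeDeriv_zero]
  | h β j ih =>
    rw [timeDeriv_add_single, ih, map_add, map_nsmul, Derivation.leibniz, ← timeDeriv_add_single,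
      ← timeDeriv_add_single, smul_eq_mul, smul_eq_mul, add_assoc]
    congr 1
    by_cases hij : i = j
    · subst hij
      rw [MvPowerSeries.pderiv_X_self, mul_one, add_tsub_cancel_right, Finsupp.add_apply,
        Finsupp.single_eq_same, add_smul, one_smul, add_comm]
      congr 1
      by_cases h : β i = 0
      · rw [h, zero_smul, zero_smul]
      · rw [tsub_add_cancel_of_le (by rw [Finsupp.single_le_iff]; omega)]
    · rw [MvPowerSeries.pderiv_X_of_ne hij, mul_zero, zero_add, Finsupp.add_apply,
        Finsupp.single_eq_of_ne hij, add_zero]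
      by_cases h : β i = 0
      · rw [h, zero_smul, zero_smul]
      · rw [tsub_add_eq_add_tsub (by rw [Finsupp.single_le_iff]; omega)]

theorem pderiv_monomial_add (γ : ℕ →₀ ℕ) (i : ℕ) :
    pderiv R i (monomial (γ + Finsupp.single i 1) (1 : R)) =
      (γ i + 1 : ℕ) • (monomial γ (1 : R) : TimeFn R) := by
  classical
  ext δ
  rw [MvPowerSeries.coeff_pderiv, map_nsmul, MvPowerSeries.coeff_monomial,
    MvPowerSeries.coeff_monomial]
  by_cases h : δ = γ
  · subst h; simp
  · rw [if_neg h, if_neg (by simpa using h)]; simp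

theorem pderiv_monomial_of_eq_zero {γ : ℕ →₀ ℕ} {i : ℕ} (h : γ i = 0) :
    pderiv R i (monomial γ (1 : R)) = 0 := by
  classical
  ext δ
  rw [MvPowerSeries.coeff_pderiv, MvPowerSeries.coeff_monomial, if_neg, zero_mul, map_zero]
  rintro rfl
  simp at h

theorem fil_monomial (γ : ℕ →₀ ℕ) (a : R) : Fil wt (wt γ) (monomial γ a : TimeFn R) := by
  classical
  intro α hα
  rw [MvPowerSeries.coeff_monomial] at hα
  split_ifs at hα with h
  · rw [h]
  · exact absurd rfl hα

/-- Each coefficient of `T f` of weight `n` only depends on the coefficients of `f` of weight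
`n + r`. -/
def Homog (r : ℤ) (T : TimeFn R → TimeFn R) : Prop :=
  ∀ f α, (∀ δ, (wt δ : ℤ) = wt α + r → coeff δ f = 0) → coeff α (T f) = 0

theorem Homog.continuous {r : ℤ} {T : TimeFn R →ₗ[R] TimeFn R} (h : Homog r T) :
    Continuous T := by
  refine continuous_of_local T.toAddMonoidHom
    (fun α => (finite_wt_le (wt α + r).toNat).toFinset) fun f α hf => h f α fun δ hδ => hf δ ?_
  rw [Set.Finite.mem_toFinset]
  change wt δ ≤ _
  omega

variable [Algebra ℂ R]

theorem coeff_csmul (z : ℂ) (f : TimeFn R) (α : ℕ →₀ ℕ) : coeff α (z • f) = z • coeff α f := rfl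

theorem continuous_csmul (z : ℂ) : Continuous (fun f : TimeFn R => z • f) := by
  have : (fun f : TimeFn R => z • f) = fun f => C (algebraMap ℂ R z) * f := by
    funext f; ext α
    rw [MvPowerSeries.coeff_C_mul, coeff_csmul, Algebra.smul_def]
  rw [this]
  exact continuous_const.mul continuous_id

theorem Fil.csmul {w : (ℕ →₀ ℕ) →+ ℕ} {c : ℤ} {f : TimeFn R} (h : Fil w c f) (z : ℂ) :
    Fil w c (z • f) := fun α hα => h α fun h0 => hα (by rw [coeff_csmul, h0, smul_zero])

/-- The terms of the operator `∑_{γ,β} κ(γ,β) t^γ ∂^β`, restricted to degree `-r`. -/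
def kTerm (κ : (ℕ →₀ ℕ) × (ℕ →₀ ℕ) → ℂ) (r : ℤ) (f : TimeFn R) (p : (ℕ →₀ ℕ) × (ℕ →₀ ℕ)) :
    TimeFn R :=
  if (wt p.1 : ℤ) - wt p.2 = -r then κ p • (monomial p.1 (1 : R) * timeDeriv p.2 f) else 0

theorem kTerm_finite (κ : (ℕ →₀ ℕ) × (ℕ →₀ ℕ) → ℂ) (r : ℤ) (f : TimeFn R) (α : ℕ →₀ ℕ) :
    {p | coeff α (kTerm κ r f p) ≠ 0}.Finite := by
  refine ((finite_wt_le (wt α)).prod (finite_wt_le (wt α + r).toNat)).subset ?_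
  rintro ⟨γ, β⟩ hp
  rw [Set.mem_ofPred_eq, kTerm] at hp
  split_ifs at hp with h
  · have h1 := ((fil_monomial γ (1 : R)).mul_right.csmul _) α hp
    simp only at h
    constructor
    · change wt γ ≤ _; omega
    · change wt β ≤ _; omega
  · exact absurd (map_zero _) hp

/-- The operator `∑_{γ,β} κ(γ,β) t^γ ∂^β`, restricted to degree `-r`. -/
def KOp (κ : (ℕ →₀ ℕ) × (ℕ →₀ ℕ) → ℂ) (r : ℤ) (f : TimeFn R) : TimeFn R :=
  ∑' p, kTerm κ r f p

variable (κ κ' : (ℕ →₀ ℕ) × (ℕ →₀ ℕ) → ℂ) (r : ℤ) (f g : TimeFn R)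

theorem kop_hasSum : HasSum (kTerm κ r f) (KOp κ r f) :=
  (timeFn_summable_of_finite (kTerm_finite κ r f)).hasSum

theorem vertexMode_eq_KOp (m : ℕ) :
    vertexMode m r f = KOp (fun p => PowerSeries.coeff m (vertexSeries p.1 p.2)) r f := by
  refine HasSum.unique ?_ (kop_hasSum _ r f)
  refine timeFn_hasSum_of_finsum (kTerm_finite _ r f) fun α => finsum_congr fun p => ?_
  rw [kTerm]
  split_ifs with h1 h2 h2
  · rfl
  · exact absurd h1 h2
  · exact absurd h2 h1
  · exact (map_zero _).symm

theorem KOp_add : KOp κ r (f + g) = KOp κ r f + KOp κ r g := by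
  refine (kop_hasSum κ r (f + g)).unique
    (((kop_hasSum κ r f).add (kop_hasSum κ r g)).congr_fun fun p => ?_)
  simp only [kTerm]
  split_ifs
  · rw [timeDeriv_map_add, mul_add, smul_add]
  · rw [add_zero]

theorem KOp_smul (a : R) : KOp κ r (a • f) = a • KOp κ r f := by
  refine (kop_hasSum κ r (a • f)).unique (HasSum.congr_fun (f := fun p => a • kTerm κ r f p) ?_
    fun p => ?_)
  · have h := (kop_hasSum κ r f).mul_left (C a)
    simpa only [← MvPowerSeries.smul_eq_C_mul] using h
  · simp only [kTerm]
    split_ifs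
    · rw [timeDeriv_smul, mul_smul_comm, smul_comm]
    · rw [smul_zero]

theorem KOp_kernel_add : KOp (κ + κ') r f = KOp κ r f + KOp κ' r f := by
  refine (kop_hasSum (κ + κ') r f).unique
    (((kop_hasSum κ r f).add (kop_hasSum κ' r f)).congr_fun fun p => ?_)
  simp only [kTerm]
  split_ifs
  · rw [Pi.add_apply, add_smul]
  · rw [add_zero]

theorem KOp_kernel_smul (z : ℂ) : KOp (z • κ) r f = z • KOp κ r f := by
  refine (kop_hasSum (z • κ) r f).unique (HasSum.congr_fun (f := fun p => z • kTerm κ r f p) ?_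
    fun p => ?_)
  · exact (kop_hasSum κ r f).map (DistribSMul.toAddMonoidHom (TimeFn R) z)
      (continuous_csmul z)
  · simp only [kTerm]
    split_ifs
    · rw [Pi.smul_apply, smul_eq_mul, mul_smul]
    · rw [smul_zero]

theorem KOp_kernel_sum {ι : Type*} (s : Finset ι) (K : ι → (ℕ →₀ ℕ) × (ℕ →₀ ℕ) → ℂ) :
    KOp (∑ i ∈ s, K i) r f = ∑ i ∈ s, KOp (K i) r f := by
  classical
  induction s using Finset.induction_on with
  | empty =>
    rw [Finset.sum_empty, Finset.sum_empty]
    have := KOp_kernel_smul 0 r f 0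
    rwa [zero_smul, zero_smul] at this
  | insert i s hi ih => rw [Finset.sum_insert hi, Finset.sum_insert hi, KOp_kernel_add, ih]

/-- `KOp` as a linear map. -/
def KOpL : TimeFn R →ₗ[R] TimeFn R where
  toFun := KOp κ r
  map_add' := KOp_add κ r
  map_smul' := fun a f => KOp_smul κ r f a

theorem KOpL_apply : KOpL κ r f = KOp κ r f := rfl

theorem homog_KOp : Homog r (KOp (R := R) κ r) := fun f α hf => by
  rw [(timeFn_hasSum_coeff (kop_hasSum κ r f) α).2]
  refine finsum_eq_zero_of_forall_eq_zero fun p => ?_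
  rw [kTerm]
  split_ifs with h
  · rw [coeff_csmul, MvPowerSeries.coeff_mul, Finset.sum_eq_zero, smul_zero]
    intro x hx
    have hx := mem_antidiagonal.1 hx
    by_cases h1 : x.1 = p.1
    · rw [timeDeriv_coeff, hf, smul_zero, mul_zero]
      rw [← hx, map_add, map_add, h1]
      push_cast
      omega
    · rw [MvPowerSeries.coeff_monomial_ne h1, zero_mul]
  · exact map_zero _

/-- The commutator with `∂_i` differentiates the normally ordered symbol in `t_i`; dually,
`KOp_X_mul` differentiates it in the symbol of `∂_i`. -/
theorem pderiv_KOp (i : ℕ) : pderiv R i (KOp κ r f) = KOp κ r (pderiv R i f) +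
    KOp (fun p => (p.1 i + 1) * κ (p.1 + Finsupp.single i 1, p.2)) (r + (2 * i + 1)) f := by
  rw [← sub_eq_iff_eq_add']
  let G : (ℕ →₀ ℕ) × (ℕ →₀ ℕ) → TimeFn R := fun p => if (wt p.1 : ℤ) - wt p.2 = -r then
    κ p • (pderiv R i (monomial p.1 (1 : R)) * timeDeriv p.2 f) else 0
  have hG : HasSum G (pderiv R i (KOp κ r f) - KOp κ r (pderiv R i f)) := by
    refine (((kop_hasSum κ r f).map (pderiv R i) (continuous_pderiv i)).sub
      (kop_hasSum κ r (pderiv R i f))).congr_fun fun p => ?_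
    simp only [Function.comp_apply, kTerm, G]
    split_ifs with h
    · have hs : ∀ (z : ℂ) (g : TimeFn R), pderiv R i (z • g) = z • pderiv R i g := fun z g => by
        ext δ
        rw [MvPowerSeries.coeff_pderiv, coeff_csmul, coeff_csmul, MvPowerSeries.coeff_pderiv,
          smul_mul_assoc]
      rw [hs, ← smul_sub, Derivation.leibniz, timeDeriv_pderiv, smul_eq_mul, smul_eq_mul,
        add_sub_cancel_left, mul_comm]
    · rw [map_zero, sub_zero]
  have hinj : Function.Injective fun p : (ℕ →₀ ℕ) × (ℕ →₀ ℕ) =>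
      (p.1 + Finsupp.single i 1, p.2) := by
    rintro ⟨a, b⟩ ⟨c, d⟩ h
    simpa using h
  rw [← hinj.hasSum_iff] at hG
  · refine hG.unique ((kop_hasSum _ _ f).congr_fun fun p => ?_)
    simp only [Function.comp_apply, G, kTerm, wt_add_single]
    by_cases h : ((wt p.1 : ℕ) : ℤ) - (wt p.2 : ℕ) = -(r + (2 * i + 1))
    · rw [if_pos h, if_pos (by push_cast; omega), pderiv_monomial_add, smul_mul_assoc,
        ← Nat.cast_smul_eq_nsmul ℂ, smul_smul, mul_comm]
      push_cast; rfl
    · rw [if_neg h, if_neg (by push_cast; omega)]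
  · rintro ⟨γ, β⟩ hp
    have h : γ i = 0 := by
      by_contra h
      obtain ⟨δ, rfl⟩ := eq_add_single h
      exact hp ⟨(δ, β), rfl⟩
    simp only [G, pderiv_monomial_of_eq_zero h, zero_mul, smul_zero, ite_self]

theorem KOp_X_mul (i : ℕ) : KOp κ r ((X i : TimeFn R) * f) = (X i : TimeFn R) * KOp κ r f +
    KOp (fun p => (p.2 i + 1) * κ (p.1, p.2 + Finsupp.single i 1)) (r - (2 * i + 1)) f := by
  rw [← sub_eq_iff_eq_add']
  let G : (ℕ →₀ ℕ) × (ℕ →₀ ℕ) → TimeFn R := fun p => if (wt p.1 : ℤ) - wt p.2 = -r then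
    κ p • (monomial p.1 (1 : R) * p.2 i • timeDeriv (p.2 - Finsupp.single i 1) f) else 0
  have hG : HasSum G (KOp κ r (X i * f) - X i * KOp κ r f) := by
    have h1 : HasSum (fun p => (X i : TimeFn R) * kTerm κ r f p) (X i * KOp κ r f) :=
      (kop_hasSum κ r f).mul_left (X i)
    have h2 : HasSum (fun p => kTerm κ r (X i * f) p - X i * kTerm κ r f p)
        (KOp κ r (X i * f) - X i * KOp κ r f) := by
      have h0 := kop_hasSum κ r ((X i : TimeFn R) * f)
      have h3 := h0.sub h1
      exact h3
    refine h2.congr_fun fun p => ?_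
    clear h1 h2
    simp only [kTerm, G]
    split_ifs with h
    · have h2 : (X i : TimeFn R) * κ p • (monomial p.1 1 * timeDeriv p.2 f) =
          κ p • (X i * (monomial p.1 1 * timeDeriv p.2 f)) := Algebra.mul_smul_comm _ _ _
      rw [timeDeriv_X_mul, h2, ← smul_sub, mul_add, mul_left_comm, add_sub_cancel_left]
    · rw [mul_zero, sub_zero]
  have hinj : Function.Injective fun p : (ℕ →₀ ℕ) × (ℕ →₀ ℕ) =>
      (p.1, p.2 + Finsupp.single i 1) := by
    rintro ⟨a, b⟩ ⟨c, d⟩ h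
    simpa using h
  rw [← hinj.hasSum_iff] at hG
  · refine hG.unique ((kop_hasSum _ _ f).congr_fun fun p => ?_)
    simp only [Function.comp_apply, G, kTerm, wt_add_single]
    by_cases h : ((wt p.1 : ℕ) : ℤ) - (wt p.2 : ℕ) = -(r - (2 * i + 1))
    · rw [if_pos h, if_pos (by push_cast; omega), add_tsub_cancel_right, Finsupp.add_apply,
        Finsupp.single_eq_same, mul_smul_comm, ← Nat.cast_smul_eq_nsmul ℂ, smul_smul, mul_comm]
      push_cast; rfl
    · rw [if_neg h, if_neg (by push_cast; omega)]
  · rintro ⟨γ, β⟩ hp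
    have h : β i = 0 := by
      by_contra h
      obtain ⟨δ, rfl⟩ := eq_add_single h
      exact hp ⟨(γ, δ), rfl⟩
    simp only [G, h, zero_smul, mul_zero, smul_zero, ite_self]

end KernelOperators

/-! ### The shift by `-2[z⁻¹]` and the modes of `V(z)`. -/

section Shift

variable {R : Type} [CommRing R] [Algebra ℂ R]

/-- The coefficients of `f(t - 2[z⁻¹])`. -/
def shiftKer (p : (ℕ →₀ ℕ) × (ℕ →₀ ℕ)) : ℂ :=
  if p.1 = 0 then p.2.prod fun i b => (-2 / (2 * i + 1) : ℂ) ^ b / (b.factorial : ℂ) else 0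

/-- The coefficient of `z^{-n}` in `f(t - 2[z⁻¹])`, for an integer `n`. -/
def shiftOp (n : ℤ) (f : TimeFn R) : TimeFn R := KOp shiftKer n f

theorem shiftOp_hasSum (n : ℤ) (f : TimeFn R) :
    HasSum (fun β : ℕ →₀ ℕ => if (wt β : ℤ) = n then
      (β.prod fun i b => (-2 / (2 * i + 1) : ℂ) ^ b / (b.factorial : ℂ)) • timeDeriv β f else 0)
      (shiftOp n f) := by
  have h := kop_hasSum shiftKer n f
  rw [← Function.Injective.hasSum_iff (Prod.mk_right_injective (0 : ℕ →₀ ℕ))] at h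
  · refine h.congr_fun fun β => ?_
    simp only [Function.comp_apply, kTerm, shiftKer, map_zero, if_true]
    by_cases h1 : (wt β : ℤ) = n
    · rw [if_pos h1, if_pos (by push_cast; omega), MvPowerSeries.monomial_zero_one, one_mul]
    · rw [if_neg h1, if_neg (by push_cast; omega)]
  · rintro ⟨γ, β⟩ hp
    have : γ ≠ 0 := by rintro rfl; exact hp ⟨β, rfl⟩
    simp only [kTerm, shiftKer, if_neg this, zero_smul, ite_self]

theorem shiftCoeff_eq (f : TimeFn R) (n : ℕ) : shiftCoeff f n = shiftOp n f := by
  ext α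
  rw [(timeFn_hasSum_coeff (shiftOp_hasSum n f) α).2]
  refine finsum_congr fun β => ?_
  rw [weight_eq_wt]
  by_cases h : wt β = n
  · rw [if_pos h, if_pos (by rw [h])]; rfl
  · rw [if_neg h, if_neg (by exact_mod_cast h), map_zero]

theorem shiftOp_neg {n : ℤ} (hn : n < 0) (f : TimeFn R) : shiftOp n f = 0 := by
  refine (shiftOp_hasSum n f).unique (hasSum_zero.congr_fun fun β => if_neg (by omega))

theorem pderiv_shiftOp (i : ℕ) (n : ℤ) (f : TimeFn R) :
    pderiv R i (shiftOp n f) = shiftOp n (pderiv R i f) := by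
  rw [shiftOp, shiftOp, pderiv_KOp, add_eq_left]
  refine (kop_hasSum _ _ f).unique (hasSum_zero.congr_fun fun p => ?_)
  have : p.1 + Finsupp.single i 1 ≠ 0 := fun h => by simpa using DFunLike.congr_fun h i
  simp only [kTerm, shiftKer, if_neg this, mul_zero, zero_smul, ite_self]

theorem shiftOp_X_mul (i : ℕ) (n : ℤ) (f : TimeFn R) : shiftOp n (X i * f) =
    X i * shiftOp n f + (-2 / (2 * i + 1) : ℂ) • shiftOp (n - (2 * i + 1)) f := by
  rw [shiftOp, KOp_X_mul, shiftOp, shiftOp, ← KOp_kernel_smul]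
  congr 2
  funext p
  simp only [shiftKer, Pi.smul_apply]
  split_ifs
  · have := prod_add_single (F := fun i b => (-2 / (2 * i + 1) : ℂ) ^ b / (b.factorial : ℂ))
      (by simp) p.2 i (a := (p.2 i + 1 : ℂ)) (b := (-2 / (2 * i + 1) : ℂ)) (by
        rw [Nat.factorial_succ, pow_succ]
        have h1 : ((p.2 i : ℂ) + 1) ≠ 0 := Nat.cast_add_one_ne_zero (p.2 i)
        push_cast
        field_simp)
    rw [mul_comm, this, smul_eq_mul, mul_comm]
  · rw [mul_zero, smul_zero]

theorem timeDeriv_one {β : ℕ →₀ ℕ} (hβ : β ≠ 0) : timeDeriv β (1 : TimeFn R) = 0 := by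
  ext δ
  classical
  rw [timeDeriv_coeff, MvPowerSeries.coeff_one, if_neg, smul_zero, map_zero]
  exact fun h => hβ (add_eq_zero.1 h).2

theorem shiftOp_one (n : ℤ) : shiftOp n (1 : TimeFn R) = if n = 0 then 1 else 0 := by
  refine (shiftOp_hasSum n 1).unique ?_
  convert! hasSum_single (f := fun β : ℕ →₀ ℕ => if (wt β : ℤ) = n then
      (β.prod fun i b => (-2 / (2 * i + 1) : ℂ) ^ b / (b.factorial : ℂ)) •
        timeDeriv β (1 : TimeFn R) else 0) 0 ?_ using 1
  · simp [timeDeriv_zero, eq_comm]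
  · intro β hβ
    rw [timeDeriv_one hβ, smul_zero, ite_self]

/-- The coefficients of `f(t - 2[z⁻¹])` as an operator `∑_j f_j ∂^j`. -/
def Op.sh (f : TimeFn R) : Op R := ⟨fun j => shiftOp (-j) f, 0,
  Adm.of_order_le fun _ hj => shiftOp_neg (by omega) f⟩

theorem Op.ordLE_sh (f : TimeFn R) : Op.OrdLE 0 (Op.sh f) := fun _ hj => shiftOp_neg (by omega) f

theorem homog_mode_sh (j : ℤ) : Homog (-j) fun f : TimeFn R => mode (Op.sh f).1 j := by
  intro f α hf
  obtain ⟨c, hc⟩ := (Op.sh f).exists_adm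
  change coeff α (mode (Op.sh f).1 j) = 0
  rw [(timeFn_hasSum_coeff (mode_hasSum hc j) α).2]
  refine finsum_eq_zero_of_forall_eq_zero fun m => ?_
  rw [MvPowerSeries.coeff_mul, Finset.sum_eq_zero]
  intro x hx
  have hx := mem_antidiagonal.1 hx
  rw [coeff_schur]
  split_ifs with h
  · rw [show coeff x.2 ((Op.sh f).1 m) = 0 from homog_KOp shiftKer (-m) f x.2 fun δ hδ => hf δ ?_,
      mul_zero]
    rw [hδ, ← hx, map_add]
    push_cast
    omega
  · rw [zero_mul]

/-- The modes of `V(z) f = f(t - 2[z⁻¹]) e^ξ`. -/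
def V (j : ℤ) : TimeFn R →ₗ[R] TimeFn R where
  toFun f := mode (Op.sh f).1 j
  map_add' f g := by
    obtain ⟨c, hc⟩ := (Op.sh f).exists_adm
    obtain ⟨d, hd⟩ := (Op.sh g).exists_adm
    rw [← mode_add hc hd]
    exact congrArg (mode · j) (funext fun k => KOp_add shiftKer (-k) f g)
  map_smul' a f := by
    obtain ⟨c, hc⟩ := (Op.sh f).exists_adm
    rw [RingHom.id_apply, MvPowerSeries.smul_eq_C_mul (mode _ j), ← mode_congr_mul _ hc]
    refine congrArg (mode · j) (funext fun k => ?_)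
    rw [← MvPowerSeries.smul_eq_C_mul]
    exact KOp_smul shiftKer (-k) f a

theorem V_apply (j : ℤ) (f : TimeFn R) : V j f = mode (Op.sh f).1 j := rfl

theorem continuous_V (j : ℤ) : Continuous (V j : TimeFn R →ₗ[R] TimeFn R) :=
  Homog.continuous (homog_mode_sh j)

theorem continuous_KOp (κ : (ℕ →₀ ℕ) × (ℕ →₀ ℕ) → ℂ) (r : ℤ) :
    Continuous (KOpL κ r : TimeFn R →ₗ[R] TimeFn R) :=
  Homog.continuous (homog_KOp κ r)

theorem pderiv_V (i : ℕ) (j : ℤ) (f : TimeFn R) :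
    pderiv R i (V j f) = V j (pderiv R i f) + V (j - (2 * i + 1)) f := by
  obtain ⟨c, hc⟩ := (Op.sh f).exists_adm
  obtain ⟨d, hd⟩ := (Op.sh (pderiv R i f)).exists_adm
  rw [← sub_eq_iff_eq_add]
  refine (mode_pderiv hc i j).unique ((mode_hasSum hd j).congr_fun fun m => ?_)
  exact congrArg _ (pderiv_shiftOp i (-m) f)

/-- The shift moves `t_{2i+1}` by `-2 z^{-(2i+1)}/(2i+1)`, and lowering the power of `z` reads a
higher mode of `f`. -/
theorem V_X_mul (i : ℕ) (j : ℤ) (f : TimeFn R) :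
    V j (X i * f) = X i * V j f + (-2 / (2 * i + 1) : ℂ) • V (j + (2 * i + 1)) f := by
  obtain ⟨c, hc⟩ := (Op.sh f).exists_adm
  obtain ⟨d, hd⟩ := (Op.sh (X i * f)).exists_adm
  have h1 := (mode_hasSum hc j).mul_left (X i)
  have h2 : HasSum (fun m : ℤ => schur R (j + (2 * i + 1) - m) * (Op.sh f).1 m)
    (V (j + (2 * i + 1)) f) := mode_hasSum hc _
  have h3 := ((Equiv.addRight (2 * i + 1 : ℤ)).hasSum_iff).2 h2
  have h4 := h3.map (DistribSMul.toAddMonoidHom (TimeFn R) (-2 / (2 * i + 1) : ℂ))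
    (continuous_csmul _)
  refine (mode_hasSum hd j).unique ((h1.add h4).congr_fun fun m => ?_)
  have h5 : (Op.sh (X i * f)).1 m = _ := shiftOp_X_mul i (-m) f
  rw [h5, mul_add, mul_left_comm]
  congr 1
  simp only [Function.comp_apply, Equiv.coe_addRight, DistribSMul.toAddMonoidHom_apply]
  rw [mul_smul_comm, add_sub_add_right_eq_sub]
  congr 2
  change _ = shiftOp _ f
  congr 1; ring

theorem V_one (j : ℤ) : V j (1 : TimeFn R) = schur R j := by
  obtain ⟨c, hc⟩ := (Op.sh (1 : TimeFn R)).exists_adm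
  refine (mode_hasSum hc j).unique ?_
  convert! hasSum_single (f := fun m : ℤ => schur R (j - m) * (Op.sh (1 : TimeFn R)).1 m) 0 ?_
    using 1
  · change _ = _ * shiftOp (-0) 1
    rw [shiftOp_one, if_pos (by simp), mul_one, sub_zero]
  · intro m hm
    change _ * shiftOp (-m) 1 = 0
    rw [shiftOp_one, if_neg (by simpa using hm), mul_zero]

theorem coeff_zero_V (j : ℤ) (f : TimeFn R) : coeff 0 (V j f) = coeff 0 (shiftOp (-j) f) := by
  obtain ⟨c, hc⟩ := (Op.sh f).exists_adm
  rw [V_apply, (timeFn_hasSum_coeff (mode_hasSum hc j) 0).2, finsum_eq_single _ j]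
  · rw [sub_self, MvPowerSeries.coeff_zero_eq_constantCoeff_apply, map_mul, constantCoeff_schur,
      if_pos rfl, one_mul]
    rfl
  · intro m hm
    rw [MvPowerSeries.coeff_zero_eq_constantCoeff_apply, map_mul, constantCoeff_schur,
      if_neg (by omega), zero_mul]

end Shift

/-! ### Exponentials of odd series and a rational generating function. -/

section Euler

variable {A : Type*} [CommRing A] [Algebra ℂ A] (c : ℕ → A)

/-- The multi-indices of weight `n`. -/
def wtSet (n : ℕ) : Finset (ℕ →₀ ℕ) := 
  ((finite_wt_le n).subset (t := {β | wt β = n}) fun _ h => le_of_eq h).toFinset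

theorem mem_wtSet {n : ℕ} {β : ℕ →₀ ℕ} : β ∈ wtSet n ↔ wt β = n := by
  rw [wtSet, Set.Finite.mem_toFinset]; rfl

/-- `∏ᵢ cᵢ^{βᵢ}/βᵢ!`. -/
def expTerm (β : ℕ →₀ ℕ) : A := β.prod fun i b => ((b.factorial : ℂ)⁻¹) • c i ^ b

theorem expTerm_add_single (β : ℕ →₀ ℕ) (i : ℕ) :
    (β i + 1 : ℕ) • expTerm c (β + Finsupp.single i 1) = c i * expTerm c β := by
  have h := prod_add_single (F := fun i b => ((b.factorial : ℂ)⁻¹) • c i ^ b) (by simp) β i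
    (a := ((β i + 1 : ℕ) : A)) (b := c i) (by
      rw [smul_mul_assoc, smul_mul_assoc, ← pow_succ, mul_comm, ← nsmul_eq_mul,
        ← Nat.cast_smul_eq_nsmul ℂ, smul_smul, Nat.factorial_succ]
      congr 1
      have h1 : ((β i : ℂ) + 1) ≠ 0 := Nat.cast_add_one_ne_zero (β i)
      have h2 : ((β i).factorial : ℂ) ≠ 0 := Nat.cast_ne_zero.2 (Nat.factorial_ne_zero _)
      push_cast
      field_simp)
  rw [nsmul_eq_mul, mul_comm, expTerm, h, mul_comm, expTerm]

/-- The coefficient of `y^n` in `exp(∑ᵢ cᵢ y^{2i+1})`. -/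
def expCoeff (n : ℕ) : A := ∑ β ∈ wtSet n, expTerm c β

theorem expCoeff_zero : expCoeff c 0 = 1 := by
  rw [expCoeff, Finset.sum_eq_single 0]
  · simp [expTerm]
  · intro β hβ h
    obtain ⟨i, hi⟩ := Finsupp.ne_iff.1 h
    obtain ⟨δ, rfl⟩ := eq_add_single hi
    rw [mem_wtSet, wt_add_single] at hβ
    omega
  · intro h
    exact absurd (mem_wtSet.2 (map_zero _)) h

theorem sum_wtSet_smul_expTerm (n i : ℕ) : ∑ β ∈ wtSet n, β i • expTerm c β =
    if 2 * i + 1 ≤ n then c i * expCoeff c (n - (2 * i + 1)) else 0 := by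
  classical
  split_ifs with h
  · rw [expCoeff, Finset.mul_sum]
    have hinj : Function.Injective fun β : ℕ →₀ ℕ => β + Finsupp.single i 1 :=
      add_left_injective _
    have hsub : (wtSet (n - (2 * i + 1))).map ⟨_, hinj⟩ ⊆ wtSet n := by
      intro β hβ
      obtain ⟨δ, hδ, rfl⟩ := Finset.mem_map.1 hβ
      rw [mem_wtSet] at hδ ⊢
      change wt (δ + _) = n
      rw [wt_add_single, hδ]; omega
    rw [← Finset.sum_subset hsub, Finset.sum_map]
    · refine Finset.sum_congr rfl fun β _ => ?_
      rw [← expTerm_add_single]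
      simp
    · intro β hβ hβ'
      by_cases h0 : β i = 0
      · rw [h0, zero_smul]
      · obtain ⟨δ, rfl⟩ := eq_add_single h0
        rw [mem_wtSet, wt_add_single] at hβ
        exact absurd (Finset.mem_map.2 ⟨δ, mem_wtSet.2 (by omega), rfl⟩) hβ'
  · refine Finset.sum_eq_zero fun β hβ => ?_
    rw [mem_wtSet] at hβ
    by_cases h0 : β i = 0
    · rw [h0, zero_smul]
    · obtain ⟨δ, rfl⟩ := eq_add_single h0
      rw [wt_add_single] at hβ
      omega

/-- The recursion is the logarithmic derivative of `exp(∑ cᵢ y^{2i+1})`. The bound on `n` ensures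
that the range contains every `i` with `2i+1 ≤ n`. -/
theorem nsmul_expCoeff {n q : ℕ} (hq : n ≤ 2 * q) : n • expCoeff c n =
    ∑ i ∈ Finset.range q, if 2 * i + 1 ≤ n then (2 * i + 1) • (c i * expCoeff c (n - (2 * i + 1))) else 0 := by
  have h1 : ∀ β ∈ wtSet n, n • expTerm c β = ∑ i ∈ Finset.range q, (2 * i + 1) • β i • expTerm c β := by
    intro β hβ
    rw [mem_wtSet] at hβ
    have h2 : wt β = ∑ i ∈ Finset.range q, (2 * i + 1) * β i := by
      rw [← weight_eq_wt, weight, Finsupp.sum_of_support_subset _ _ _ (by simp)]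
      intro i hi
      obtain ⟨δ, rfl⟩ := eq_add_single (Finsupp.mem_support_iff.1 hi)
      rw [wt_add_single] at hβ
      rw [Finset.mem_range]; omega
    rw [← hβ, h2, Finset.sum_smul]
    exact Finset.sum_congr rfl fun i _ => mul_smul _ _ _
  rw [expCoeff, Finset.smul_sum, Finset.sum_congr rfl h1, Finset.sum_comm]
  refine Finset.sum_congr rfl fun i _ => ?_
  rw [← Finset.smul_sum, sum_wtSet_smul_expTerm]
  split_ifs
  · rfl
  · rw [smul_zero]

variable (v : A)

theorem sum_odd_even (q : ℕ) : (v - 1) * ∑ i ∈ Finset.range q, (v ^ (2 * i + 1) + v ^ (2 * (i + 1))) =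
    v ^ (2 * q + 1) - v := by
  induction q with
  | zero => simp
  | succ q ih => rw [Finset.sum_range_succ, mul_add, ih]; ring

/-- `exp(-2 ∑ᵢ (v^{2i+1} - 1) y^{2i+1}/(2i+1)) = (1 - vy)(1 + y)/((1 + vy)(1 - y))`. -/
theorem expCoeff_odd_log (n : ℕ) (hn : n ≠ 0) :
    (1 + v) * expCoeff (fun i => (-2 / (2 * i + 1) : ℂ) • (v ^ (2 * i + 1) - 1)) n =
      2 * (v - 1) * ((-v) ^ n - 1) := by
  induction n using Nat.strong_induction_on with
  | _ n ih =>
    set H := expCoeff fun i => (-2 / (2 * i + 1) : ℂ) • (v ^ (2 * i + 1) - 1) with hH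
    have hc : ∀ (i : ℕ) (y : A), (2 * i + 1) • ((-2 / (2 * i + 1) : ℂ) • (v ^ (2 * i + 1) - 1) * y) =
        -2 * (v ^ (2 * i + 1) - 1) * y := by
      intro i y
      have h1 : ((2 * i + 1 : ℕ) : ℂ) ≠ 0 := Nat.cast_ne_zero.2 (by omega)
      rw [← Nat.cast_smul_eq_nsmul ℂ, smul_mul_assoc, smul_smul]
      have h2 : ((2 * i + 1 : ℕ) : ℂ) * (-2 / (2 * i + 1)) = -2 := by
        push_cast at h1 ⊢; field_simp
      rw [h2, mul_assoc, Algebra.smul_def, map_neg, map_ofNat]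
    have hfree : ∀ x y : A, n • x = n • y → x = y := by
      intro x y h
      rw [← Nat.cast_smul_eq_nsmul ℂ, ← Nat.cast_smul_eq_nsmul ℂ n y] at h
      have h1 : (n : ℂ) ≠ 0 := Nat.cast_ne_zero.2 hn
      have h2 := congrArg (fun z => (n : ℂ)⁻¹ • z) h
      simpa only [smul_smul, inv_mul_cancel₀ h1, one_smul] using h2
    apply hfree
    rw [← mul_smul_comm]
    -- For even `n` the recursion meets only odd positive indices, and the non-constant terms cancel
    -- under `i ↦ q - 1 - i`. For odd `n` it also reaches index `0`, where the closed formula is not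
    -- valid and the value `1` is inserted separately.
    obtain ⟨q, rfl | rfl⟩ := Nat.even_or_odd' n
    · rw [nsmul_expCoeff _ le_rfl, Finset.mul_sum]
      have h1 : ∀ i ∈ Finset.range q, (1 + v) * (if 2 * i + 1 ≤ 2 * q then
          (2 * i + 1) • ((-2 / (2 * i + 1) : ℂ) • (v ^ (2 * i + 1) - 1) * H (2 * q - (2 * i + 1)))
            else 0) =
          4 * (v - 1) * (v ^ (2 * q) - 1) + 4 * (v - 1) * (v ^ (2 * i + 1) -
            v ^ (2 * (q - 1 - i) + 1)) := by
        intro i hi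
        rw [Finset.mem_range] at hi
        obtain ⟨d, rfl⟩ := Nat.exists_eq_add_of_lt hi
        rw [if_pos (by omega), hc, mul_left_comm, ih _ (by omega) (by omega),
          show 2 * (i + d + 1) - (2 * i + 1) = 2 * d + 1 by omega,
          show i + d + 1 - 1 - i = d by omega, Odd.neg_pow ⟨d, rfl⟩]
        ring
      rw [Finset.sum_congr rfl h1, Finset.sum_add_distrib, Finset.sum_const, Finset.card_range, ← Finset.mul_sum,
        Finset.sum_sub_distrib,
        Finset.sum_range_reflect (fun i => v ^ (2 * i + 1)), sub_self, mul_zero, add_zero,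
        Even.neg_pow (even_two_mul q), nsmul_eq_mul,
        nsmul_eq_mul]
      push_cast; ring
    · rw [nsmul_expCoeff (q := q + 1) _ (by omega), Finset.sum_range_succ, mul_add, Finset.mul_sum]
      have h1 : ∀ i ∈ Finset.range q, (1 + v) * (if 2 * i + 1 ≤ 2 * q + 1 then
          (2 * i + 1) • ((-2 / (2 * i + 1) : ℂ) • (v ^ (2 * i + 1) - 1) *
            H (2 * q + 1 - (2 * i + 1))) else 0) =
          -4 * (v - 1) * (v ^ (2 * q + 1) + 1) + 4 * (v - 1) * (v ^ (2 * i + 1) +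
            v ^ (2 * (q - 1 - i + 1))) := by
        intro i hi
        rw [Finset.mem_range] at hi
        obtain ⟨d, rfl⟩ := Nat.exists_eq_add_of_lt hi
        rw [if_pos (by omega), hc, mul_left_comm, ih _ (by omega) (by omega),
          show 2 * (i + d + 1) + 1 - (2 * i + 1) = 2 * (d + 1) by omega,
          show i + d + 1 - 1 - i = d by omega, Even.neg_pow (even_two_mul _)]
        ring
      have h2 := sum_odd_even v q
      rw [Finset.sum_add_distrib, ← Finset.sum_range_reflect (fun i => v ^ (2 * (i + 1)))] at h2
      rw [Finset.sum_congr rfl h1, Finset.sum_add_distrib, Finset.sum_const, Finset.card_range, ← Finset.mul_sum,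
        Finset.sum_add_distrib, if_pos le_rfl, hc, Nat.sub_self, expCoeff_zero,
        Odd.neg_pow ⟨q, rfl⟩, nsmul_eq_mul, nsmul_eq_mul,
        mul_assoc 4, h2]
      push_cast; ring

end Euler

/-! ### The vertex operator as an operator-valued series in `u = μ/λ - 1`. -/

section Vertex

/-- `(1 + u)^k`. -/
def pw (k : ℤ) : PowerSeries ℂ := PowerSeries.binomialSeries ℂ k

theorem coeff_pw (k : ℤ) (m : ℕ) : PowerSeries.coeff m (pw k) = Ring.choose k m := by
  rw [pw, PowerSeries.binomialSeries_coeff, zsmul_one]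

theorem pw_add (a b : ℤ) : pw (a + b) = pw a * pw b := PowerSeries.binomialSeries_add a b

theorem pw_zero : pw 0 = 1 := PowerSeries.binomialSeries_zero

theorem pw_natCast (n : ℕ) : pw n = (1 + PowerSeries.X) ^ n := PowerSeries.binomialSeries_nat n

theorem pw_one : pw 1 = 1 + PowerSeries.X := by simpa using pw_natCast 1

theorem one_add_X_inv : (1 + PowerSeries.X : PowerSeries ℂ)⁻¹ = pw (-1) := by
  rw [PowerSeries.inv_eq_iff_mul_eq_one (by simp), ← pw_one, ← pw_add, neg_add_cancel, pw_zero]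

theorem pw_pow (k : ℤ) (n : ℕ) : pw k ^ n = pw (n * k) := by
  induction n with
  | zero => rw [pow_zero, Nat.cast_zero, zero_mul, pw_zero]
  | succ n ih => rw [pow_succ, ih, ← pw_add]; congr 1; push_cast; ring

theorem pw_neg_natCast (n : ℕ) : pw (-n) = (pw (-1)) ^ n := by
  rw [pw_pow]; congr 1; ring

theorem vertexSeries_eq (γ β : ℕ →₀ ℕ) : vertexSeries γ β =
    expTerm (fun i => pw (2 * i + 1) - 1) γ *
      expTerm (fun i => (-2 / (2 * i + 1) : ℂ) • (pw (-(2 * i + 1)) - 1)) β := by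
  rw [vertexSeries, expTerm, expTerm]
  congr 1
  · refine Finset.prod_congr rfl fun i _ => ?_
    have := pw_natCast (2 * i + 1)
    push_cast at this
    simp only [this]
  · refine Finset.prod_congr rfl fun i _ => ?_
    have := pw_neg_natCast (2 * i + 1)
    push_cast at this
    simp only [one_add_X_inv, ← this, smul_pow, smul_smul]
    congr 1
    rw [div_eq_inv_mul]

theorem vertexSeries_add_single_left (γ β : ℕ →₀ ℕ) (i : ℕ) :
    (γ i + 1 : ℕ) • vertexSeries (γ + Finsupp.single i 1) β =
      (pw (2 * i + 1) - 1) * vertexSeries γ β := by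
  rw [vertexSeries_eq, vertexSeries_eq, ← smul_mul_assoc, expTerm_add_single, mul_assoc]

theorem vertexSeries_add_single_right (γ β : ℕ →₀ ℕ) (i : ℕ) :
    (β i + 1 : ℕ) • vertexSeries γ (β + Finsupp.single i 1) =
      ((-2 / (2 * i + 1) : ℂ) • (pw (-(2 * i + 1)) - 1)) * vertexSeries γ β := by
  rw [vertexSeries_eq, vertexSeries_eq, ← mul_smul_comm, expTerm_add_single, mul_left_comm]

variable {R : Type} [CommRing R] [Algebra ℂ R]

/-- The kernel of the coefficient of `u^m` in `X(λ, λ(1+u))`. -/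
def vertexKer (m : ℕ) (p : (ℕ →₀ ℕ) × (ℕ →₀ ℕ)) : ℂ :=
  PowerSeries.coeff m (vertexSeries p.1 p.2)

/-- Formal power series in `u` whose coefficients are operators. -/
abbrev EndSeries (R : Type) [CommRing R] : Type := PowerSeries (Module.End R (TimeFn R))

variable (R) in
/-- Scalar series as series of operators. -/
def sc : PowerSeries ℂ →+* EndSeries R :=
  PowerSeries.map (algebraMap ℂ (Module.End R (TimeFn R)))

theorem coeff_sc_mul (c : PowerSeries ℂ) (F : EndSeries R) (m : ℕ) (f : TimeFn R) :
    PowerSeries.coeff m (sc R c * F) f =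
      ∑ x ∈ antidiagonal m, PowerSeries.coeff x.1 c • PowerSeries.coeff x.2 F f := by
  rw [PowerSeries.coeff_mul, LinearMap.sum_apply]
  refine Finset.sum_congr rfl fun x _ => ?_
  rw [sc, PowerSeries.coeff_map, Module.End.mul_apply, Module.algebraMap_end_apply]

theorem sc_mul_comm (c : PowerSeries ℂ) (F : EndSeries R) : F * sc R c = sc R c * F := by
  ext m : 1
  rw [PowerSeries.coeff_mul, PowerSeries.coeff_mul, ← Finset.Nat.sum_antidiagonal_swap]
  refine Finset.sum_congr rfl fun x _ => ?_
  rw [sc, PowerSeries.coeff_map, PowerSeries.coeff_map]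
  exact (Algebra.commutes _ _).symm

/-- A constant series of operators. -/
def cs (T : Module.End R (TimeFn R)) : EndSeries R := PowerSeries.C T

variable (R) in
/-- The coefficient of `λ^{-r}` in `X(λ, λ(1+u))`. -/
def vertexOp (r : ℤ) : EndSeries R := PowerSeries.mk fun m => KOpL (vertexKer m) r

variable (R) in
/-- `∂/∂t_{2i+1}` as a linear map. -/
def pdL (i : ℕ) : Module.End R (TimeFn R) := (pderiv R i : TimeFn R →ₗ[R] TimeFn R)

variable (R) in
/-- Multiplication by `t_{2i+1}`. -/
def tL (i : ℕ) : Module.End R (TimeFn R) := LinearMap.mulLeft R (X i)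

theorem coeff_sc_mul_vertexOp (c : PowerSeries ℂ) (r : ℤ) (m : ℕ) (f : TimeFn R) :
    PowerSeries.coeff m (sc R c * vertexOp R r) f =
      KOp (fun p => PowerSeries.coeff m (c * vertexSeries p.1 p.2)) r f := by
  rw [coeff_sc_mul]
  have : (fun p : (ℕ →₀ ℕ) × (ℕ →₀ ℕ) => PowerSeries.coeff m (c * vertexSeries p.1 p.2)) =
      ∑ x ∈ antidiagonal m, PowerSeries.coeff x.1 c • vertexKer x.2 := by
    funext p
    rw [PowerSeries.coeff_mul, Finset.sum_apply]; rfl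
  rw [this, KOp_kernel_sum]
  refine Finset.sum_congr rfl fun x _ => ?_
  rw [KOp_kernel_smul, vertexOp, PowerSeries.coeff_mk]; rfl

theorem pd_vertexOp (i : ℕ) (r : ℤ) : cs (pdL R i) * vertexOp R r = vertexOp R r * cs (pdL R i) +
    sc R (pw (2 * i + 1) - 1) * vertexOp R (r + (2 * i + 1)) := by
  ext m : 1
  refine LinearMap.ext fun f => ?_
  rw [cs, PowerSeries.coeff_C_mul, map_add, PowerSeries.coeff_mul_C, LinearMap.add_apply,
    coeff_sc_mul_vertexOp, vertexOp, PowerSeries.coeff_mk]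
  refine (pderiv_KOp (vertexKer m) r f i).trans ?_
  congr 2
  funext p
  rw [← vertexSeries_add_single_left, map_nsmul, vertexKer, nsmul_eq_mul]
  push_cast; rfl

theorem vertexOp_t (i : ℕ) (r : ℤ) : cs (tL R i) * vertexOp R r = vertexOp R r * cs (tL R i) -
    sc R ((-2 / (2 * i + 1) : ℂ) • (pw (-(2 * i + 1)) - 1)) * vertexOp R (r - (2 * i + 1)) := by
  rw [eq_sub_iff_add_eq, eq_comm]
  ext m : 1
  refine LinearMap.ext fun f => ?_
  rw [cs, PowerSeries.coeff_mul_C, map_add, PowerSeries.coeff_C_mul, LinearMap.add_apply,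
    coeff_sc_mul_vertexOp, vertexOp, PowerSeries.coeff_mk]
  refine (KOp_X_mul (vertexKer m) r f i).trans ?_
  congr 2
  funext p
  rw [← vertexSeries_add_single_right, map_nsmul, vertexKer, nsmul_eq_mul]
  push_cast; rfl

theorem pd_V (i : ℕ) (j : ℤ) : cs (pdL R i) * cs (V j) = cs (V j) * cs (pdL R i) +
    cs (V (j - (2 * i + 1))) := by
  simp only [cs, ← map_mul, ← map_add]
  exact congrArg _ (LinearMap.ext fun f => pderiv_V i j f)

theorem V_t (i : ℕ) (j : ℤ) : cs (tL R i) * cs (V j) = cs (V j) * cs (tL R i) -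
    sc R (PowerSeries.C (-2 / (2 * i + 1))) * cs (V (j + (2 * i + 1))) := by
  rw [eq_sub_iff_add_eq, eq_comm, sc, PowerSeries.map_C]
  simp only [cs, ← map_mul, ← map_add]
  exact congrArg _ (LinearMap.ext fun f => V_X_mul i j f)

/-- A family of series of operators closed under commutators with `∂_i` and `t_i` vanishes if its
vacuum expectation values do. -/
theorem endSeries_eq_zero {ι : Type*} (D : ι → EndSeries R)
    (hcont : ∀ a m, Continuous fun f => PowerSeries.coeff m (D a) f)
    (hpd : ∀ a i, ∃ c₁ c₂ b₁ b₂, cs (pdL R i) * D a =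
      D a * cs (pdL R i) + sc R c₁ * D b₁ + sc R c₂ * D b₂)
    (ht : ∀ a i, ∃ c₁ c₂ b₁ b₂, cs (tL R i) * D a =
      D a * cs (tL R i) + sc R c₁ * D b₁ + sc R c₂ * D b₂)
    (h0 : ∀ a m, coeff 0 (PowerSeries.coeff m (D a) 1) = 0) (a : ι) : D a = 0 := by
  have := isAddTorsionFree_of_complex R
  have hsc : ∀ (c : PowerSeries ℂ) (b : ι) (α γ : ℕ →₀ ℕ),
      (∀ m, coeff α (PowerSeries.coeff m (D b) (monomial γ 1)) = 0) →
      ∀ m, coeff α (PowerSeries.coeff m (sc R c * D b) (monomial γ 1)) = 0 := by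
    intro c b α γ h m
    rw [coeff_sc_mul, map_sum]
    exact Finset.sum_eq_zero fun x _ => by rw [coeff_csmul, h, smul_zero]
  -- Induction on the total weight of a matrix entry: commuting with `t_i` shortens the input
  -- monomial `γ`, commuting with `∂_i` shortens the output monomial `α`, and what remains is the
  -- vacuum value.
  have key : ∀ (n : ℕ) (α γ : ℕ →₀ ℕ), wt α + wt γ = n →
      ∀ a m, coeff α (PowerSeries.coeff m (D a) (monomial γ 1)) = 0 := by
    intro n
    induction n using Nat.strong_induction_on with
    | _ n ih =>
      intro α γ hn a m
      by_cases hα : α = 0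
      · by_cases hγ : γ = 0
        · rw [hα, hγ, MvPowerSeries.monomial_zero_one, h0]
        · obtain ⟨i, hi⟩ := Finsupp.ne_iff.1 hγ
          obtain ⟨δ, rfl⟩ := eq_add_single hi
          obtain ⟨c₁, c₂, b₁, b₂, h⟩ := ht a i
          have h1 := congrArg (fun F : EndSeries R => coeff α (PowerSeries.coeff m F (monomial δ 1))) h
          simp only [map_add, LinearMap.add_apply] at h1
          rw [wt_add_single] at hn
          rw [hsc c₁ b₁ α δ (fun m => ih _ (by omega) α δ rfl b₁ m),
            hsc c₂ b₂ α δ (fun m => ih _ (by omega) α δ rfl b₂ m), add_zero, add_zero, cs,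
            PowerSeries.coeff_C_mul, PowerSeries.coeff_mul_C] at h1
          -- The output is read at the exponent `0`, where a multiple of `t_i` has no coefficient.
          have h2 : coeff α (tL R i (PowerSeries.coeff m (D a) (monomial δ 1))) = 0 := by
            rw [hα]
            change coeff 0 ((X i : TimeFn R) * _) = 0
            rw [MvPowerSeries.coeff_zero_X_mul]
          have h3 : tL R i (monomial δ 1) = monomial (δ + Finsupp.single i 1) (1 : R) := by
            change (X i : TimeFn R) * _ = _
            rw [MvPowerSeries.X, MvPowerSeries.monomial_mul_monomial, one_mul, add_comm]
          rw [Module.End.mul_apply, Module.End.mul_apply, h2, h3] at h1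
          exact h1.symm
      · obtain ⟨i, hi⟩ := Finsupp.ne_iff.1 hα
        obtain ⟨δ, rfl⟩ := eq_add_single hi
        obtain ⟨c₁, c₂, b₁, b₂, h⟩ := hpd a i
        have h1 := congrArg (fun F : EndSeries R => coeff δ (PowerSeries.coeff m F (monomial γ 1))) h
        simp only [map_add, LinearMap.add_apply] at h1
        rw [wt_add_single] at hn
        rw [hsc c₁ b₁ δ γ (fun m => ih _ (by omega) δ γ rfl b₁ m),
          hsc c₂ b₂ δ γ (fun m => ih _ (by omega) δ γ rfl b₂ m), add_zero, add_zero, cs,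
          PowerSeries.coeff_C_mul, PowerSeries.coeff_mul_C, Module.End.mul_apply,
          Module.End.mul_apply] at h1
        have h2 : coeff δ (PowerSeries.coeff m (D a) (pdL R i (monomial γ 1))) = 0 := by
          change coeff δ (PowerSeries.coeff m (D a) (pderiv R i (monomial γ 1))) = 0
          by_cases hγ : γ i = 0
          · rw [pderiv_monomial_of_eq_zero hγ, map_zero, map_zero]
          · obtain ⟨ε, rfl⟩ := eq_add_single hγ
            rw [wt_add_single] at hn
            rw [pderiv_monomial_add, map_nsmul, map_nsmul, ih _ (by omega) δ ε rfl, smul_zero]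
        rw [h2] at h1
        change coeff δ (pderiv R i _) = 0 at h1
        rw [MvPowerSeries.coeff_pderiv, mul_comm, ← Nat.cast_succ, ← nsmul_eq_mul] at h1
        exact (smul_eq_zero.1 h1).resolve_left (Nat.succ_ne_zero _)
  ext m : 1
  refine LinearMap.ext fun f => ?_
  have h1 : HasSum (fun γ => monomial γ (coeff γ f)) f := timeFn_hasSum_monomials f
  have h2 := h1.map (PowerSeries.coeff m (D a)) (hcont a m)
  refine h2.unique (hasSum_zero.congr_fun fun γ => ?_)
  have h3 : (monomial γ (coeff γ f) : TimeFn R) = coeff γ f • monomial γ 1 := by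
    rw [← map_smul, smul_eq_mul, mul_one]
  rw [Function.comp_apply, h3, map_smul]
  have h4 : PowerSeries.coeff m (D a) (monomial γ 1) = 0 :=
    MvPowerSeries.ext fun α => by rw [key _ α γ rfl, map_zero]
  rw [h4, smul_zero]

end Vertex

/-! ### The commutator of `V(z)` with the vertex operator. -/

section Commutator

variable {R : Type} [CommRing R] [Algebra ℂ R]

theorem invFact_ne_zero (β : ℕ →₀ ℕ) : invFact β ≠ 0 :=
  Finset.prod_ne_zero_iff.2 fun _ _ => inv_ne_zero (Nat.cast_ne_zero.2 (Nat.factorial_ne_zero _))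

theorem coeff_zero_timeDeriv (β : ℕ →₀ ℕ) (f : TimeFn R) :
    coeff 0 (timeDeriv β f) = (invFact β)⁻¹ • coeff β f := by
  rw [timeDeriv_coeff, zero_add, ← Nat.cast_smul_eq_nsmul ℂ]
  congr 1
  rw [invFact, Finsupp.prod, Finsupp.prod, Nat.cast_prod, ← Finset.prod_inv_distrib]
  refine Finset.prod_congr rfl fun i _ => ?_
  rw [Finsupp.zero_apply, zero_add, Nat.descFactorial_self, inv_inv]

theorem coeff_zero_KOp (κ : (ℕ →₀ ℕ) × (ℕ →₀ ℕ) → ℂ) (n : ℤ) (f : TimeFn R) :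
    coeff 0 (KOp κ n f) = if 0 ≤ n then
      ∑ β ∈ wtSet n.toNat, (κ (0, β) * (invFact β)⁻¹) • coeff β f else 0 := by
  have hterm : ∀ γ β, coeff 0 (kTerm κ n f (γ, β)) = if γ = 0 ∧ (wt β : ℤ) = n then
      (κ (0, β) * (invFact β)⁻¹) • coeff β f else 0 := by
    intro γ β
    by_cases hγ : γ = 0
    · rw [kTerm, hγ]
      simp only [map_zero, Nat.cast_zero, zero_sub, neg_inj, true_and]
      split_ifs
      · rw [coeff_csmul, MvPowerSeries.monomial_zero_one, one_mul, coeff_zero_timeDeriv, smul_smul]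
      · exact map_zero _
    · rw [if_neg fun h => hγ h.1, kTerm]
      split_ifs
      · rw [coeff_csmul, MvPowerSeries.coeff_monomial_mul, if_neg, smul_zero]
        exact fun h => hγ (le_antisymm h zero_le)
      · exact map_zero _
  rw [(timeFn_hasSum_coeff (kop_hasSum κ n f) 0).2]
  split_ifs with hn
  · rw [finsum_eq_sum_of_support_subset _
      (s := (wtSet n.toNat).map ⟨Prod.mk 0, Prod.mk_right_injective _⟩), Finset.sum_map]
    · refine Finset.sum_congr rfl fun β hβ => ?_
      rw [mem_wtSet] at hβ
      exact (hterm 0 β).trans (if_pos ⟨rfl, by omega⟩)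
    · rintro ⟨γ, β⟩ h
      rw [Function.mem_support, hterm] at h
      split_ifs at h with h1
      · rw [Finset.mem_coe, Finset.mem_map]
        exact ⟨β, mem_wtSet.2 (by omega), Prod.ext h1.1.symm rfl⟩
      · exact absurd rfl h
  · refine finsum_eq_zero_of_forall_eq_zero fun ⟨γ, β⟩ => ?_
    rw [hterm, if_neg]
    omega

theorem coeff_KOp_one (κ : (ℕ →₀ ℕ) × (ℕ →₀ ℕ) → ℂ) (r : ℤ) (α : ℕ →₀ ℕ) :
    coeff α (KOp κ r (1 : TimeFn R)) = if (wt α : ℤ) = -r then algebraMap ℂ R (κ (α, 0)) else 0 := by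
  classical
  rw [(timeFn_hasSum_coeff (kop_hasSum κ r 1) α).2, finsum_eq_single _ (α, 0)]
  · simp only [kTerm, map_zero, Nat.cast_zero, sub_zero]
    split_ifs
    · rw [timeDeriv_zero, mul_one, coeff_csmul, MvPowerSeries.coeff_monomial_same,
        Algebra.algebraMap_eq_smul_one]
    · exact map_zero _
  · rintro ⟨γ, β⟩ h
    simp only [kTerm]
    split_ifs
    · by_cases hβ : β = 0
      · have hγ : α ≠ γ := by rintro rfl; exact h (by rw [hβ])
        rw [hβ, timeDeriv_zero, mul_one, coeff_csmul, MvPowerSeries.coeff_monomial_ne hγ, smul_zero]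
      · rw [timeDeriv_one hβ, mul_zero, smul_zero, map_zero]
    · exact map_zero _

/-- `expCoeff` at an integer. -/
def expCoeffInt {A : Type*} [CommRing A] [Algebra ℂ A] (c : ℕ → A) (n : ℤ) : A :=
  if 0 ≤ n then expCoeff c n.toNat else 0

/-- The exponents of the vacuum expectation values of `V X` and `X V`. -/
def logOdd (v : PowerSeries ℂ) (i : ℕ) : PowerSeries ℂ :=
  (-2 / (2 * i + 1) : ℂ) • (v ^ (2 * i + 1) - 1)

theorem pw_odd (i : ℕ) : pw (2 * i + 1) = pw 1 ^ (2 * i + 1) := by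
  rw [pw_pow]; congr 1; push_cast; ring

theorem pw_neg_odd (i : ℕ) : pw (-(2 * i + 1)) = pw (-1) ^ (2 * i + 1) := by
  rw [pw_pow]; congr 1; push_cast; ring

theorem expTerm_zero {A : Type*} [CommRing A] [Algebra ℂ A] (c : ℕ → A) : expTerm c 0 = 1 := by
  simp [expTerm]

/-- Here `X · 1` is an exponential linear in `t`, and the value at `t = 0` after the shift is `exp`
of an odd series in `y = λ/z` with `v = 1 + u`. -/
theorem vev_V_vertex (j r : ℤ) (m : ℕ) :
    coeff 0 (V j (KOp (vertexKer m) r (1 : TimeFn R))) =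
      algebraMap ℂ R (PowerSeries.coeff m (if j = r then expCoeffInt (logOdd (pw 1)) (-j) else 0)) := by
  rw [coeff_zero_V, shiftOp, coeff_zero_KOp, expCoeffInt]
  split_ifs with h1 h2 h2
  · rw [expCoeff, map_sum, map_sum]
    refine Finset.sum_congr rfl fun β hβ => ?_
    rw [mem_wtSet] at hβ
    have h3 : expTerm (logOdd (pw 1)) β =
        (shiftKer (0, β) * (invFact β)⁻¹) • expTerm (fun i => pw (2 * i + 1) - 1) β := by
      simp only [expTerm, shiftKer, invFact, Finsupp.prod, if_true, ← Finset.prod_inv_distrib,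
        ← Finset.prod_mul_distrib, ← Finset.prod_smul]
      refine Finset.prod_congr rfl fun i _ => ?_
      have h4 : ((β i).factorial : ℂ) ≠ 0 := Nat.cast_ne_zero.2 (Nat.factorial_ne_zero _)
      rw [logOdd, smul_pow, pw_odd, smul_smul, smul_smul]
      congr 1
      field_simp
    rw [coeff_KOp_one, if_pos (by omega), Algebra.smul_def, ← map_mul, h3, map_smul, smul_eq_mul,
      vertexKer, vertexSeries_eq, expTerm_zero, mul_one]
  · rw [map_zero, map_zero]
    refine Finset.sum_eq_zero fun β hβ => ?_
    rw [mem_wtSet] at hβ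
    rw [coeff_KOp_one, if_neg (by omega), smul_zero]
  · rw [map_zero, map_zero]
  · rw [map_zero, map_zero]

/-- Here `V(z) · 1 = e^ξ`, and the shift in `X` evaluates it at `t = 0` to `exp` of an odd series in
`y = z/λ` with `v = (1 + u)⁻¹`. -/
theorem vev_vertex_V (j r : ℤ) (m : ℕ) :
    coeff 0 (KOp (vertexKer m) r (V j (1 : TimeFn R))) =
      algebraMap ℂ R (PowerSeries.coeff m (if j = r then expCoeffInt (logOdd (pw (-1))) j else 0)) := by
  rw [V_one, coeff_zero_KOp, expCoeffInt]
  by_cases h2 : j = r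
  · subst h2
    rw [if_pos rfl]
    split_ifs with h1
    · rw [expCoeff, map_sum, map_sum]
      refine Finset.sum_congr rfl fun β hβ => ?_
      rw [mem_wtSet] at hβ
      rw [coeff_schur, if_pos (by omega), Algebra.smul_def, ← map_mul,
        inv_mul_cancel_right₀ (invFact_ne_zero β), vertexKer, vertexSeries_eq, expTerm_zero, one_mul]
      simp only [pw_neg_odd]
      rfl
    · rw [map_zero, map_zero]
  · rw [if_neg h2, map_zero, map_zero]
    split_ifs
    · refine Finset.sum_eq_zero fun β hβ => ?_
      rw [mem_wtSet] at hβ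
      rw [coeff_schur, if_neg (by omega), smul_zero]
    · rfl

theorem expCoeffInt_logOdd {v : PowerSeries ℂ} {n : ℤ} (hn : 0 < n) :
    (1 + v) * expCoeffInt (logOdd v) n = 2 * (v - 1) * ((n.negOnePow : ℤ) * v ^ n.toNat - 1) := by
  lift n to ℕ using hn.le
  have h := expCoeff_odd_log v n (by omega)
  rw [expCoeffInt, if_pos hn.le, Int.toNat_natCast]
  refine h.trans ?_
  rw [neg_pow, ← Int.cast_negOnePow_natCast]

/-- The function of `u` in the commutator of `V(z)` with the vertex operator. -/
def commCoeff (j r : ℤ) : PowerSeries ℂ := ((r.negOnePow : ℤ) : PowerSeries ℂ) * pw (-j) - pw (j - r)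

/-- Both vacuum values expand `(z - μ)(z + λ)/((z + μ)(z - λ))`, one at infinity and one at zero.
Their difference comes from the poles `z = -μ` and `z = λ`, which give the two terms of `commCoeff`;
the factor `1 + u/2 = (λ + μ)/(2λ)` clears the denominator of the residues. -/
theorem vev_commCoeff (j : ℤ) :
    (1 + PowerSeries.C (1 / 2) * PowerSeries.X) *
      (expCoeffInt (logOdd (pw 1)) (-j) - expCoeffInt (logOdd (pw (-1))) j) =
      PowerSeries.X * commCoeff j j := by
  have h2 : (2 : PowerSeries ℂ) * PowerSeries.C (1 / 2) = 1 := by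
    rw [← map_ofNat PowerSeries.C 2, ← map_mul]; norm_num
  have hX : PowerSeries.X = pw 1 - 1 := by rw [pw_one, add_sub_cancel_left]
  have h1 : (1 + PowerSeries.C (1 / 2) * PowerSeries.X : PowerSeries ℂ) =
      PowerSeries.C (1 / 2) * (1 + pw 1) := by
    rw [hX]; linear_combination (-1 : PowerSeries ℂ) * h2
  have h3 : pw 1 * pw (-1) = 1 := by rw [← pw_add, add_neg_cancel, pw_zero]
  rw [h1, hX, commCoeff, sub_self, pw_zero]
  rcases lt_trichotomy j 0 with hj | rfl | hj
  · have h := expCoeffInt_logOdd (v := pw 1) (n := -j) (by omega)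
    rw [expCoeffInt, expCoeffInt, if_neg (not_le.2 hj), sub_zero, mul_assoc, ← expCoeffInt]
    rw [pw_pow, Int.toNat_of_nonneg (by omega), mul_one, Int.negOnePow_neg] at h
    rw [h]
    linear_combination (pw 1 - 1) * (((j.negOnePow : ℤ) : PowerSeries ℂ) * pw (-j) - 1) * h2
  · simp [expCoeffInt, expCoeff_zero, pw_zero]
  · have h := expCoeffInt_logOdd (v := pw (-1)) hj
    rw [expCoeffInt, expCoeffInt, if_neg (by omega), zero_sub, ← expCoeffInt]
    rw [pw_pow, Int.toNat_of_nonneg (by omega), mul_neg_one] at h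
    set H := expCoeffInt (logOdd (pw (-1))) j
    set E := ((j.negOnePow : ℤ) : PowerSeries ℂ) * pw (-j)
    linear_combination (-PowerSeries.C (1 / 2) * pw 1) * h +
      (PowerSeries.C (1 / 2) * H - 2 * PowerSeries.C (1 / 2) * (E - 1)) * h3 +
      (pw 1 - 1) * (E - 1) * h2

/-- This identity and `commCoeff_add` are what closes the family `commDefect` under commutators with
`∂_i` and `t_i`. -/
theorem commCoeff_sub (i : ℕ) (j r : ℤ) : commCoeff j r = commCoeff (j - (2 * i + 1)) r +
    (pw (2 * i + 1) - 1) * commCoeff j (r + (2 * i + 1)) := by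
  have h1 : (r + (2 * i + 1)).negOnePow = -r.negOnePow := by
    rw [Int.negOnePow_add, Int.negOnePow_odd _ (odd_two_mul_add_one _), mul_neg_one]
  rw [commCoeff, commCoeff, commCoeff, h1, show -(j - (2 * i + 1)) = (2 * i + 1) + -j by ring,
    show j - (2 * i + 1) - r = j - (r + (2 * i + 1)) by ring, pw_add,
    show j - r = (2 * i + 1) + (j - (r + (2 * i + 1))) by ring, pw_add]
  push_cast
  ring

theorem commCoeff_add (i : ℕ) (j r : ℤ) : commCoeff j r = commCoeff (j + (2 * i + 1)) r +
    (pw (-(2 * i + 1)) - 1) * commCoeff j (r - (2 * i + 1)) := by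
  have h1 : (r - (2 * i + 1)).negOnePow = -r.negOnePow := by
    rw [Int.negOnePow_sub, Int.negOnePow_odd _ (odd_two_mul_add_one _), mul_neg_one]
  rw [commCoeff, commCoeff, commCoeff, h1, show -(j + (2 * i + 1)) = -(2 * i + 1) + -j by ring,
    show j + (2 * i + 1) - r = j - (r - (2 * i + 1)) by ring, pw_add,
    show j - r = -(2 * i + 1) + (j - (r - (2 * i + 1))) by ring, pw_add]
  push_cast
  ring

/-- The Leibniz rule for commutators with `P`, to be used with `P = ∂_i` or `P = t_i`; the elements
`h`, `z`, `c`, `φ₁`, `φ₂` are central scalar series. -/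
theorem commutator_aux {A : Type*} [Ring A] {P V V₁ X X₁ W W₁ h z c φ₁ φ₂ : A}
    (hV : P * V = V * P + z * V₁) (hX : P * X = X * P + z * c * X₁) (hW : P * W = W * P + z * W₁)
    (hh : ∀ F, F * h = h * F) (hz : ∀ F, F * z = z * F) (hc : ∀ F, F * c = c * F)
    (h₁ : ∀ F, F * φ₁ = φ₁ * F) (h₂ : ∀ F, F * φ₂ = φ₂ * F) :
    P * (h * (V * X - X * V) - (φ₁ + c * φ₂) * W) =
      (h * (V * X - X * V) - (φ₁ + c * φ₂) * W) * P + z * (h * (V₁ * X - X * V₁) - φ₁ * W₁) +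
        z * c * (h * (V * X₁ - X₁ * V) - φ₂ * W₁) := by
  linear_combination (norm := noncomm_ring) hh P * (V * X - X * V) + h * hV * X + h * V * hX -
    h * hX * V - h * X * hV + h * hz V * c * X₁ + h * z * hc V * X₁ - h * hz X * V₁ -
    hh z * (V₁ * X - X * V₁) * 1 - z * hh c * (V * X₁ - X₁ * V) - hh z * c * (V * X₁ - X₁ * V) -
    h₁ P * W - hc P * φ₂ * W - c * h₂ P * W - φ₁ * hW - c * φ₂ * hW +
    h₁ z * W₁ + hc z * φ₂ * W₁ + c * h₂ z * W₁

variable (R) in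
/-- The deviation from the commutation relation of `V(z)` with the vertex operator. -/
def commDefect (a : ℤ × ℤ) : EndSeries R :=
  sc R (1 + PowerSeries.C (1 / 2) * PowerSeries.X) *
      (cs (V a.1) * vertexOp R a.2 - vertexOp R a.2 * cs (V a.1)) -
    sc R (PowerSeries.X * commCoeff a.1 a.2) * cs (V (a.1 - a.2))

theorem coeff_commDefect (j r : ℤ) (m : ℕ) (f : TimeFn R) :
    PowerSeries.coeff m (commDefect R (j, r)) f =
      ∑ x ∈ antidiagonal m,
        PowerSeries.coeff x.1 (1 + PowerSeries.C (1 / 2) * PowerSeries.X : PowerSeries ℂ) •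
        (V j (KOpL (vertexKer x.2) r f) - KOpL (vertexKer x.2) r (V j f)) -
      PowerSeries.coeff m (PowerSeries.X * commCoeff j r) • V (j - r) f := by
  have h : PowerSeries.coeff m (sc R (PowerSeries.X * commCoeff j r) * cs (V (j - r))) =
      PowerSeries.coeff m (PowerSeries.X * commCoeff j r) • V (j - r) := by
    rw [cs, PowerSeries.coeff_mul_C, sc, PowerSeries.coeff_map, ← Algebra.smul_def]
  rw [commDefect, map_sub, LinearMap.sub_apply, coeff_sc_mul, h]
  congr 1
  refine Finset.sum_congr rfl fun x _ => ?_
  rw [map_sub, LinearMap.sub_apply, cs, PowerSeries.coeff_C_mul, PowerSeries.coeff_mul_C, vertexOp,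
    PowerSeries.coeff_mk]
  rfl

/-- The commutation relation between `V(z)` and `X(λ,μ)`. Both sides have the same commutators with
all `t_i` and `∂_i`, so `endSeries_eq_zero` reduces the claim to the vacuum values in
`vev_commCoeff`. -/
theorem commDefect_eq_zero (a : ℤ × ℤ) : commDefect R a = 0 := by
  refine endSeries_eq_zero (commDefect R) ?_ ?_ ?_ ?_ a
  · rintro ⟨j, r⟩ m
    simp only [coeff_commDefect]
    refine Continuous.sub (continuous_finsetSum _ fun x _ => ?_)
      ((continuous_csmul _).comp (continuous_V _))
    exact (continuous_csmul _).comp (((continuous_V j).comp (continuous_KOp _ r)).sub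
      ((continuous_KOp _ r).comp (continuous_V j)))
  · rintro ⟨j, r⟩ i
    refine ⟨1, 1 * (pw (2 * i + 1) - 1), (j - (2 * i + 1), r), (j, r + (2 * i + 1)), ?_⟩
    have h0 : sc R (PowerSeries.X * commCoeff j r) =
        sc R (PowerSeries.X * commCoeff (j - (2 * i + 1)) r) + sc R (pw (2 * i + 1) - 1) *
          sc R (PowerSeries.X * commCoeff j (r + (2 * i + 1))) := by
      rw [commCoeff_sub i j r, ← map_mul, ← map_add]
      congr 1; ring
    simp only [commDefect]
    rw [h0, show j - (2 * i + 1) - r = j - r - (2 * i + 1) by ring,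
      show j - (r + (2 * i + 1)) = j - r - (2 * i + 1) by ring]
    rw [map_mul (sc R) 1]
    refine commutator_aux ?_ ?_ ?_ (sc_mul_comm _) (sc_mul_comm _) (sc_mul_comm _) (sc_mul_comm _)
      (sc_mul_comm _)
    · rw [map_one, one_mul]; exact pd_V i j
    · rw [map_one, one_mul]; exact pd_vertexOp i r
    · rw [map_one, one_mul]; exact pd_V i (j - r)
  · rintro ⟨j, r⟩ i
    refine ⟨PowerSeries.C (-(-2 / (2 * i + 1) : ℂ)),
      PowerSeries.C (-(-2 / (2 * i + 1) : ℂ)) * (pw (-(2 * i + 1)) - 1),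
      (j + (2 * i + 1), r), (j, r - (2 * i + 1)), ?_⟩
    have hneg : ∀ (z : ℂ) (F : EndSeries R),
        sc R (PowerSeries.C (-z)) * F = -(sc R (PowerSeries.C z) * F) := fun z F => by
      rw [map_neg, map_neg]; exact neg_mul (sc R (PowerSeries.C z)) F
    have h0 : sc R (PowerSeries.X * commCoeff j r) =
        sc R (PowerSeries.X * commCoeff (j + (2 * i + 1)) r) + sc R (pw (-(2 * i + 1)) - 1) *
          sc R (PowerSeries.X * commCoeff j (r - (2 * i + 1))) := by
      rw [commCoeff_add i j r, ← map_mul, ← map_add]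
      congr 1; ring
    simp only [commDefect]
    rw [h0, show j + (2 * i + 1) - r = j - r + (2 * i + 1) by ring,
      show j - (r - (2 * i + 1)) = j - r + (2 * i + 1) by ring, map_mul (sc R) (PowerSeries.C _)]
    refine commutator_aux ?_ ?_ ?_ (sc_mul_comm _) (sc_mul_comm _) (sc_mul_comm _) (sc_mul_comm _)
      (sc_mul_comm _)
    · rw [V_t, hneg, sub_eq_add_neg]
    · rw [vertexOp_t, PowerSeries.smul_eq_C_mul, map_mul, mul_assoc, mul_assoc, hneg,
        sub_eq_add_neg]
    · rw [V_t, hneg, sub_eq_add_neg]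
  · rintro ⟨j, r⟩ m
    rw [coeff_commDefect, map_sub, map_sum, coeff_csmul]
    simp only [coeff_csmul, map_sub, KOpL_apply, vev_V_vertex, vev_vertex_V]
    rw [V_one, coeff_zero_schur]
    by_cases h : j = r
    · subst h
      simp only [if_true, sub_self, ← map_sub, Algebra.smul_def, ← map_mul, mul_one]
      rw [← map_sum, ← PowerSeries.coeff_mul, vev_commCoeff, ← map_sub, sub_self, map_zero]
    · simp [h, sub_ne_zero.2 h]

end Commutator

/-! ### Commuting `V(z)` past the generators of `W^B_∞`. -/

section Generators

variable {R : Type} [CommRing R] [Algebra ℂ R]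

variable (R) in
/-- The operator `Z_s^{(p+1)}/(p+1)`. -/
def genZ (p s : ℕ) : TimeFn R →ₗ[R] TimeFn R :=
  (p.factorial : ℂ) • (KOpL (vertexKer (p + 1)) (s - p) +
    (if p = 0 then 0 else (1 / 2 : ℂ)) • KOpL (vertexKer p) (s - p))

theorem genZ_apply (p s : ℕ) (f : TimeFn R) : genZ R p s f =
    (p.factorial : ℂ) • (KOp (vertexKer (p + 1)) (s - p) f +
      (if p = 0 then 0 else (1 / 2 : ℂ)) • KOp (vertexKer p) (s - p) f) := rfl

theorem continuous_genZ (p s : ℕ) : Continuous (genZ R p s) :=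
  (continuous_csmul _).comp ((continuous_KOp _ _).add
    ((continuous_csmul _).comp (continuous_KOp _ _)))

theorem shiftOp_zero (f : TimeFn R) : shiftOp 0 f = f := by
  refine (shiftOp_hasSum 0 f).unique ?_
  convert! hasSum_single (f := fun β : ℕ →₀ ℕ => if (wt β : ℤ) = 0 then
      (β.prod fun i b => (-2 / (2 * i + 1) : ℂ) ^ b / (b.factorial : ℂ)) • timeDeriv β f else 0)
      0 ?_ using 1
  · simp [timeDeriv_zero]
  · intro β hβ
    obtain ⟨i, hi⟩ := Finsupp.ne_iff.1 hβ
    obtain ⟨δ, rfl⟩ := eq_add_single hi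
    rw [wt_add_single, if_neg (by push_cast; omega)]

theorem smul_opZ (p s : ℕ) (f : TimeFn R) : ((p : ℂ) + 1)⁻¹ • opZ p s f = genZ R p s f := by
  have h1 : ((p : ℂ) + 1) ≠ 0 := Nat.cast_add_one_ne_zero p
  rw [genZ_apply, opZ, opW, opW, if_neg p.succ_ne_zero, vertexMode_eq_KOp, vertexMode_eq_KOp,
    smul_add, smul_add, smul_smul, Nat.factorial_succ]
  congr 1
  · congr 1
    push_cast
    field_simp
  · split_ifs
    · rw [smul_zero, smul_zero, zero_smul, smul_zero]
    · rw [smul_smul, smul_smul, smul_smul]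
      congr 1
      field_simp

theorem negOnePow_mul_choose_neg (j : ℤ) (p : ℕ) :
    (p.factorial : ℤ) * Ring.choose (-j) p = (-1) ^ p * Op.fallFact (j - 1 + p) p := by
  rw [Ring.choose_neg, Op.fallFact, Units.smul_def, smul_eq_mul, ← Int.coe_negOnePow_natCast,
    show j + p - 1 = j - 1 + p by ring]
  ring

/-- The right side of the commutation relation is divisible by `u`. Thus the convention `W^{(0)} =
0`, which comes from subtracting `1` from `X`, leaves the commutators unchanged. -/
theorem V_vertex_zero (j r : ℤ) (f : TimeFn R) :
    V j (KOp (vertexKer 0) r f) = KOp (vertexKer 0) r (V j f) := by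
  have h := coeff_commDefect (R := R) j r 0 f
  rw [commDefect_eq_zero, Finset.Nat.antidiagonal_zero, Finset.sum_singleton] at h
  simp only [map_zero, LinearMap.zero_apply, PowerSeries.coeff_zero_eq_constantCoeff, map_add,
    map_mul, map_one, PowerSeries.constantCoeff_X, mul_zero, zero_mul, add_zero, one_smul,
    zero_smul, sub_zero, KOpL_apply] at h
  exact (sub_eq_zero.1 h.symm)

theorem V_vertex_succ (j r : ℤ) (p : ℕ) (f : TimeFn R) :
    V j (KOp (vertexKer (p + 1)) r f) - KOp (vertexKer (p + 1)) r (V j f) +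
      (1 / 2 : ℂ) • (V j (KOp (vertexKer p) r f) - KOp (vertexKer p) r (V j f)) =
      ((r.negOnePow : ℤ) * Ring.choose (-j) p - Ring.choose (j - r) p : ℤ) • V (j - r) f := by
  have h := coeff_commDefect (R := R) j r (p + 1) f
  rw [commDefect_eq_zero, map_zero, LinearMap.zero_apply, eq_comm, sub_eq_zero] at h
  have hc : ∀ n : ℕ, PowerSeries.coeff (n + 1)
      (1 + PowerSeries.C (1 / 2) * PowerSeries.X : PowerSeries ℂ) = if n = 0 then 1 / 2 else 0 := by
    intro n
    rw [map_add, PowerSeries.coeff_C_mul, PowerSeries.coeff_X, PowerSeries.coeff_one,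
      if_neg n.succ_ne_zero, zero_add]
    simp
  have hc0 : PowerSeries.coeff 0 (1 + PowerSeries.C (1 / 2) * PowerSeries.X : PowerSeries ℂ) = 1 := by
    simp
  rw [Finset.Nat.sum_antidiagonal_succ, hc0, one_smul, Finset.sum_eq_single (0, p),
    PowerSeries.coeff_succ_X_mul, commCoeff, map_sub, ← zsmul_eq_mul, map_zsmul, coeff_pw, coeff_pw,
    hc, if_pos rfl] at h
  · refine h.trans ?_
    rw [zsmul_eq_mul, ← Int.cast_mul, ← Int.cast_sub, Int.cast_smul_eq_zsmul]
  · intro x hx hne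
    rw [hc, if_neg, zero_smul]
    intro h0
    have := mem_antidiagonal.1 hx
    exact hne (Prod.ext h0 (by omega))
  · intro hne
    exact absurd (mem_antidiagonal.2 (zero_add p)) hne

/-- The coefficient of `u^{p+1}` in the commutation relation, with the binomials turned into falling
factorials. The factor is exactly the one in `mode_orlovB`. -/
theorem V_genZ (p s : ℕ) (j : ℤ) (f : TimeFn R) : V j (genZ R p s f) = genZ R p s (V j f) -
    (Op.fallFact (j - s + p) p - (-1) ^ s * Op.fallFact (j - 1 + p) p) • V (j - s + p) f := by
  have h := V_vertex_succ j (s - p) p f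
  have h0 : (1 / 2 : ℂ) • (V j (KOp (vertexKer p) (s - p) f) - KOp (vertexKer p) (s - p) (V j f)) =
      (if p = 0 then 0 else (1 / 2 : ℂ)) •
        (V j (KOp (vertexKer p) (s - p) f) - KOp (vertexKer p) (s - p) (V j f)) := by
    split_ifs with hp
    · rw [hp, V_vertex_zero, sub_self, smul_zero, smul_zero]
    · rfl
  rw [h0] at h
  have hs : ∀ (z : ℂ) (g : TimeFn R), V j (z • g) = z • V j g := fun z g =>
    LinearMap.map_smul_of_tower _ _ _
  have h2 : ((s : ℤ) - p).negOnePow = (-1) ^ s * (-1) ^ p := by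
    rw [Int.negOnePow_sub]
    rfl
  have h3 : (p.factorial : ℤ) *
      (((s : ℤ) - p).negOnePow * Ring.choose (-j) p - Ring.choose (j - (s - p)) p) =
      -(Op.fallFact (j - s + p) p - (-1) ^ s * Op.fallFact (j - 1 + p) p) := by
    have h4 := negOnePow_mul_choose_neg j p
    have h5 : ((-1 : ℤ) ^ p) * (-1) ^ p = 1 := by rw [← mul_pow]; simp
    rw [h2, Op.fallFact, show j - (s - p) = j - s + p by ring]
    push_cast
    linear_combination (-1 : ℤ) ^ s * (-1) ^ p * h4 +
      (-1 : ℤ) ^ s * Op.fallFact (j - 1 + p) p * h5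
  have h6 : V j (genZ R p s f) - genZ R p s (V j f) =
      (-(Op.fallFact (j - s + p) p - (-1) ^ s * Op.fallFact (j - 1 + p) p)) •
        V (j - s + p) f := by
    rw [← h3, mul_smul, show j - (s : ℤ) + p = j - (s - p) by ring, ← h, genZ_apply, genZ_apply, hs,
      map_add, hs, ← smul_sub, Nat.cast_smul_eq_nsmul, natCast_zsmul]
    congr 1
    rw [smul_sub]
    abel
  rw [sub_eq_add_neg, ← neg_smul, ← h6, add_sub_cancel]

end Generators

/-! ### The Adler–Shiota–van Moerbeke formula. -/

section MainIdentity

variable {R : Type} [CommRing R] [Algebra ℂ R]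

namespace Op

/-- The operator `M^p L^s - (-1)^s L^{s-1} M^p L`. -/
def orlovB (φ ψ : Op R) (p s : ℕ) : Op R :=
  φ * gam ^ p * d s * ψ - (-1 : ℤ) ^ s • (φ * d (s - 1) * gam ^ p * d 1 * ψ)

variable {φ ψ : Op R}

theorem Dressing.orlovB_apply (h : Dressing φ ψ) {Φ : PsiDO R} (hφ : φ.1 = Φ) (hψ : ψ.1 = inv Φ)
    (p s : ℕ) : (orlovB φ ψ p s).1 = opB Φ p s := by
  have hM : orlov Φ = (φ * gam * ψ).1 := by rw [coe_mul, coe_mul, hφ, hψ]; rfl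
  have hL : ∀ n, laxPow Φ n = (φ * d n * ψ).1 := fun n => by rw [coe_mul, coe_mul, hφ, hψ]; rfl
  have hp : ∀ (A : Op R) (n : ℕ), (φ * A * ψ) ^ n = φ * A ^ n * ψ := fun A n => by
    induction n with
    | zero => rw [pow_zero, pow_zero, mul_one, h.mul_inv]
    | succ n ih =>
      rw [pow_succ, ih, pow_succ]
      linear_combination (norm := noncomm_ring) φ * A ^ n * h.inv_mul * A * ψ
  rw [opB, hM, hL, hL, hL, ← coe_pow, hp, ← coe_mul, ← coe_mul, ← coe_mul]
  have h1 : φ * gam ^ p * ψ * (φ * d s * ψ) = φ * gam ^ p * d s * ψ := by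
    linear_combination (norm := noncomm_ring) φ * gam ^ p * h.inv_mul * d s * ψ
  have h2 : φ * d (s - 1) * ψ * (φ * gam ^ p * ψ) * (φ * d 1 * ψ) =
      φ * d (s - 1) * gam ^ p * d 1 * ψ := by
    linear_combination (norm := noncomm_ring)
      φ * d (s - 1) * h.inv_mul * gam ^ p * ψ * φ * d 1 * ψ +
      φ * d (s - 1) * gam ^ p * h.inv_mul * d 1 * ψ
  rw [h1, h2]
  rfl

/-- In `B_{p,s} φ` the inverse dressing cancels, and `Γ_B` and `∂` next to `e^ξ` become `∂_z` and
`z`. The falling factorials are those of `z^s ∂_z^p` and `z ∂_z^p z^{s-1}`. -/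
theorem Dressing.mode_orlovB (h : Dressing φ ψ) (p s : ℕ) (j : ℤ) :
    mode (orlovB φ ψ p s * φ).1 j =
      (fallFact (j - s + p) p - (-1) ^ s * fallFact (j - 1 + p) p) • mode φ.1 (j - s + p) := by
  have h1 : orlovB φ ψ p s * φ = φ * gam ^ p * d s - (-1 : ℤ) ^ s • (φ * d (s - 1) * gam ^ p * d 1) := by
    rw [orlovB, sub_mul, smul_mul_assoc, mul_assoc _ ψ, mul_assoc _ ψ, h.inv_mul, mul_one, mul_one]
  have h2 : mode ((-1 : ℤ) ^ s • (φ * d (s - 1) * gam ^ p * d 1)).1 j =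
      (-1 : ℤ) ^ s • mode (φ * d (s - 1) * gam ^ p * d 1).1 j := by
    obtain ⟨c, hc⟩ := ((-1 : ℤ) ^ s • (φ * d (s - 1) * gam ^ p * d 1)).exists_adm
    obtain ⟨e, he⟩ := (φ * d (s - 1) * gam ^ p * d 1).exists_adm
    refine (mode_hasSum hc j).unique (((mode_hasSum he j).const_smul ((-1 : ℤ) ^ s)).congr_fun
      fun m => ?_)
    exact mul_smul_comm ((-1 : ℤ) ^ s) _ _
  rw [h1, mode_sub, h2, mode_mul_d, mode_mul_gam_pow, mode_mul_d, mode_mul_gam_pow, mode_mul_d,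
    smul_smul, show j - 1 + (p : ℤ) - (s - 1) = j - s + p by ring, ← sub_smul]

/-- If `∑_j (-1)^j E_j(t) Φ_{-j}(t')` is a function of `t` only, for the modes of `E` and `Φ`, then
`E Φ⁻¹` minus that function has no terms of nonpositive order. -/
theorem Dressing.apply_eq_zero_of_bilinear (h : Dressing φ ψ) {E : Op R} {f : TimeFn R}
    (hE : ∀ β, HasSum (fun j : ℤ => (j.negOnePow : ℤ) • (coeff β (mode φ.1 (-j)) • mode E.1 j))
      (if β = 0 then f else 0)) (n : ℕ) : ((E - fn f * φ) * ψ).1 (-n) = 0 := by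
  refine apply_eq_zero_of_d_mul (fun n => ?_) n
  have h1 : ∀ β, HasSum (fun j : ℤ => (j.negOnePow : ℤ) •
      (coeff β (mode φ.1 (-j)) • mode (d n * E).1 j)) (if β = 0 then dx n f else 0) := fun β => by
    have h2 := (hE β).map (dxL n) ((continuous_dx n).congr fun f => (dxL_apply n f).symm)
    have h3 : dxL n (if β = 0 then f else 0) = if β = 0 then dx n f else 0 := by
      split_ifs
      · exact dxL_apply n f
      · exact map_zero _
    rw [h3] at h2
    refine h2.congr_fun fun j => ?_
    rw [Function.comp_apply, map_zsmul, map_smul, dxL_apply, mode_d_mul]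
  -- Setting `t' = t` in the differentiated identity turns it into a pairing, hence into the
  -- constant term of `∂^n E ψ`.
  have h3 : pair (d n * E).1 φ.1 = dx n f := by
    obtain ⟨c, hc⟩ := (d n * E).exists_adm
    have h4 := pair_eq_modes hc (Adm.of_order_le h.ordLE)
    ext α
    have h5 : ∀ x : (ℕ →₀ ℕ) × (ℕ →₀ ℕ),
        (Function.support fun j : ℤ => coeff x.1 ((j.negOnePow : ℤ) •
          (coeff x.2 (mode φ.1 (-j)) • mode (d n * E).1 j))).Finite ∧
        coeff x.1 (if x.2 = 0 then dx n f else 0) = ∑ᶠ j : ℤ, coeff x.1 ((j.negOnePow : ℤ) •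
          (coeff x.2 (mode φ.1 (-j)) • mode (d n * E).1 j)) :=
      fun x => timeFn_hasSum_coeff (h1 x.2) x.1
    have h6 : ∀ (j : ℤ), coeff α ((j.negOnePow : ℤ) • (mode (d n * E).1 j * mode φ.1 (-j))) =
        ∑ x ∈ antidiagonal α, coeff x.1 ((j.negOnePow : ℤ) •
          (coeff x.2 (mode φ.1 (-j)) • mode (d n * E).1 j)) := fun j => by
      rw [map_zsmul, MvPowerSeries.coeff_mul, Finset.smul_sum]
      refine Finset.sum_congr rfl fun x _ => ?_
      rw [map_zsmul, MvPowerSeries.coeff_smul, mul_comm]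
    obtain ⟨F, hF⟩ : ∃ F : ℤ → (ℕ →₀ ℕ) × (ℕ →₀ ℕ) → R, F = fun j x =>
      coeff x.1 ((j.negOnePow : ℤ) • (coeff x.2 (mode φ.1 (-j)) • mode (d n * E).1 j)) := ⟨_, rfl⟩
    have h7 : ∀ x : (ℕ →₀ ℕ) × (ℕ →₀ ℕ), (Function.support fun j => F j x).Finite ∧
        coeff x.1 (if x.2 = 0 then dx n f else 0) = ∑ᶠ j : ℤ, F j x := by rw [hF]; exact h5
    have h8 : ∀ j : ℤ, coeff α ((j.negOnePow : ℤ) • (mode (d n * E).1 j * mode φ.1 (-j))) =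
        ∑ x ∈ antidiagonal α, F j x := by rw [hF]; exact h6
    rw [(timeFn_hasSum_coeff h4 α).2, finsum_congr h8,
      finsum_sum_comm (antidiagonal α) F fun x _ => (h7 x).1, Finset.sum_eq_single (α, 0)]
    · rw [← (h7 (α, 0)).2, if_pos rfl]
    · intro x hx hne
      rw [← (h7 x).2, if_neg, map_zero]
      intro h0
      have := mem_antidiagonal.1 hx
      exact hne (Prod.ext (by rw [← this, h0, add_zero]) h0)
    · intro hne
      exact absurd (mem_antidiagonal.2 (add_zero α)) hne
  have h5 : d n * ((E - fn f * φ) * ψ) = d n * E * ψ - d n * fn f := by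
    rw [sub_mul, mul_assoc _ φ, h.mul_inv, mul_one, mul_sub, mul_assoc]
  have h6 : (d n * E * ψ).1 0 = dx n f := by
    rw [← h.pair_mul, mul_assoc _ ψ, h.inv_mul, mul_one, h3]
  rw [h5]
  change (d n * E * ψ).1 0 - (d n * fn f).1 0 = 0
  rw [h6, d_mul_fn_apply_zero, sub_self]

/-- The negative part of `M^p L^s - (-1)^s L^{s-1} M^p L`, when `g = Z_s^{(p+1)} τ/(p+1)`. -/
def defect (φ ψ : Op R) (σ g : TimeFn R) : Op R := (fn (σ * g) * φ - fn σ * sh g) * ψ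

theorem Dressing.ordLE_sub (h : Dressing φ ψ) (σ g : TimeFn R) :
    OrdLE (-1) (fn (σ * g) * φ - fn σ * sh g) := fun j hj => by
  change (fn (σ * g) * φ).1 j - (fn σ * sh g).1 j = 0
  rw [fn_mul_apply, fn_mul_apply]
  rcases (show 0 ≤ j by omega).eq_or_lt with rfl | hj
  · rw [h.monic, mul_one, sub_eq_zero]
    change _ = σ * shiftOp (-0) g
    rw [neg_zero, shiftOp_zero]
  · rw [h.ordLE j hj, ordLE_sh g j hj, mul_zero, mul_zero, sub_zero]

theorem Dressing.ordLE_defect (h : Dressing φ ψ) (σ g : TimeFn R) :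
    OrdLE (-1) (defect φ ψ σ g) :=
  ((h.ordLE_sub σ g).mul h.ordLE_inv).mono (by norm_num)

variable {τ σ : TimeFn R}

/-- By `V_genZ` and `mode_orlovB` the operator `E` has modes `σ Z(τ w_j)/(p+1)`, where `σ = 1/τ`.
Hence `B_{p,s} - defect` has no terms of nonpositive order; since `defect` has order at most `-1`,
it is the negative part. -/
theorem Dressing.neg_orlovB (h : Dressing φ ψ) (hτ : sh τ = fn τ * φ) (hσ : σ * τ = 1) (p s : ℕ) :
    neg (orlovB φ ψ p s) = defect φ ψ σ (genZ R p s τ) := by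
  set g := genZ R p s τ
  set E : Op R := fn σ * sh g + orlovB φ ψ p s * φ
  have hV : ∀ j, V j τ = τ * mode φ.1 j := fun j => by rw [V_apply, hτ, mode_fn_mul]
  have hE : ∀ j, mode E.1 j = σ * genZ R p s (V j τ) := fun j => by
    obtain ⟨c, hc⟩ := (fn σ * sh g).exists_adm
    obtain ⟨e, he⟩ := (orlovB φ ψ p s * φ).exists_adm
    refine (mode_add hc he j).trans ?_
    rw [mode_fn_mul, h.mode_orlovB, ← V_apply, V_genZ, mul_sub, hV, mul_smul_comm, hV, ← mul_assoc σ τ,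
      hσ, one_mul, sub_add_cancel]
  have key := h.apply_eq_zero_of_bilinear (E := E) (f := σ * g) fun β => by
    -- The generator acts in `t` only and is linear over `R`, so it passes through the coefficients
    -- in `t'` of the bilinear identity.
    have h1 := (((h.bilinear β).mul_left τ).map (genZ R p s) (continuous_genZ p s)).mul_left σ
    refine HasSum.congr_fun (f := fun j : ℤ => σ * genZ R p s (τ * ((j.negOnePow : ℤ) • (coeff β (mode φ.1 (-j)) • mode φ.1 j))))
      ?_ fun j => ?_
    · convert! h1 using 1
      split_ifs
      · rw [mul_one]
      · rw [mul_zero, map_zero, mul_zero]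
    · rw [hE, hV, mul_smul_comm, mul_smul_comm, map_zsmul, map_smul, mul_smul_comm, mul_smul_comm]
  have h2 : (E - fn (σ * g) * φ) * ψ = orlovB φ ψ p s - defect φ ψ σ g := by
    have h3 : E = fn σ * sh g + orlovB φ ψ p s * φ := rfl
    rw [defect]
    linear_combination (norm := noncomm_ring) orlovB φ ψ p s * h.mul_inv + h3 * ψ
  rw [h2] at key
  ext j : 2
  change (if j < 0 then _ else _) = _
  split_ifs with hj
  · have h3 := key (-j).toNat
    rw [Int.toNat_of_nonneg (by omega), neg_neg] at h3
    exact sub_eq_zero.1 h3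
  · rw [h.ordLE_defect σ g j (by omega)]

end Op

end MainIdentity

/-! ### Shift invariance forces constancy. -/

section Constants

variable {R : Type} [CommRing R] [Algebra ℂ R]

theorem timeDeriv_mul_of_pderiv_eq_zero {f : TimeFn R} (g : TimeFn R) (β : ℕ →₀ ℕ)
    (h : ∀ i, β i ≠ 0 → pderiv R i f = 0) : timeDeriv β (f * g) = f * timeDeriv β g := by
  induction β using finsupp_single_induction with
  | h0 => rw [timeDeriv_zero, timeDeriv_zero]
  | h β i ih =>
    rw [timeDeriv_add_single, ih fun j hj => h j (by
      rw [Finsupp.add_apply]; omega), Derivation.leibniz, h i (by simp), smul_zero, add_zero,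
      timeDeriv_add_single, smul_eq_mul]

/-- In the coefficient of `z^{-(2i+1)}`, every multi-index other than the single `t_{2i+1}` involves
only variables of smaller index, on which `f` does not depend by induction. What remains is a
nonzero multiple of `τ ∂_i f`, and `τ` is invertible. -/
theorem pderiv_eq_zero_of_shiftOp {f τ : TimeFn R} (hτ : IsUnit τ)
    (h : ∀ n : ℤ, shiftOp n (f * τ) = f * shiftOp n τ) (i : ℕ) : pderiv R i f = 0 := by
  induction i using Nat.strong_induction_on with
  | _ i ih =>
    have h1 := ((shiftOp_hasSum (2 * i + 1) (f * τ)).sub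
      ((shiftOp_hasSum (2 * i + 1) τ).mul_left f))
    rw [h, sub_self] at h1
    have h2 := h1.unique (hasSum_single (Finsupp.single i 1) fun β hβ => ?_)
    · have h3 : wt (Finsupp.single i 1) = 2 * i + 1 := by
        rw [← zero_add (Finsupp.single i 1), wt_add_single, map_zero, zero_add]
      rw [h3, if_pos (by push_cast; rfl), if_pos (by push_cast; rfl), Algebra.mul_smul_comm,
        ← smul_sub, timeDeriv_single, timeDeriv_single, Derivation.leibniz, smul_eq_mul,
        smul_eq_mul, add_sub_cancel_left, Finsupp.prod_single_index (by simp)] at h2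
      have h4 : (-2 / (2 * (i : ℂ) + 1)) ^ 1 / ((Nat.factorial 1 : ℕ) : ℂ) ≠ 0 := by
        have h5 : ((2 * i + 1 : ℕ) : ℂ) ≠ 0 := Nat.cast_ne_zero.2 (by omega)
        push_cast at h5
        simp [h5]
      have h6 : τ * pderiv R i f = 0 := by
        have := congrArg (fun g : TimeFn R =>
          ((-2 / (2 * (i : ℂ) + 1)) ^ 1 / ((Nat.factorial 1 : ℕ) : ℂ))⁻¹ • g) h2
        simpa only [smul_zero, smul_smul, inv_mul_cancel₀ h4, one_smul, eq_comm] using this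
      exact hτ.mul_right_eq_zero.1 h6
    · split_ifs with hw
      · rw [timeDeriv_mul_of_pderiv_eq_zero τ β fun k hk => ih k ?_, Algebra.mul_smul_comm, sub_self]
        obtain ⟨δ, rfl⟩ := eq_add_single hk
        rw [wt_add_single] at hw
        by_contra hki
        have hδ : wt δ = 0 := by push_cast at hw; omega
        have hk' : k = i := by push_cast at hw; omega
        refine hβ ?_
        have : δ = 0 := by
          by_contra h0
          obtain ⟨m, hm⟩ := Finsupp.ne_iff.1 h0
          obtain ⟨ε, rfl⟩ := eq_add_single hm
          rw [wt_add_single] at hδ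
          omega
        rw [this, hk', zero_add]
      · rw [mul_zero, sub_zero]

theorem eq_C_of_pderiv_eq_zero {f : TimeFn R} (h : ∀ i, pderiv R i f = 0) :
    f = C (MvPowerSeries.constantCoeff f) := by
  have := isAddTorsionFree_of_complex R
  refine MvPowerSeries.pderiv.ext (fun i => ?_) (by simp)
  rw [h, MvPowerSeries.pderiv_C]

theorem shiftOp_C_mul (n : ℤ) (c : R) (f : TimeFn R) : shiftOp n (C c * f) = C c * shiftOp n f := by
  rw [← MvPowerSeries.smul_eq_C_mul, ← MvPowerSeries.smul_eq_C_mul]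
  exact KOp_smul _ _ _ _

end Constants

/-! ### Passing to convergence in the topology of the coefficient ring. -/

section Transfer

variable {R : Type} [CommRing R] [TopologicalSpace R] [IsTopologicalRing R]

/-- A linear map that is continuous for coefficientwise stabilisation preserves coefficientwise
sums. -/
theorem hasSum_coeff_map {ι : Type*} {F : ι → TimeFn R} {G : TimeFn R}
    {T : TimeFn R →ₗ[R] TimeFn R} (hT : Continuous T)
    (h : ∀ α, HasSum (fun a => coeff α (F a)) (coeff α G)) (α : ℕ →₀ ℕ) :
    HasSum (fun a => coeff α (T (F a))) (coeff α (T G)) := by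
  classical
  obtain ⟨A, hA⟩ := exists_finset_of_continuous T.toAddMonoidHom hT α
  -- A coefficient of `T f` is a fixed finite linear combination of coefficients of `f`, so
  -- continuity of the ring operations is enough.
  have key : ∀ f : TimeFn R,
      coeff α (T f) = ∑ δ ∈ A, coeff α (T (monomial δ 1)) * coeff δ f := fun f => by
    have h1 : coeff α (T (f - ∑ δ ∈ A, coeff δ f • monomial δ (1 : R))) = 0 := by
      refine hA _ fun δ hδ => ?_
      rw [map_sub, map_sum, Finset.sum_eq_single δ, MvPowerSeries.coeff_smul,
        MvPowerSeries.coeff_monomial_same, mul_one, sub_self]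
      · intro ε _ hε
        rw [MvPowerSeries.coeff_smul, MvPowerSeries.coeff_monomial_ne hε.symm, mul_zero]
      · exact fun hn => absurd hδ hn
    rw [map_sub, map_sub, sub_eq_zero, map_sum, map_sum] at h1
    rw [h1]
    refine Finset.sum_congr rfl fun δ _ => ?_
    rw [map_smul, MvPowerSeries.coeff_smul, mul_comm]
  rw [key G]
  exact (hasSum_sum fun δ _ => (h δ).mul_left (coeff α (T (monomial δ 1)))).congr_fun
    fun a => key (F a)

end Transfer

/-! ### The quantum torus flow. -/

section Flow

variable {R : Type} [CommRing R] [Algebra ℂ R]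

namespace Op

variable (φ ψ : Op R) (σ : TimeFn R)

/-- The coefficients of `defect` as linear maps. -/
def defectL (j : ℤ) : TimeFn R →ₗ[R] TimeFn R :=
  ∑ x ∈ Finset.Icc j (-1) ×ˢ Finset.range ((-j).toNat), Ring.choose x.1 x.2 •
    (LinearMap.mulRight R (dx x.2 (ψ.1 (j - x.1 + x.2))) ∘ₗ
      (LinearMap.mulLeft R (σ * φ.1 x.1) - LinearMap.mulLeft R σ ∘ₗ KOpL shiftKer (-x.1)))

theorem continuous_defectL (j : ℤ) : Continuous (defectL φ ψ σ j) := by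
  have h : (defectL φ ψ σ j : TimeFn R → TimeFn R) = fun g =>
      ∑ x ∈ Finset.Icc j (-1) ×ˢ Finset.range ((-j).toNat), Ring.choose x.1 x.2 •
        ((σ * φ.1 x.1 * g - σ * KOpL shiftKer (-x.1) g) * dx x.2 (ψ.1 (j - x.1 + x.2))) := by
    funext g
    rw [defectL, LinearMap.sum_apply]
    rfl
  rw [h]
  refine continuous_finsetSum _ fun x _ => ?_
  have h1 : Continuous fun g : TimeFn R => (σ * φ.1 x.1 * g - σ * KOpL shiftKer (-x.1) g) *
      dx x.2 (ψ.1 (j - x.1 + x.2)) :=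
    ((continuous_const.mul continuous_id).sub
      (continuous_const.mul (continuous_KOp _ _))).mul continuous_const
  exact h1.const_smul (Ring.choose x.1 x.2)

variable {φ ψ σ}

theorem Dressing.defect_apply (h : Dressing φ ψ) (g : TimeFn R) (j : ℤ) :
    (defect φ ψ σ g).1 j = defectL φ ψ σ j g := by
  refine (mul_hasSum _ ψ j).unique ?_
  rw [defectL, LinearMap.sum_apply]
  have h1 : ∀ p, (fn (σ * g) * φ - fn σ * sh g).1 p =
      (LinearMap.mulLeft R (σ * φ.1 p) - LinearMap.mulLeft R σ ∘ₗ KOpL shiftKer (-p)) g := fun p => by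
    change (fn (σ * g) * φ).1 p - (fn σ * sh g).1 p = _
    rw [fn_mul_apply, fn_mul_apply, mul_right_comm]
    rfl
  convert! hasSum_sum_of_ne_finset_zero (L := .unconditional _) (f := compTerm
    (fn (σ * g) * φ - fn σ * sh g).1 ψ.1 j) (s := Finset.Icc j (-1) ×ˢ Finset.range ((-j).toNat))
    ?_ using 1
  · refine Finset.sum_congr rfl fun x _ => ?_
    rw [compTerm, h1]
    rfl
  · rintro ⟨p, n⟩ hx
    rw [Finset.mem_product, Finset.mem_Icc, Finset.mem_range] at hx
    simp only [compTerm]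
    by_cases hp : p ≤ -1
    · rw [h.ordLE_inv _ (by simp only at hx; omega), dx_map_zero, mul_zero, smul_zero]
    · rw [h.ordLE_sub σ g p (by omega), zero_mul, smul_zero]

end Op

theorem IsTau.sh_eq {Φ : PsiDO R} {τ : TimeFn R} (hτ : IsTau Φ τ) {φ : Op R} (hφ : φ.1 = Φ) :
    Op.sh τ = Op.fn τ * φ := by
  ext j : 2
  rw [Op.fn_mul_apply, hφ]
  refine Eq.trans ?_ (hτ.2 j).symm
  change shiftOp (-j) τ = _
  split_ifs with hj
  · rw [shiftCoeff_eq, Int.toNat_of_nonneg (by omega)]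
  · exact shiftOp_neg (by omega) τ

/-- Because `φ = σ sh τ`, vanishing of the flow says that `σ g` commutes with the shift applied to
`τ`, that is, `g/τ` is shift invariant. -/
theorem Op.Dressing.torusFlow {φ ψ : Op R} (h : Op.Dressing φ ψ) {σ τ : TimeFn R}
    (hτ : Op.sh τ = Op.fn τ * φ) (hσ : σ * τ = 1) (g : TimeFn R) :
    -(Op.defect φ ψ σ g * φ) = 0 ↔ ∃ c : R, g = C c * τ := by
  have hφ : φ = Op.fn σ * Op.sh τ := by
    rw [hτ, ← mul_assoc, Op.fn_mul_fn, hσ, Op.fn_one, one_mul]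
  have hu : IsUnit τ := IsUnit.of_mul_eq_one_right σ hσ
  have hg : σ * g * τ = g := by rw [mul_right_comm, hσ, one_mul]
  have h1 : Op.defect φ ψ σ g * φ = Op.fn (σ * g) * φ - Op.fn σ * Op.sh g := by
    rw [Op.defect, mul_assoc, h.inv_mul, mul_one]
  have h2 : ∀ j, (Op.fn (σ * g) * φ - Op.fn σ * Op.sh g).1 j =
      σ * (σ * g * shiftOp (-j) τ - shiftOp (-j) g) := fun j => by
    change (Op.fn (σ * g) * φ).1 j - (Op.fn σ * Op.sh g).1 j = _
    rw [Op.fn_mul_apply, Op.fn_mul_apply, hφ, Op.fn_mul_apply]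
    change σ * g * (σ * shiftOp (-j) τ) - σ * shiftOp (-j) g = _
    ring
  rw [neg_eq_zero, h1]
  constructor
  · intro h3
    have h4 : ∀ n : ℤ, shiftOp n (σ * g * τ) = σ * g * shiftOp n τ := fun n => by
      have h5 := h2 (-n)
      rw [h3, neg_neg] at h5
      have h6 : τ * σ * (σ * g * shiftOp n τ - shiftOp n g) = 0 := by
        rw [mul_assoc, ← h5]; exact mul_zero τ
      rw [mul_comm τ, hσ, one_mul, sub_eq_zero] at h6
      rw [hg, h6]
    exact ⟨_, by rw [← eq_C_of_pderiv_eq_zero (pderiv_eq_zero_of_shiftOp hu h4), hg]⟩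
  · rintro ⟨c, rfl⟩
    ext j : 2
    rw [h2, shiftOp_C_mul, mul_left_comm σ (C c), hσ, mul_one, sub_self, mul_zero]
    rfl

/-- The formula for the negative parts is summed over `(p,s)` through `defectL`. Only negative
orders are compared: `negPart` discards the others, whose series need not converge. -/
theorem termD_summable_and_torusFlow_iff [TopologicalSpace R] [IsTopologicalRing R] [T2Space R]
    (logq : ℂ) (l k : ℕ) {Φ : PsiDO R} (hΦ : IsDressing Φ) {τ : TimeFn R} (hτ : IsTau Φ τ)
    (hconv : ∀ α : ℕ →₀ ℕ, Summable (termLB logq l k τ α)) :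
    (∀ j : ℤ, j < 0 → ∀ α : ℕ →₀ ℕ, Summable (termD logq Φ l k j α)) ∧
      (torusFlowWave logq Φ l k = 0 ↔ ∃ c : R, opLB logq l k τ = C c * τ) := by
  obtain ⟨φ, ψ, hφ, hψ, h⟩ := hΦ.exists_op
  obtain ⟨σ, hσ⟩ := hτ.1.exists_left_inv
  have hsh := hτ.sh_eq hφ
  have h1 : ∀ α, HasSum (fun a : ℕ × ℕ =>
      coeff α (torusCoeff logq l k a • genZ R a.1 a.2 τ)) (coeff α (opLB logq l k τ)) := fun α => by
    refine (hconv α).hasSum.congr_fun fun a => ?_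
    rw [termLB, smul_opZ]
    rfl
  have h2 : ∀ j : ℤ, j < 0 → ∀ α, HasSum (termD logq Φ l k j α)
      (coeff α ((Op.defect φ ψ σ (opLB logq l k τ)).1 j)) := fun j hj α => by
    rw [h.defect_apply]
    refine (hasSum_coeff_map (Op.continuous_defectL φ ψ σ j) h1 α).congr_fun fun a => ?_
    have h3 : opB Φ a.1 a.2 j = Op.defectL φ ψ σ j (genZ R a.1 a.2 τ) := by
      rw [← h.defect_apply, ← h.neg_orlovB hsh hσ, ← h.orlovB_apply hφ hψ]
      exact (if_pos hj).symm
    rw [termD, h3, LinearMap.map_smul_of_tower]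
    rfl
  refine ⟨fun j hj α => (h2 j hj α).summable, ?_⟩
  rw [← h.torusFlow hsh hσ]
  have h3 : negPart (opD logq Φ l k) = (Op.defect φ ψ σ (opLB logq l k τ)).1 := by
    funext j
    rw [negPart]
    split_ifs with hj
    · exact MvPowerSeries.ext fun α => (h2 j hj α).tsum_eq
    · exact (h.ordLE_defect σ _ j (by omega)).symm
  have h5 : torusFlowWave logq Φ l k = (-(Op.defect φ ψ σ (opLB logq l k τ) * φ)).1 := by
    rw [torusFlowWave, h3, ← hφ]
    rfl
  rw [h5]
  exact ⟨fun h4 => Subtype.ext h4, fun h4 => congrArg Subtype.val h4⟩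

end Flow

end CMBKP

end

theorem mainTheorem5 (N : ℕ) (hN : 0 < N) (q logq : ℂ) (hq : Complex.exp logq = q) (l k : ℕ)
    (Φ : CMBKP.PsiDO (CMBKP.ZN N)) (hΦ : CMBKP.IsDressing Φ)
    (τ : CMBKP.TimeFn (CMBKP.ZN N)) (hτ : CMBKP.IsTau Φ τ)
    (hconv : ∀ α : ℕ →₀ ℕ, Summable (CMBKP.termLB logq l k τ α)) :
    (∀ j : ℤ, j < 0 → ∀ α : ℕ →₀ ℕ, Summable (CMBKP.termD logq Φ l k j α)) ∧
    (CMBKP.torusFlowWave logq Φ l k = 0 ↔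
      ∃ c : CMBKP.ZN N, CMBKP.opLB logq l k τ = MvPowerSeries.C c * τ) := by
  -- The operations on `Z_N` are restrictions of the continuous matrix operations.
  have : IsTopologicalRing (CMBKP.ZN N) :=
    { continuous_add := ((continuous_subtype_val.comp continuous_fst).add
        (continuous_subtype_val.comp continuous_snd)).subtype_mk _
      continuous_mul := ((continuous_subtype_val.comp continuous_fst).matrix_mul
        (continuous_subtype_val.comp continuous_snd)).subtype_mk _
      continuous_neg := continuous_subtype_val.neg.subtype_mk _ }
  exact CMBKP.termD_summable_and_torusFlow_iff logq l k hΦ hτ hconv
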